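/- **Setting.** Let $T>0$, $n,l,m,r\in\mathbb{N}$, let $\psi_i:[0,T]\times\mathbb{R}^n\to\mathbb{R}$ ($i=1,\dots,r$) be continuous, and for $t\in[0,T]$ let $C(t)=\{x\in\mathbb{R}^n:\psi_i(t,x)\le 0,\ i=1,\dots,r\}$. Let $\mathrm{Gr}\,C=\{(t,x): t\in[0,T],\,x\in C(t)\}$ and $\mathcal{I}^0_{(t,x)}=\{i:\psi_i(t,x)=0\}$. Let $N_{C(t)}(x)$ be the Clarke normal cone to $C(t)$ at $x$ (the polar of the Clarke tangent cone; $N_{C(t)}(x)=\emptyset$ if $x\notin C(t)$). Let $f:[0,T]\times\mathbb{R}^n\times\mathbb{R}^l\times\mathbb{R}^m\to\mathbb{R}^n$, $g:[0,T]\times\mathbb{R}^n\times\mathbb{R}^l\times\mathbb{R}^m\to\mathbb{R}^l$, $h=(f,g)$, and let $U:[0,T]\rightsquigarrow\mathbb{R}^m$ be a set-valued map. A control is a Lebesgue measurable $u:[0,T]\to\mathbb{R}^m$ with $u(t)\in U(t)$ for a.e. $t$. Norms are Euclidean, $B$ and $\bar B$ are the open and closed unit balls. For $(x_0,y_0)\in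 C(0)\times\mathbb{R}^l$ and a control $u$, a solution of $(D)$ is a pair $(x,y)\in W^{1,1}([0,T];\mathbb{R}^n\times\mathbb{R}^l)$ with $(x(0),y(0))=(x_0,y_0)$ and, for a.e. $t\in[0,T]$, $$\dot x(t)\in f(t,x(t),y(t),u(t))-N_{C(t)}(x(t)),\qquad \dot y(t)=g(t,x(t),y(t),u(t)).$$ For $\gamma\in\mathbb{R}$ and $c\in\mathbb{R}^n$, a solution of $(D_\gamma)$ starting at $(c,y_0)$ is a pair $(x,y)\in W^{1,1}([0,T];\mathbb{R}^n\times\mathbb{R}^l)$ with $(x(0),y(0))=(c,y_0)$ and, for a.e. $t\in[0,T]$, $$\dot x(t)=f(t,x(t),y(t),u(t))-\sum_{i=1}^r\gamma e^{\gamma\psi_i(t,x(t))}\nabla_x\psi_i(t,x(t)),\qquad \dot y(t)=g(t,x(t),y(t),u(t)).$$ **Theorem.** Assume that $C(t)\neq\emptyset$ for every $t\in[0,T]$, that $\mathrm{Gr}\,C$ is bounded, and that the following hold. * $(A3.1)_G$: there are $\rho_o,L_\psi>0$ such that, for each $i$, $\nabla_x\psi_i$ exists on $\mathrm{Gr}\,C+\{0\}\times\rho_oB$,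 and for all $(t_1,x_1),(t_2,x_2)\in\mathrm{Gr}\,C+\{0\}\times\frac{\rho_o}{2}\bar B$, $$\max\{|\psi_i(t_1,x_1)-\psi_i(t_2,x_2)|,\ \|\nabla_x\psi_i(t_1,x_1)-\nabla_x\psi_i(t_2,x_2)\|\}\le L_\psi(|t_1-t_2|+\|x_1-x_2\|).$$ * $(A3.2)_G$: for every $(t,x)\in\mathrm{Gr}\,C$, if $\lambda_i\ge0$ for $i\in\mathcal{I}^0_{(t,x)}$ and $\sum_{i\in\mathcal{I}^0_{(t,x)}}\lambda_i\nabla_x\psi_i(t,x)=0$, then $\lambda_i=0$ for all $i\in\mathcal{I}^0_{(t,x)}$. * $(A4.1)_G$: for all $x\in\bigcup_{t}C(t)$, $y\in\mathbb{R}^l$, $u\in\bigcup_tU(t)$ the function $h(\cdot,x,y,u)$ is Lebesgue measurable on $[0,T]$; for a.e. $t$, $h(t,\cdot,\cdot,\cdot)$ is continuous on $C(t)\times\mathbb{R}^l\times U(t)$; and there are $M_h>0$ and a nonnegative $L_h\in L^2([0,T])$ such that, for a.e. $t$, all $(x,y),(x',y')\in C(t)\times\mathbb{R}^l$ and all $u\in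 U(t)$, $\|h(t,x,y,u)\|\le M_h$ and $\|h(t,x,y,u)-h(t,x',y',u)\|\le L_h(t)\|(x,y)-(x',y')\|$. Let $(x_0,y_0)\in C(0)\times\mathbb{R}^l$ and let $u$ be a control such that, for all $(x,y)\in\mathbb{R}^n\times\mathbb{R}^l$, the function $t\mapsto h(t,x,y,u(t))$ is Lebesgue measurable on $\{t\in[0,T]:x\in C(t)\}$ (this is automatic if, for example, $U(\cdot)$ is constant). Then $(D)$ has a solution $(x,y)$, which is unique on $[0,T]$ and is Lipschitz. Moreover, for every real sequence $\gamma_k\to\infty$ there are points $c_k\to x_0$ in $\mathbb{R}^n$ and functions $(x_{\gamma_k},y_{\gamma_k})$ such that, for all $k$ large enough, $(x_{\gamma_k},y_{\gamma_k})$ is the unique solution of $(D_{\gamma_k})$ starting at $(c_k,y_0)$ and $x_{\gamma_k}(t)\in\mathrm{int}\,C(t)$ for all $t\in[0,T]$; and a subsequence of $(x_{\gamma_k},y_{\gamma_k})_k$ converges to $(x,y)$ uniformly on $[0,T]$. -/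

import Mathlib

open Set Filter Topology MeasureTheory

namespace CoupledSweeping

/-- Euclidean space `ℝᵈ` with its Euclidean norm and inner product. -/
abbrev E (d : ℕ) : Type := EuclideanSpace ℝ (Fin d)

/-! ### Clarke normal cone -/

/-- The Clarke tangent cone to `S` at `s` (sequential form): `v` is tangent when for all sequences
`z k → s` in `S` and `τ k → 0`, `τ k > 0`, there are `w k → v` with `z k + τ k • w k ∈ S`. -/
def clarkeTangentCone {n : ℕ} (S : Set (E n)) (s : E n) : Set (E n) :=
  {v | ∀ (z : ℕ → E n) (τ : ℕ → ℝ), (∀ k, z k ∈ S) → Tendsto z atTop (𝓝 s) →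
    (∀ k, 0 < τ k) → Tendsto τ atTop (𝓝 0) →
    ∃ w : ℕ → E n, Tendsto w atTop (𝓝 v) ∧ ∀ k, z k + τ k • w k ∈ S}

/-- The Clarke normal cone to `S` at `s`: the polar of the Clarke tangent cone if `s ∈ S`,
and the empty set if `s ∉ S`. -/
def clarkeNormalCone {n : ℕ} (S : Set (E n)) (s : E n) : Set (E n) :=
  {ξ | s ∈ S ∧ ∀ v ∈ clarkeTangentCone S s, inner ℝ ξ v ≤ 0}

/-! ### The moving set -/

/-- `C(t)`, the intersection of the zero-sublevel sets of `ψ₁(t,·), …, ψᵣ(t,·)`. -/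
def sweepSet {n r : ℕ} (ψ : Fin r → ℝ → E n → ℝ) (t : ℝ) : Set (E n) :=
  {x | ∀ i, ψ i t x ≤ 0}

/-- The graph of `C(·)` over `[0,T]`. -/
def sweepGraph {n r : ℕ} (T : ℝ) (ψ : Fin r → ℝ → E n → ℝ) : Set (ℝ × E n) :=
  {p | p.1 ∈ Icc 0 T ∧ p.2 ∈ sweepSet ψ p.1}

/-- The set of active indices at `(t,x)`. -/
def activeSet {n r : ℕ} (ψ : Fin r → ℝ → E n → ℝ) (t : ℝ) (x : E n) : Set (Fin r) :=
  {i | ψ i t x = 0}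

/-- The global regularity assumption on the generators: with constants `ρ, L > 0` common to all `i`,
the gradient in `x` of `ψ i` exists on `Gr C + {0} × ρB`, and `ψ i` and its gradient in `x`
are `L`-Lipschitz on `Gr C + {0} × (ρ/2)B̄` (`B`, `B̄` the open and the closed unit ball). -/
def GeneratorsRegular {n r : ℕ} (T : ℝ) (ψ : Fin r → ℝ → E n → ℝ) : Prop :=
  ∃ ρ L : ℝ, 0 < ρ ∧ 0 < L ∧ ∀ i,
    (∀ t ∈ Icc 0 T, ∀ x ∈ sweepSet ψ t, ∀ z ∈ Metric.ball x ρ, DifferentiableAt ℝ (ψ i t) z) ∧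
    (∀ t₁ ∈ Icc 0 T, ∀ x₁ ∈ sweepSet ψ t₁, ∀ z₁ ∈ Metric.closedBall x₁ (ρ / 2),
      ∀ t₂ ∈ Icc 0 T, ∀ x₂ ∈ sweepSet ψ t₂, ∀ z₂ ∈ Metric.closedBall x₂ (ρ / 2),
        |ψ i t₁ z₁ - ψ i t₂ z₂| ≤ L * (|t₁ - t₂| + ‖z₁ - z₂‖) ∧
        ‖gradient (ψ i t₁) z₁ - gradient (ψ i t₂) z₂‖ ≤ L * (|t₁ - t₂| + ‖z₁ - z₂‖))

/-- The global constraint qualification: at each point of `Gr C` the gradients of the active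
generators are positively linearly independent. -/
def ConstraintQualification {n r : ℕ} (T : ℝ) (ψ : Fin r → ℝ → E n → ℝ) : Prop :=
  ∀ t ∈ Icc 0 T, ∀ x ∈ sweepSet ψ t, ∀ c : Fin r → ℝ,
    (∀ i ∈ activeSet ψ t x, 0 ≤ c i) → (∀ i ∉ activeSet ψ t x, c i = 0) →
    ∑ i, c i • gradient (ψ i t) x = 0 → ∀ i ∈ activeSet ψ t x, c i = 0

/-! ### The perturbation `h = (f,g)` and the controls -/

/-- The Euclidean norm of the pair `(a,b) ∈ ℝⁿ × ℝˡ`. -/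
noncomputable def pairNorm {n l : ℕ} (a : E n) (b : E l) : ℝ := √(‖a‖ ^ 2 + ‖b‖ ^ 2)

/-- The global assumption on `h = (f,g)`, with `C(t)` the moving set and `U(t)` the control sets:
`h(·,x,y,u)` is Lebesgue measurable on `[0,T]` for `x ∈ ⋃ C(t)`, `y ∈ ℝˡ`, `u ∈ ⋃ U(t)`;
for a.e. `t`, `h(t,·,·,·)` is continuous on `C(t) × ℝˡ × U(t)`; and `h(t,·,·,u)` is bounded by a
constant `M` and `Lh(t)`-Lipschitz on `C(t) × ℝˡ` for a.e. `t` and all `u ∈ U(t)`, `Lh ∈ L²`. -/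
def PerturbationRegular {n l m r : ℕ} (T : ℝ) (ψ : Fin r → ℝ → E n → ℝ)
    (f : ℝ → E n → E l → E m → E n) (g : ℝ → E n → E l → E m → E l)
    (U : ℝ → Set (E m)) : Prop :=
  (∀ x ∈ ⋃ t ∈ Icc 0 T, sweepSet ψ t, ∀ y : E l, ∀ u ∈ ⋃ t ∈ Icc 0 T, U t,
    AEMeasurable (fun t => f t x y u) (volume.restrict (Icc 0 T)) ∧
    AEMeasurable (fun t => g t x y u) (volume.restrict (Icc 0 T))) ∧
  (∀ᵐ t ∂(volume.restrict (Icc 0 T)),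
    ContinuousOn (fun p : E n × E l × E m => f t p.1 p.2.1 p.2.2)
      (sweepSet ψ t ×ˢ univ ×ˢ U t) ∧
    ContinuousOn (fun p : E n × E l × E m => g t p.1 p.2.1 p.2.2)
      (sweepSet ψ t ×ˢ univ ×ˢ U t)) ∧
  ∃ (M : ℝ) (Lh : ℝ → ℝ), 0 < M ∧ (∀ t ∈ Icc 0 T, 0 ≤ Lh t) ∧
    MemLp Lh 2 (volume.restrict (Icc 0 T)) ∧
    ∀ᵐ t ∂(volume.restrict (Icc 0 T)), ∀ u ∈ U t, ∀ x ∈ sweepSet ψ t, ∀ y : E l,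
      pairNorm (f t x y u) (g t x y u) ≤ M ∧
      ∀ x' ∈ sweepSet ψ t, ∀ y' : E l,
        pairNorm (f t x y u - f t x' y' u) (g t x y u - g t x' y' u)
          ≤ Lh t * pairNorm (x - x') (y - y')

/-- The control functions: Lebesgue measurable `u` on `[0,T]` with `u(t) ∈ U(t)` a.e. -/
def IsControl {m : ℕ} (T : ℝ) (U : ℝ → Set (E m)) (u : ℝ → E m) : Prop :=
  AEMeasurable u (volume.restrict (Icc 0 T)) ∧ ∀ᵐ t ∂(volume.restrict (Icc 0 T)), u t ∈ U t

/-! ### Solutions -/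

/-- `z ∈ W^{1,1}([0,T]; ℝᵈ)` with derivative `v`: `v` is integrable on `[0,T]` and `z` is its
primitive there. -/
def HasL1Deriv {d : ℕ} (T : ℝ) (z v : ℝ → E d) : Prop :=
  IntegrableOn v (Icc 0 T) volume ∧ ∀ t ∈ Icc 0 T, z t = z 0 + ∫ s in (0 : ℝ)..t, v s

/-- `(x,y) ∈ W^{1,1}` solves the Cauchy problem of the coupled sweeping process `(D)`:
`x' ∈ f(t,x,y,u) - N_{C(t)}(x)`, `y' = g(t,x,y,u)` a.e. on `[0,T]`, `(x(0),y(0)) = (x₀,y₀)`.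
(Since the normal cone is empty off `C(t)`, the inclusion contains the state constraint.) -/
def IsSweepingSolution {n l m r : ℕ} (T : ℝ) (ψ : Fin r → ℝ → E n → ℝ)
    (f : ℝ → E n → E l → E m → E n) (g : ℝ → E n → E l → E m → E l) (u : ℝ → E m)
    (x₀ : E n) (y₀ : E l) (x : ℝ → E n) (y : ℝ → E l) : Prop :=
  x 0 = x₀ ∧ y 0 = y₀ ∧ ∃ (v : ℝ → E n) (w : ℝ → E l), HasL1Deriv T x v ∧ HasL1Deriv T y w ∧
    ∀ᵐ t ∂(volume.restrict (Icc 0 T)),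
      (∃ ξ ∈ clarkeNormalCone (sweepSet ψ t) (x t), v t = f t (x t) (y t) (u t) - ξ) ∧
      w t = g t (x t) (y t) (u t)

/-- `(x,y) ∈ W^{1,1}` solves the Cauchy problem of the exponential-penalty control system with
parameter `γ`:
`x' = f(t,x,y,u) - ∑ᵢ γ exp(γ ψᵢ(t,x)) ∇ₓψᵢ(t,x)`, `y' = g(t,x,y,u)` a.e. on `[0,T]`,
`(x(0),y(0)) = (x₀,y₀)`. -/
def IsPenaltySolution {n l m r : ℕ} (T : ℝ) (ψ : Fin r → ℝ → E n → ℝ)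
    (f : ℝ → E n → E l → E m → E n) (g : ℝ → E n → E l → E m → E l) (u : ℝ → E m)
    (γ : ℝ) (x₀ : E n) (y₀ : E l) (x : ℝ → E n) (y : ℝ → E l) : Prop :=
  x 0 = x₀ ∧ y 0 = y₀ ∧ ∃ (v : ℝ → E n) (w : ℝ → E l), HasL1Deriv T x v ∧ HasL1Deriv T y w ∧
    ∀ᵐ t ∂(volume.restrict (Icc 0 T)),
      v t = f t (x t) (y t) (u t)
        - ∑ i, (γ * Real.exp (γ * ψ i t (x t))) • gradient (ψ i t) (x t) ∧
      w t = g t (x t) (y t) (u t)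

end CoupledSweeping

/-!
The solution of the sweeping process is obtained as the limit of the penalized trajectories, with
all estimates made directly on the penalized system.

**Generators.** Since the graph of `C(·)` is compact, the constraint qualification holds uniformly:
at every point some direction of length at most one decreases all nearly active generators at a
common rate (`exists_uniformGenerators`). With a quadratic Taylor bound, this yields that Clarke
normals are hypomonotone, `⟪ξ, z - x⟫ ≤ c ‖ξ‖ ‖z - x‖²` for `z ∈ C(t)`
(`UniformGenerators.inner_clarkeNormalCone_le`), whence uniqueness for the sweeping process by
Grönwall's inequality with an `L¹` coefficient (`RegularField.sweeping_unique`).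

**Penalized system.** The fields are only given on `C(t)`. A McShane extension over a countable
dense set is Lipschitz in the state and still measurable in time, so that Picard iteration provides
a trajectory on `[0,T]`, which solves the given system as long as it stays in `C(t)`. The penalty
is the gradient of `S = ∑ᵢ exp(γ ψᵢ)`. When `γ S` exceeds a constant `K` independent of `γ`, the
nearly active generators dominate, and `S` decreases along trajectories; hence `γ S ≤ K` persists
(`RegularField.expSum_le_of_trajectory`). For `γ > K` this gives `ψᵢ < 0`, so that trajectories
remain in the interior and are unique. Initial points at distance of order `log γ / γ` from `x₀`
satisfy the bound at time `0`.

**Limit.** The multipliers `λᵢ = γ exp(γ ψᵢ)` are bounded by `K` and `-λᵢ ψᵢ = O(γ^{-1/2})`, so the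
penalty is approximately a proximal normal (`UniformGenerators.inner_expPenalty_le`), and the
penalized trajectories form a uniformly Cauchy sequence. No weak compactness is needed to identify
the limit: near a Lebesgue point, the penalty has almost nonpositive inner product with every
direction in which no active generator increases, and this passes to the derivative of the limit
(`isSolution_of_tendstoUniformlyOn`). By uniqueness all limits coincide.
-/

namespace CoupledSweeping

/-! ### Absolutely continuous functions and Grönwall's inequality -/

/-- A function dominated, increment by increment, by an absolutely continuous one is absolutely
continuous. -/
theorem absolutelyContinuousOnInterval_of_dist_le {X Y : Type*} [PseudoMetricSpace X]
    [PseudoMetricSpace Y] {f : ℝ → X} {g : ℝ → Y} {a b : ℝ} (K : ℝ)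
    (hg : AbsolutelyContinuousOnInterval g a b)
    (h : ∀ s ∈ uIcc a b, ∀ t ∈ uIcc a b, dist (f s) (f t) ≤ K * dist (g s) (g t)) :
    AbsolutelyContinuousOnInterval f a b := by
  have hg' := Tendsto.const_mul K hg
  rw [mul_zero] at hg'
  refine squeeze_zero' (Eventually.of_forall fun E => Finset.sum_nonneg fun _ _ => dist_nonneg)
    ?_ hg'
  have : ∀ᶠ E in AbsolutelyContinuousOnInterval.totalLengthFilter ⊓
      𝓟 (AbsolutelyContinuousOnInterval.disjWithin a b),
      E ∈ AbsolutelyContinuousOnInterval.disjWithin a b :=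
    eventually_inf_principal.mpr (by simp)
  filter_upwards [this] with E hE
  rw [Finset.mul_sum]
  exact Finset.sum_le_sum fun i hi => h _ (hE.1 i hi).1 _ (hE.1 i hi).2

theorem absolutelyContinuousOnInterval_contDiff_comp {φ : ℝ → ℝ} (hφ : ContDiff ℝ 1 φ)
    {f : ℝ → ℝ} {a b : ℝ} (hf : AbsolutelyContinuousOnInterval f a b) :
    AbsolutelyContinuousOnInterval (fun t => φ (f t)) a b := by
  obtain ⟨C, hC⟩ := hf.exists_bound
  obtain ⟨K, hK⟩ := hφ.contDiffOn.exists_lipschitzOnWith (by decide) (convex_Icc (-C) C)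
    isCompact_Icc
  exact absolutelyContinuousOnInterval_of_dist_le K hf fun s hs t ht =>
    hK.dist_le_mul _ (abs_le.1 (hC s hs)) _ (abs_le.1 (hC t ht))

/-- An absolutely continuous function grows by at most the integral of a bound on its
derivative. -/
theorem sub_le_integral_of_ae_deriv_le {φ c : ℝ → ℝ} {a b : ℝ} (hab : a ≤ b)
    (hφ : AbsolutelyContinuousOnInterval φ a b) (hc : IntervalIntegrable c volume a b)
    (h : ∀ᵐ t, t ∈ Ioo a b → ∀ d, HasDerivAt φ d t → d ≤ c t) :
    φ b - φ a ≤ ∫ t in a..b, c t := by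
  rw [← hφ.integral_deriv_eq_sub]
  refine intervalIntegral.integral_mono_ae_restrict hab hφ.intervalIntegrable_deriv hc ?_
  rw [restrict_Ioo_eq_restrict_Icc.symm, EventuallyLE, ae_restrict_iff' measurableSet_Ioo]
  filter_upwards [h, hφ.ae_differentiableAt] with t h1 h2 ht
  exact h1 ht _ (h2 (by rw [uIcc_of_le hab]; exact Ioo_subset_Icc_self ht)).hasDerivAt

/-- Grönwall's inequality for absolutely continuous functions, with an integrable coefficient. -/
theorem gronwall_of_ae_deriv_le {D α c : ℝ → ℝ} {b : ℝ} (hb : 0 ≤ b)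
    (hD : AbsolutelyContinuousOnInterval D 0 b)
    (hα : IntervalIntegrable α volume 0 b) (hα0 : ∀ t ∈ Icc 0 b, 0 ≤ α t)
    (hc : IntervalIntegrable c volume 0 b) (hc0 : ∀ t ∈ Icc 0 b, 0 ≤ c t)
    (h : ∀ᵐ t, t ∈ Ioo 0 b → ∀ d, HasDerivAt D d t → d ≤ α t * D t + c t) :
    D b ≤ (D 0 + ∫ t in (0 : ℝ)..b, c t) * Real.exp (∫ t in (0 : ℝ)..b, α t) := by
  set A : ℝ → ℝ := fun t => ∫ s in (0 : ℝ)..t, α s with hA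
  have hAac : AbsolutelyContinuousOnInterval A 0 b :=
    hα.absolutelyContinuousOnInterval_intervalIntegral (by simp)
  have hw : AbsolutelyContinuousOnInterval (fun t => D t * Real.exp (-A t)) 0 b :=
    hD.fun_mul (absolutelyContinuousOnInterval_contDiff_comp (φ := fun s => Real.exp (-s))
      (by fun_prop) hAac)
  have hA0 : ∀ t ∈ Icc 0 b, 0 ≤ A t := fun t ht =>
    intervalIntegral.integral_nonneg ht.1 fun s hs => hα0 s ⟨hs.1, hs.2.trans ht.2⟩
  have key := sub_le_integral_of_ae_deriv_le hb hw hc (by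
    filter_upwards [h, hα.ae_hasDerivAt_integral, hD.ae_differentiableAt] with t h1 h2 h3 ht d hd
    have htI : t ∈ Icc 0 b := Ioo_subset_Icc_self ht
    have htu : t ∈ uIcc 0 b := by rwa [uIcc_of_le hb]
    have hD' := (h3 htu).hasDerivAt
    have hA' := h2 htu 0 (by simp)
    have hw' := hD'.mul (hA'.neg.exp)
    rw [hd.unique hw']
    have e1 := h1 ht _ hD'
    have e2 : Real.exp (-A t) ≤ 1 := Real.exp_le_one_iff.2 (by linarith [hA0 t htI])
    have e3 := Real.exp_pos (-A t)
    have e4 := hc0 t htI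
    calc deriv D t * Real.exp (-A t) + D t * (Real.exp (-A t) * -α t)
        = (deriv D t - α t * D t) * Real.exp (-A t) := by ring
      _ ≤ c t * Real.exp (-A t) := by
          apply mul_le_mul_of_nonneg_right _ e3.le; linarith
      _ ≤ c t * 1 := by apply mul_le_mul_of_nonneg_left e2 e4
      _ = c t := mul_one _)
  have hA00 : A 0 = 0 := by simp [hA]
  simp only [hA00, neg_zero, Real.exp_zero, mul_one] at key
  have : D b = D b * Real.exp (-A b) * Real.exp (A b) := by
    rw [mul_assoc, ← Real.exp_add]; simp
  rw [this]
  apply mul_le_mul_of_nonneg_right _ (Real.exp_pos _).le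
  linarith

/-- A function whose derivative is nonpositive wherever it exceeds the level `K` stays
below `K`. -/
theorem le_of_ae_deriv_nonpos_above {φ : ℝ → ℝ} {a b K : ℝ} (hab : a ≤ b)
    (hφ : AbsolutelyContinuousOnInterval φ a b) (ha : φ a ≤ K)
    (h : ∀ᵐ t, t ∈ Ioo a b → K < φ t → ∀ d, HasDerivAt φ d t → d ≤ 0) : φ b ≤ K := by
  by_contra! hK
  -- the last time at which the level `K` is not exceeded
  set S : Set ℝ := {t | t ∈ Icc a b ∧ φ t ≤ K} with hS
  have hcont : ContinuousOn φ (Icc a b) := by simpa [uIcc_of_le hab] using hφ.continuousOn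
  have hSclosed : IsClosed S := hcont.preimage_isClosed_of_isClosed isClosed_Icc isClosed_Iic
  have hSb : BddAbove S := ⟨b, fun t ht => ht.1.2⟩
  have hmem : sSup S ∈ S := hSclosed.csSup_mem ⟨a, ⟨le_rfl, hab⟩, ha⟩ hSb
  set s := sSup S
  have hs : ∀ t, s < t → t ≤ b → K < φ t := by
    intro t h1 h2
    by_contra! h3
    exact absurd (le_csSup hSb ⟨⟨hmem.1.1.trans h1.le, h2⟩, h3⟩) (not_le.2 h1)
  have hsub : uIcc s b ⊆ uIcc a b := by
    rw [uIcc_of_le hmem.1.2, uIcc_of_le hab]; exact Icc_subset_Icc_left hmem.1.1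
  have := sub_le_integral_of_ae_deriv_le (c := fun _ => 0) hmem.1.2 (hφ.mono hsub) (by simp) (by
    filter_upwards [h] with t ht hts d hd
    exact ht ⟨hmem.1.1.trans_lt hts.1, hts.2⟩ (hs t hts.1 hts.2.le) d hd)
  simp at this
  linarith [hmem.2]

/-! ### Functions in `W^{1,1}` -/

theorem HasL1Deriv.intervalIntegrable {d : ℕ} {T : ℝ} {z v : ℝ → E d}
    (h : HasL1Deriv T z v) {a b : ℝ} (ha : a ∈ Icc 0 T) (hb : b ∈ Icc 0 T) :
    IntervalIntegrable v volume a b :=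
  (h.1.mono_set ((uIcc_subset_Icc ha hb))).intervalIntegrable

theorem HasL1Deriv.sub_eq_integral {d : ℕ} {T : ℝ} {z v : ℝ → E d}
    (h : HasL1Deriv T z v) {a b : ℝ} (ha : a ∈ Icc 0 T) (hb : b ∈ Icc 0 T) :
    z b - z a = ∫ s in a..b, v s := by
  have h0 : (0 : ℝ) ∈ Icc 0 T := ⟨le_rfl, ha.1.trans ha.2⟩
  rw [h.2 b hb, h.2 a ha, ← intervalIntegral.integral_interval_sub_left
    (h.intervalIntegrable h0 hb) (h.intervalIntegrable h0 ha)]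
  abel

theorem HasL1Deriv.absolutelyContinuousOnInterval {d : ℕ} {T : ℝ} (hT : 0 ≤ T) {z v : ℝ → E d}
    (h : HasL1Deriv T z v) : AbsolutelyContinuousOnInterval z 0 T := by
  have h0 : (0 : ℝ) ∈ Icc 0 T := ⟨le_rfl, hT⟩
  have hT' : T ∈ Icc 0 T := ⟨hT, le_rfl⟩
  have hN : IntervalIntegrable (fun s => ‖v s‖) volume 0 T := (h.intervalIntegrable h0 hT').norm
  refine absolutelyContinuousOnInterval_of_dist_le 1
    (hN.absolutelyContinuousOnInterval_intervalIntegral (c := 0) (by simp)) fun s hs t ht => ?_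
  rw [uIcc_of_le hT] at hs ht
  rw [dist_eq_norm, h.sub_eq_integral ht hs, one_mul, Real.dist_eq,
    intervalIntegral.integral_interval_sub_left ((h.intervalIntegrable h0 hs).norm)
      ((h.intervalIntegrable h0 ht).norm)]
  exact intervalIntegral.norm_integral_le_abs_integral_norm

theorem HasL1Deriv.continuousOn {d : ℕ} {T : ℝ} (hT : 0 ≤ T) {z v : ℝ → E d}
    (h : HasL1Deriv T z v) : ContinuousOn z (Icc 0 T) := by
  simpa [uIcc_of_le hT] using (h.absolutelyContinuousOnInterval hT).continuousOn

theorem HasL1Deriv.ae_hasDerivAt {d : ℕ} {T : ℝ} (hT : 0 ≤ T) {z v : ℝ → E d}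
    (h : HasL1Deriv T z v) : ∀ᵐ t, t ∈ Ioo 0 T → HasDerivAt z (v t) t := by
  have h0 : (0 : ℝ) ∈ Icc 0 T := ⟨le_rfl, hT⟩
  have hT' : T ∈ Icc 0 T := ⟨hT, le_rfl⟩
  filter_upwards [(h.intervalIntegrable h0 hT').ae_hasDerivAt_integral] with t ht htI
  have h1 := ht (by rw [uIcc_of_le hT]; exact Ioo_subset_Icc_self htI) 0 (by simp)
  refine (h1.const_add (z 0)).congr_of_eventuallyEq ?_
  filter_upwards [Ioo_mem_nhds htI.1 htI.2] with s hs
  exact h.2 s (Ioo_subset_Icc_self hs)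

theorem HasL1Deriv.sub {d : ℕ} {T : ℝ} {z v z' v' : ℝ → E d}
    (h : HasL1Deriv T z v) (h' : HasL1Deriv T z' v') :
    HasL1Deriv T (fun t => z t - z' t) (fun t => v t - v' t) := by
  refine ⟨h.1.sub h'.1, fun t ht => ?_⟩
  have h0 : (0 : ℝ) ∈ Icc 0 T := ⟨le_rfl, ht.1.trans ht.2⟩
  rw [intervalIntegral.integral_sub (h.intervalIntegrable h0 ht) (h'.intervalIntegrable h0 ht)]
  beta_reduce
  rw [h.2 t ht, h'.2 t ht]
  abel

theorem HasL1Deriv.mono {d : ℕ} {T b : ℝ} (hb : b ≤ T) {z v : ℝ → E d}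
    (h : HasL1Deriv T z v) : HasL1Deriv b z v :=
  ⟨h.1.mono_set (Icc_subset_Icc_right hb), fun t ht => h.2 t ⟨ht.1, ht.2.trans hb⟩⟩

theorem absolutelyContinuousOnInterval_norm_sq {F : Type*} [SeminormedAddCommGroup F] {a b : ℝ}
    {z : ℝ → F} (h : AbsolutelyContinuousOnInterval z a b) :
    AbsolutelyContinuousOnInterval (fun t => ‖z t‖ ^ 2) a b := by
  have h1 : AbsolutelyContinuousOnInterval (fun t => ‖z t‖) a b :=
    absolutelyContinuousOnInterval_of_dist_le 1 h fun s _ t _ => by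
      rw [one_mul, dist_eq_norm (z s), Real.dist_eq]; exact abs_norm_sub_norm_le _ _
  simpa only [pow_two] using h1.fun_mul h1

/-- A one-sided Lipschitz estimate for the velocities of two pairs of `W^{1,1}` functions bounds
the squared distance of the pairs. -/
theorem norm_sq_sub_le_of_oneSided {n l : ℕ} {b : ℝ} (hb : 0 ≤ b)
    {x v x' v' : ℝ → E n} {y w y' w' : ℝ → E l}
    (hx : HasL1Deriv b x v) (hx' : HasL1Deriv b x' v')
    (hy : HasL1Deriv b y w) (hy' : HasL1Deriv b y' w') {α c : ℝ → ℝ}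
    (hα : IntervalIntegrable α volume 0 b) (hα0 : ∀ t ∈ Icc 0 b, 0 ≤ α t)
    (hc : IntervalIntegrable c volume 0 b) (hc0 : ∀ t ∈ Icc 0 b, 0 ≤ c t)
    (h : ∀ᵐ t, t ∈ Ioo 0 b → 2 * (inner ℝ (x t - x' t) (v t - v' t)
      + inner ℝ (y t - y' t) (w t - w' t)) ≤
        α t * (‖x t - x' t‖ ^ 2 + ‖y t - y' t‖ ^ 2) + c t) :
    ∀ t ∈ Icc 0 b, ‖x t - x' t‖ ^ 2 + ‖y t - y' t‖ ^ 2 ≤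
      (‖x 0 - x' 0‖ ^ 2 + ‖y 0 - y' 0‖ ^ 2 + ∫ t in (0 : ℝ)..b, c t)
        * Real.exp (∫ t in (0 : ℝ)..b, α t) := by
  intro t ht
  have hsub : uIcc 0 t ⊆ uIcc 0 b := by
    rw [uIcc_of_le hb, uIcc_of_le ht.1]; exact Icc_subset_Icc_right ht.2
  have hX := hx.sub hx'
  have hY := hy.sub hy'
  have hac := (absolutelyContinuousOnInterval_norm_sq
    (hX.absolutelyContinuousOnInterval hb)).fun_add
    (absolutelyContinuousOnInterval_norm_sq (hY.absolutelyContinuousOnInterval hb))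
  have key := gronwall_of_ae_deriv_le ht.1 (hac.mono hsub) (hα.mono_set hsub)
    (fun s hs => hα0 s ⟨hs.1, hs.2.trans ht.2⟩) (hc.mono_set hsub)
    (fun s hs => hc0 s ⟨hs.1, hs.2.trans ht.2⟩) (by
      filter_upwards [h, hX.ae_hasDerivAt hb, hY.ae_hasDerivAt hb] with s h1 h2 h3 hs d hd
      have hs' : s ∈ Ioo 0 b := ⟨hs.1, hs.2.trans_le ht.2⟩
      rw [hd.unique ((h2 hs').norm_sq.add (h3 hs').norm_sq)]
      linarith [h1 hs'])
  refine key.trans ?_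
  have i1 : ∫ s in (0 : ℝ)..t, c s ≤ ∫ s in (0 : ℝ)..b, c s :=
    intervalIntegral.integral_mono_interval le_rfl ht.1 ht.2
      ((ae_restrict_iff' measurableSet_Ioc).2 (Eventually.of_forall fun s hs =>
        hc0 s (Ioc_subset_Icc_self hs))) hc
  have i2 : ∫ s in (0 : ℝ)..t, α s ≤ ∫ s in (0 : ℝ)..b, α s :=
    intervalIntegral.integral_mono_interval le_rfl ht.1 ht.2
      ((ae_restrict_iff' measurableSet_Ioc).2 (Eventually.of_forall fun s hs =>
        hα0 s (Ioc_subset_Icc_self hs))) hα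
  have i3 : 0 ≤ ∫ s in (0 : ℝ)..b, c s := intervalIntegral.integral_nonneg hb hc0
  gcongr

/-- Two pairs with the same initial values and a one-sided Lipschitz estimate for their velocities
coincide. -/
theorem eqOn_of_oneSided {n l : ℕ} {b : ℝ} (hb : 0 ≤ b)
    {x v x' v' : ℝ → E n} {y w y' w' : ℝ → E l}
    (hx : HasL1Deriv b x v) (hx' : HasL1Deriv b x' v')
    (hy : HasL1Deriv b y w) (hy' : HasL1Deriv b y' w') {α : ℝ → ℝ}
    (hα : IntervalIntegrable α volume 0 b) (hα0 : ∀ t ∈ Icc 0 b, 0 ≤ α t)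
    (h : ∀ᵐ t, t ∈ Ioo 0 b → 2 * (inner ℝ (x t - x' t) (v t - v' t)
      + inner ℝ (y t - y' t) (w t - w' t)) ≤
        α t * (‖x t - x' t‖ ^ 2 + ‖y t - y' t‖ ^ 2))
    (h0 : x 0 = x' 0) (h0' : y 0 = y' 0) :
    EqOn x x' (Icc 0 b) ∧ EqOn y y' (Icc 0 b) := by
  have key := norm_sq_sub_le_of_oneSided hb hx hx' hy hy' (c := fun _ => 0) hα hα0 (by simp)
    (by simp) (by simpa using h)
  simp only [h0, h0', sub_self, norm_zero, intervalIntegral.integral_zero] at key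
  have key' : ∀ t ∈ Icc 0 b, ‖x t - x' t‖ ^ 2 + ‖y t - y' t‖ ^ 2 ≤ 0 := by simpa using key
  constructor
  · intro t ht
    have h1 : ‖x t - x' t‖ ^ 2 = 0 :=
      le_antisymm (by linarith [key' t ht, sq_nonneg ‖y t - y' t‖]) (sq_nonneg _)
    exact sub_eq_zero.1 (norm_eq_zero.1 (pow_eq_zero_iff two_ne_zero |>.1 h1))
  · intro t ht
    have h1 : ‖y t - y' t‖ ^ 2 = 0 :=
      le_antisymm (by linarith [key' t ht, sq_nonneg ‖x t - x' t‖]) (sq_nonneg _)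
    exact sub_eq_zero.1 (norm_eq_zero.1 (pow_eq_zero_iff two_ne_zero |>.1 h1))

theorem HasL1Deriv.norm_sub_le {d : ℕ} {T : ℝ} {z v : ℝ → E d} (h : HasL1Deriv T z v) {B : ℝ}
    (hv : ∀ᵐ t, t ∈ Icc 0 T → ‖v t‖ ≤ B) {s t : ℝ} (hs : s ∈ Icc 0 T) (ht : t ∈ Icc 0 T) :
    ‖z t - z s‖ ≤ B * |t - s| := by
  rw [h.sub_eq_integral hs ht]
  refine intervalIntegral.norm_integral_le_of_norm_le_const_ae ?_
  filter_upwards [hv] with τ hτ hmem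
  exact hτ (uIcc_subset_Icc hs ht (uIoc_subset_uIcc hmem))

/-! ### Quantitative regularity of the generators -/

/-- The quantitative content of the assumptions on the generators, with constants valid on the
whole graph of the moving set: a common bound `L` for the Lipschitz constants and the gradients,
a quadratic bound `κ` on the first-order Taylor remainder from a point of `C(t)` to a `ρ`-close
point or to any other point of `C(t)`, and at each point a direction of length at most one along
which every generator with `ψᵢ ≥ -ε` decreases at rate at least `η`. -/
structure UniformGenerators {n r : ℕ} (T : ℝ) (ψ : Fin r → ℝ → E n → ℝ)
    (ρ L κ η ε : ℝ) : Prop where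
  ρ_pos : 0 < ρ
  L_pos : 0 < L
  κ_pos : 0 < κ
  η_pos : 0 < η
  ε_pos : 0 < ε
  hasGradientAt : ∀ i, ∀ t ∈ Icc 0 T, ∀ x ∈ sweepSet ψ t,
    HasGradientAt (ψ i t) (gradient (ψ i t) x) x
  norm_gradient_le : ∀ i, ∀ t ∈ Icc 0 T, ∀ x ∈ sweepSet ψ t, ‖gradient (ψ i t) x‖ ≤ L
  lipschitz : ∀ i, ∀ t₁ ∈ Icc 0 T, ∀ x₁ ∈ sweepSet ψ t₁, ∀ t₂ ∈ Icc 0 T, ∀ x₂ ∈ sweepSet ψ t₂,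
    |ψ i t₁ x₁ - ψ i t₂ x₂| ≤ L * (|t₁ - t₂| + ‖x₁ - x₂‖)
  gradient_lipschitz : ∀ i, ∀ t₁ ∈ Icc 0 T, ∀ x₁ ∈ sweepSet ψ t₁, ∀ t₂ ∈ Icc 0 T,
    ∀ x₂ ∈ sweepSet ψ t₂,
    ‖gradient (ψ i t₁) x₁ - gradient (ψ i t₂) x₂‖ ≤ L * (|t₁ - t₂| + ‖x₁ - x₂‖)
  time_lipschitz : ∀ i, ∀ t ∈ Icc 0 T, ∀ x ∈ sweepSet ψ t, ∀ t' ∈ Icc 0 T, ∀ x' ∈ sweepSet ψ t',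
    ‖x' - x‖ ≤ ρ → |ψ i t' x' - ψ i t x'| ≤ L * |t' - t|
  taylor_closedBall : ∀ i, ∀ t ∈ Icc 0 T, ∀ x ∈ sweepSet ψ t, ∀ z ∈ Metric.closedBall x ρ,
    |ψ i t z - ψ i t x - inner ℝ (gradient (ψ i t) x) (z - x)| ≤ κ * ‖z - x‖ ^ 2
  taylor : ∀ i, ∀ t ∈ Icc 0 T, ∀ x ∈ sweepSet ψ t, ∀ z ∈ sweepSet ψ t,
    |ψ i t z - ψ i t x - inner ℝ (gradient (ψ i t) x) (z - x)| ≤ κ * ‖z - x‖ ^ 2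
  inward : ∀ t ∈ Icc 0 T, ∀ x ∈ sweepSet ψ t, ∃ d : E n, ‖d‖ ≤ 1 ∧
    ∀ i, -ε ≤ ψ i t x → inner ℝ (gradient (ψ i t) x) d ≤ -η

/-- Gordan's alternative: finitely many positively independent vectors lie in a common open
half-space. -/
theorem exists_forall_inner_neg {n r : ℕ} (a : Fin r → E n) (A : Set (Fin r))
    (h : ∀ c : Fin r → ℝ, (∀ i ∈ A, 0 ≤ c i) → (∀ i ∉ A, c i = 0) → ∑ i, c i • a i = 0 →
      ∀ i ∈ A, c i = 0) :
    ∃ d : E n, ‖d‖ ≤ 1 ∧ ∃ η > 0, ∀ i ∈ A, inner ℝ (a i) d ≤ -η := by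
  set S : Set (Fin r → ℝ) := stdSimplex ℝ (Fin r) ∩ {c | ∀ i ∉ A, c i = 0} with hS
  set Φ : (Fin r → ℝ) →ₗ[ℝ] E n := ∑ i, (LinearMap.proj i : (Fin r → ℝ) →ₗ[ℝ] ℝ).smulRight (a i)
    with hΦ
  have hΦa : ∀ c, Φ c = ∑ i, c i • a i := by intro c; simp [hΦ]
  have hconv2 : Convex ℝ {c : Fin r → ℝ | ∀ i ∉ A, c i = 0} := by
    intro c hc c' hc' s t _ _ _ i hi
    simp [hc i hi, hc' i hi]
  have hclosed : IsClosed {c : Fin r → ℝ | ∀ i ∉ A, c i = 0} := by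
    simp only [Set.ofPred_forall]
    exact isClosed_iInter fun i => isClosed_iInter fun _ =>
      isClosed_eq (continuous_apply i) continuous_const
  have hScomp : IsCompact S := (isCompact_stdSimplex ℝ (Fin r)).inter_right hclosed
  have hSconv : Convex ℝ S := (convex_stdSimplex ℝ (Fin r)).inter hconv2
  have hK : IsCompact (Φ '' S) := hScomp.image Φ.continuous_of_finiteDimensional
  have hKc : Convex ℝ (Φ '' S) := hSconv.linear_image Φ
  have h0 : (0 : E n) ∉ Φ '' S := by
    rintro ⟨c, ⟨hc1, hc2⟩, hc0⟩
    have hz := h c (fun i _ => hc1.1 i) hc2 (by rw [← hΦa, hc0])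
    have : ∑ i, c i = 0 := Finset.sum_eq_zero fun i _ => by
      by_cases hi : i ∈ A
      exacts [hz i hi, hc2 i hi]
    exact zero_ne_one (this.symm.trans hc1.2)
  obtain ⟨f, u, hu0, hu⟩ := geometric_hahn_banach_point_closed hKc hK.isClosed h0
  rw [map_zero] at hu0
  set p := (InnerProductSpace.toDual ℝ (E n)).symm f
  have hp : ∀ z, inner ℝ p z = f z := fun z => InnerProductSpace.toDual_symm_apply
  have hN : 0 < ‖p‖ + 1 := by positivity
  refine ⟨-((‖p‖ + 1)⁻¹ • p), ?_, (‖p‖ + 1)⁻¹ * u, by positivity, fun i hi => ?_⟩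
  · rw [norm_neg, norm_smul, norm_inv, Real.norm_of_nonneg hN.le, inv_mul_le_iff₀ hN]
    linarith
  · have hmem : Pi.single i 1 ∈ S := by
      refine ⟨single_mem_stdSimplex ℝ i, fun j hj => ?_⟩
      rw [Pi.single_eq_of_ne]
      rintro rfl; exact hj hi
    have h1 := hu _ (mem_image_of_mem Φ hmem)
    have h2 : Φ (Pi.single i 1) = a i := by
      rw [hΦa, Finset.sum_eq_single i] <;> simp +contextual
    rw [h2, ← hp, real_inner_comm] at h1
    rw [inner_neg_right, inner_smul_right]
    exact neg_le_neg (mul_le_mul_of_nonneg_left h1.le (by positivity))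

theorem isCompact_sweepGraph {n r : ℕ} {T : ℝ} {ψ : Fin r → ℝ → E n → ℝ}
    (hψ : ∀ i, ContinuousOn (fun p : ℝ × E n => ψ i p.1 p.2) (Icc 0 T ×ˢ univ))
    (hbdd : Bornology.IsBounded (sweepGraph T ψ)) : IsCompact (sweepGraph T ψ) := by
  refine Metric.isCompact_of_isClosed_isBounded ?_ hbdd
  have : sweepGraph T ψ = (Icc 0 T ×ˢ univ) ∩
      ⋂ i, ((Icc 0 T ×ˢ univ) ∩ (fun p : ℝ × E n => ψ i p.1 p.2) ⁻¹' Iic 0) := by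
    ext p
    simp only [sweepGraph, sweepSet, mem_ofPred_eq, mem_inter_iff, mem_prod, mem_univ, and_true,
      mem_iInter, mem_preimage, mem_Iic]
    exact ⟨fun h => ⟨h.1, fun i => ⟨h.1, h.2 i⟩⟩, fun h => ⟨h.1, fun i => (h.2 i).2⟩⟩
  rw [this]
  have hcl : IsClosed (Icc 0 T ×ˢ (univ : Set (E n))) := isClosed_Icc.prod isClosed_univ
  exact hcl.inter (isClosed_iInter fun i =>
    (hψ i).preimage_isClosed_of_isClosed hcl isClosed_Iic)

/-- The constraint qualification is uniform on the compact graph of the moving set. -/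
theorem exists_uniform_inward {n r : ℕ} {T : ℝ} {ψ : Fin r → ℝ → E n → ℝ}
    (hcomp : IsCompact (sweepGraph T ψ)) {L : ℝ} (hL : 0 < L)
    (hlip : ∀ i, ∀ t₁ ∈ Icc 0 T, ∀ x₁ ∈ sweepSet ψ t₁, ∀ t₂ ∈ Icc 0 T, ∀ x₂ ∈ sweepSet ψ t₂,
      |ψ i t₁ x₁ - ψ i t₂ x₂| ≤ L * (|t₁ - t₂| + ‖x₁ - x₂‖))
    (hglip : ∀ i, ∀ t₁ ∈ Icc 0 T, ∀ x₁ ∈ sweepSet ψ t₁, ∀ t₂ ∈ Icc 0 T, ∀ x₂ ∈ sweepSet ψ t₂,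
      ‖gradient (ψ i t₁) x₁ - gradient (ψ i t₂) x₂‖ ≤ L * (|t₁ - t₂| + ‖x₁ - x₂‖))
    (hcq : ConstraintQualification T ψ) :
    ∃ η ε : ℝ, 0 < η ∧ 0 < ε ∧ ∀ t ∈ Icc 0 T, ∀ x ∈ sweepSet ψ t, ∃ d : E n, ‖d‖ ≤ 1 ∧
      ∀ i, -ε ≤ ψ i t x → inner ℝ (gradient (ψ i t) x) d ≤ -η := by
  have hsum : ∀ p q : ℝ × E n, L * (|p.1 - q.1| + ‖p.2 - q.2‖) ≤ (2 * L) * dist p q := by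
    intro p q
    have h1 : |p.1 - q.1| ≤ dist p q := by rw [← Real.dist_eq]; exact le_max_left _ _
    have h2 : ‖p.2 - q.2‖ ≤ dist p q := by rw [← dist_eq_norm]; exact le_max_right _ _
    nlinarith
  have hc : ∀ i, ContinuousOn (fun p : ℝ × E n => ψ i p.1 p.2) (sweepGraph T ψ) := fun i =>
    (LipschitzOnWith.of_dist_le_mul (K := ⟨2 * L, by positivity⟩) fun p hp q hq =>
      (hlip i _ hp.1 _ hp.2 _ hq.1 _ hq.2).trans (hsum p q)).continuousOn
  have hgc : ∀ i, ContinuousOn (fun p : ℝ × E n => gradient (ψ i p.1) p.2) (sweepGraph T ψ) :=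
    fun i => (LipschitzOnWith.of_dist_le_mul (K := ⟨2 * L, by positivity⟩) fun p hp q hq => by
      rw [dist_eq_norm]
      exact (hglip i _ hp.1 _ hp.2 _ hq.1 _ hq.2).trans (hsum p q)).continuousOn
  let P : Set (ℝ × E n) → Prop := fun s => ∃ η ε : ℝ, 0 < η ∧ 0 < ε ∧ ∀ p ∈ s,
    ∃ d : E n, ‖d‖ ≤ 1 ∧ ∀ i, -ε ≤ ψ i p.1 p.2 → inner ℝ (gradient (ψ i p.1) p.2) d ≤ -η
  have key : P (sweepGraph T ψ) := by
    refine hcomp.induction_on (p := P) ?_ ?_ ?_ ?_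
    · exact ⟨1, 1, one_pos, one_pos, fun p hp => hp.elim⟩
    · rintro s t hst ⟨η, ε, h1, h2, h⟩
      exact ⟨η, ε, h1, h2, fun p hp => h p (hst hp)⟩
    · rintro s t ⟨η, ε, h1, h2, h⟩ ⟨η', ε', h1', h2', h'⟩
      refine ⟨min η η', min ε ε', lt_min h1 h1', lt_min h2 h2', ?_⟩
      have m1 := min_le_left η η'
      have m2 := min_le_right η η'
      have m3 := min_le_left ε ε'
      have m4 := min_le_right ε ε'
      rintro p (hp | hp)
      · obtain ⟨d, hd, hd'⟩ := h p hp
        exact ⟨d, hd, fun i hi => (hd' i (by linarith)).trans (by linarith)⟩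
      · obtain ⟨d, hd, hd'⟩ := h' p hp
        exact ⟨d, hd, fun i hi => (hd' i (by linarith)).trans (by linarith)⟩
    · intro p hp
      obtain ⟨d, hd, η, hη, hdη⟩ := exists_forall_inner_neg (fun i => gradient (ψ i p.1) p.2)
        (activeSet ψ p.1 p.2) (hcq p.1 hp.1 p.2 hp.2)
      have hε : ∀ᶠ ε : ℝ in 𝓝[>] 0, ∀ i, i ∉ activeSet ψ p.1 p.2 → ψ i p.1 p.2 < -ε := by
        refine eventually_all.2 fun i => ?_
        by_cases hi : i ∈ activeSet ψ p.1 p.2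
        · exact Eventually.of_forall fun _ h => absurd hi h
        · have hneg : ψ i p.1 p.2 < 0 := lt_of_le_of_ne (hp.2 i) hi
          filter_upwards [Ioo_mem_nhdsGT (show (0 : ℝ) < -ψ i p.1 p.2 by linarith)] with ε hε _
          linarith [hε.2]
      obtain ⟨ε, hε1, hε0⟩ := (hε.and self_mem_nhdsWithin).exists
      have hnear : ∀ᶠ q in 𝓝[sweepGraph T ψ] p, ∀ i,
          -ε ≤ ψ i q.1 q.2 → inner ℝ (gradient (ψ i q.1) q.2) d ≤ -(η / 2) := by
        refine eventually_all.2 fun i => ?_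
        by_cases hi : i ∈ activeSet ψ p.1 p.2
        · have hct : Tendsto (fun q : ℝ × E n => inner ℝ (gradient (ψ i q.1) q.2) d)
              (𝓝[sweepGraph T ψ] p) (𝓝 (inner ℝ (gradient (ψ i p.1) p.2) d)) :=
            (hgc i p hp).inner tendsto_const_nhds
          have := hct.eventually_lt_const (u := -(η / 2)) (by linarith [hdη i hi])
          filter_upwards [this] with q hq _ using hq.le
        · have hct : Tendsto (fun q : ℝ × E n => ψ i q.1 q.2)
              (𝓝[sweepGraph T ψ] p) (𝓝 (ψ i p.1 p.2)) := hc i p hp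
          filter_upwards [hct.eventually_lt_const (hε1 i hi)] with q hq hq'
          exact absurd hq' (not_le.2 hq)
      exact ⟨_, hnear, η / 2, ε, half_pos hη, hε0, fun q hq => ⟨d, hd, hq⟩⟩
  obtain ⟨η, ε, h1, h2, h⟩ := key
  exact ⟨η, ε, h1, h2, fun t ht x hx => h (t, x) ⟨ht, hx⟩⟩

theorem exists_uniformGenerators {n r : ℕ} {T : ℝ} {ψ : Fin r → ℝ → E n → ℝ}
    (hψ : ∀ i, ContinuousOn (fun p : ℝ × E n => ψ i p.1 p.2) (Icc 0 T ×ˢ univ))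
    (hbdd : Bornology.IsBounded (sweepGraph T ψ)) (hreg : GeneratorsRegular T ψ)
    (hcq : ConstraintQualification T ψ) :
    ∃ ρ L κ η ε : ℝ, UniformGenerators T ψ ρ L κ η ε := by
  obtain ⟨ρ, L, hρ, hL, h⟩ := hreg
  have hρ2 : 0 ≤ ρ / 2 := by positivity
  have hlip : ∀ i, ∀ t₁ ∈ Icc 0 T, ∀ x₁ ∈ sweepSet ψ t₁, ∀ t₂ ∈ Icc 0 T, ∀ x₂ ∈ sweepSet ψ t₂,
      |ψ i t₁ x₁ - ψ i t₂ x₂| ≤ L * (|t₁ - t₂| + ‖x₁ - x₂‖) := fun i t₁ h1 x₁ h2 t₂ h3 x₂ h4 =>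
    ((h i).2 t₁ h1 x₁ h2 x₁ (Metric.mem_closedBall_self hρ2) t₂ h3 x₂ h4 x₂
      (Metric.mem_closedBall_self hρ2)).1
  have hglip : ∀ i, ∀ t₁ ∈ Icc 0 T, ∀ x₁ ∈ sweepSet ψ t₁, ∀ t₂ ∈ Icc 0 T, ∀ x₂ ∈ sweepSet ψ t₂,
      ‖gradient (ψ i t₁) x₁ - gradient (ψ i t₂) x₂‖ ≤ L * (|t₁ - t₂| + ‖x₁ - x₂‖) :=
    fun i t₁ h1 x₁ h2 t₂ h3 x₂ h4 =>
      ((h i).2 t₁ h1 x₁ h2 x₁ (Metric.mem_closedBall_self hρ2) t₂ h3 x₂ h4 x₂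
        (Metric.mem_closedBall_self hρ2)).2
  obtain ⟨η, ε, hη, hε, hin⟩ :=
    exists_uniform_inward (isCompact_sweepGraph hψ hbdd) hL hlip hglip hcq
  have hgrad : ∀ i, ∀ t ∈ Icc 0 T, ∀ x ∈ sweepSet ψ t, ∀ z ∈ Metric.closedBall x (ρ / 2),
      HasGradientAt (ψ i t) (gradient (ψ i t) z) z := fun i t ht x hx z hz =>
    ((h i).1 t ht x hx z (Metric.closedBall_subset_ball (by linarith) hz)).hasGradientAt
  have hnorm : ∀ i, ∀ t ∈ Icc 0 T, ∀ x ∈ sweepSet ψ t, ‖gradient (ψ i t) x‖ ≤ L := by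
    intro i t ht x hx
    have h1 : LipschitzOnWith ⟨L, hL.le⟩ (ψ i t) (Metric.closedBall x (ρ / 2)) :=
      LipschitzOnWith.of_dist_le_mul fun z hz z' hz' => by
        have := ((h i).2 t ht x hx z hz t ht x hx z' hz').1
        rw [sub_self, abs_zero, zero_add] at this
        rw [Real.dist_eq, dist_eq_norm]; exact this
    have h2 := (hgrad i t ht x hx x (Metric.mem_closedBall_self hρ2)).hasFDerivAt.le_of_lipschitzOn
      (Metric.closedBall_mem_nhds x (by positivity)) h1
    rwa [LinearIsometryEquiv.norm_map] at h2
  have htay : ∀ i, ∀ t ∈ Icc 0 T, ∀ x ∈ sweepSet ψ t, ∀ z ∈ Metric.closedBall x (ρ / 2),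
      |ψ i t z - ψ i t x - inner ℝ (gradient (ψ i t) x) (z - x)|
        ≤ (L + 4 * L / ρ) * ‖z - x‖ ^ 2 := by
    intro i t ht x hx z hd
    rw [Metric.mem_closedBall, dist_eq_norm] at hd
    -- the mean value inequality for `ψ - ⟪∇ψ(x), ·⟫`
    have hmem : ∀ w ∈ Metric.closedBall x ‖z - x‖, w ∈ Metric.closedBall x (ρ / 2) :=
      fun w hw => Metric.closedBall_subset_closedBall hd hw
    have h1 := (convex_closedBall x ‖z - x‖).norm_image_sub_le_of_norm_hasFDerivWithin_le
      (f := fun w => ψ i t w - (InnerProductSpace.toDual ℝ (E n) (gradient (ψ i t) x)) w)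
      (f' := fun w => InnerProductSpace.toDual ℝ (E n) (gradient (ψ i t) w)
        - InnerProductSpace.toDual ℝ (E n) (gradient (ψ i t) x))
      (C := L * ‖z - x‖)
      (fun w hw => ((hgrad i t ht x hx w (hmem w hw)).hasFDerivAt.sub
        (ContinuousLinearMap.hasFDerivAt _)).hasFDerivWithinAt)
      (fun w hw => by
        rw [← map_sub, LinearIsometryEquiv.norm_map]
        have := ((h i).2 t ht x hx w (hmem w hw) t ht x hx x
          (Metric.mem_closedBall_self hρ2)).2
        rw [sub_self, abs_zero, zero_add] at this
        refine this.trans (mul_le_mul_of_nonneg_left ?_ hL.le)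
        rwa [← dist_eq_norm])
      (Metric.mem_closedBall_self (norm_nonneg _))
      (show z ∈ Metric.closedBall x ‖z - x‖ by rw [Metric.mem_closedBall, dist_eq_norm])
    simp only [InnerProductSpace.toDual_apply_apply, Real.norm_eq_abs] at h1
    have e : ψ i t z - ψ i t x - inner ℝ (gradient (ψ i t) x) (z - x) =
        ψ i t z - inner ℝ (gradient (ψ i t) x) z
          - (ψ i t x - inner ℝ (gradient (ψ i t) x) x) := by
      rw [inner_sub_right]; ring
    rw [e]
    refine h1.trans ?_
    have : 0 ≤ 4 * L / ρ * ‖z - x‖ ^ 2 := by positivity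
    nlinarith
  refine ⟨ρ / 2, L, L + 4 * L / ρ, η, ε, by positivity, hL, by positivity, hη, hε,
    fun i t ht x hx => hgrad i t ht x hx x (Metric.mem_closedBall_self hρ2), hnorm, hlip, hglip,
    ?_, htay, ?_, hin⟩
  · intro i t ht x hx t' ht' x' hx' hd
    have := ((h i).2 t' ht' x' hx' x' (Metric.mem_closedBall_self hρ2) t ht x hx x'
      (by rwa [Metric.mem_closedBall, dist_eq_norm])).1
    simpa using this
  · intro i t ht x hx z hz
    have hsq : 0 ≤ ‖z - x‖ ^ 2 := sq_nonneg _
    rcases le_total ‖z - x‖ (ρ / 2) with hd | hd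
    · exact htay i t ht x hx z (by rwa [Metric.mem_closedBall, dist_eq_norm])
    · -- away from `x`, the Lipschitz bounds
      have h1 := hlip i t ht z hz t ht x hx
      rw [sub_self, abs_zero, zero_add] at h1
      have h2 : |inner ℝ (gradient (ψ i t) x) (z - x)| ≤ L * ‖z - x‖ :=
        (abs_real_inner_le_norm _ _).trans
          (mul_le_mul_of_nonneg_right (hnorm i t ht x hx) (norm_nonneg _))
      have h3 : 2 * ‖z - x‖ ≤ 4 / ρ * ‖z - x‖ ^ 2 := by
        rw [div_mul_eq_mul_div, le_div_iff₀ hρ]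
        nlinarith [norm_nonneg (z - x)]
      calc _ ≤ |ψ i t z - ψ i t x| + |inner ℝ (gradient (ψ i t) x) (z - x)| := abs_sub _ _
        _ ≤ L * (2 * ‖z - x‖) := by linarith
        _ ≤ L * (4 / ρ * ‖z - x‖ ^ 2) := mul_le_mul_of_nonneg_left h3 hL.le
        _ ≤ (L + 4 * L / ρ) * ‖z - x‖ ^ 2 := by
            have : 0 ≤ L * ‖z - x‖ ^ 2 := by positivity
            have e : (L + 4 * L / ρ) * ‖z - x‖ ^ 2 =
              L * ‖z - x‖ ^ 2 + L * (4 / ρ * ‖z - x‖ ^ 2) := by ring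
            linarith

namespace UniformGenerators

variable {n r : ℕ} {T : ℝ} {ψ : Fin r → ℝ → E n → ℝ} {ρ L κ η ε : ℝ}

/-- Moving from a point of `C(t)` along an inward direction leads into the interior, at a linear
rate. -/
theorem exists_inward_path (G : UniformGenerators T ψ ρ L κ η ε) {t : ℝ} (ht : t ∈ Icc 0 T)
    {x : E n} (hx : x ∈ sweepSet ψ t) :
    ∃ d : E n, ∀ᶠ s : ℝ in 𝓝[>] 0, ∀ i, ψ i t (x + s • d) ≤ -(η / 2) * s := by
  obtain ⟨d, -, hd⟩ := G.inward t ht x hx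
  have hη := G.η_pos
  refine ⟨d, eventually_all.2 fun i => ?_⟩
  have hder : HasDerivAt (fun s : ℝ => ψ i t (x + s • d))
      (inner ℝ (gradient (ψ i t) x) d) 0 := by
    have h1 : HasDerivAt (fun s : ℝ => x + s • d) d 0 := by
      simpa using ((hasDerivAt_id (0 : ℝ)).smul_const d).const_add x
    have h2 : HasFDerivAt (ψ i t)
        (InnerProductSpace.toDual ℝ (E n) (gradient (ψ i t) x)) (x + (0 : ℝ) • d) := by
      rw [zero_smul, add_zero]; exact (G.hasGradientAt i t ht x hx).hasFDerivAt
    exact h2.comp_hasDerivAt (0 : ℝ) h1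
  by_cases hi : -ε ≤ ψ i t x
  · have h1 := hder.hasDerivWithinAt (s := Ioi 0)
    rw [hasDerivWithinAt_iff_tendsto_slope' (by simp)] at h1
    have := h1.eventually_lt_const (u := -(η / 2)) (by linarith [hd i hi])
    filter_upwards [this, self_mem_nhdsWithin] with s hs (hs0 : 0 < s)
    rw [slope_def_field, sub_zero, div_lt_iff₀ hs0] at hs
    simp only [zero_smul, add_zero] at hs
    linarith [hx i]
  · have h1 : Tendsto (fun s : ℝ => ψ i t (x + s • d) + η / 2 * s) (𝓝[>] 0)
        (𝓝 (ψ i t x)) := by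
      have := (hder.continuousAt.tendsto.add
        ((by fun_prop : Continuous fun s : ℝ => η / 2 * s).tendsto 0))
      simp only [zero_smul, add_zero, mul_zero] at this
      exact this.mono_left nhdsWithin_le_nhds
    have hneg : ψ i t x < 0 := by linarith [G.ε_pos, not_le.1 hi]
    filter_upwards [h1.eventually_lt_const hneg] with s hs
    linarith

end UniformGenerators

/-! ### Interior of the moving set and its Clarke normal cone -/

theorem mem_interior_sweepSet {n r : ℕ} {T : ℝ} {ψ : Fin r → ℝ → E n → ℝ}
    (hψ : ∀ i, ContinuousOn (fun p : ℝ × E n => ψ i p.1 p.2) (Icc 0 T ×ˢ univ))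
    {t : ℝ} (ht : t ∈ Icc 0 T) {x : E n} (hx : ∀ i, ψ i t x < 0) :
    x ∈ interior (sweepSet ψ t) := by
  rw [mem_interior_iff_mem_nhds]
  have : ∀ᶠ z in 𝓝 x, ∀ i, ψ i t z < 0 := by
    refine eventually_all.2 fun i => ?_
    have hc : Continuous (fun z => ψ i t z) := by
      have := (hψ i).comp_continuous (f := fun z : E n => (t, z)) (by fun_prop)
        fun z => ⟨ht, mem_univ _⟩
      exact this
    exact hc.continuousAt.eventually_lt_const (hx i)
  filter_upwards [this] with z hz i using (hz i).le

/-- A continuous path that is strictly inside the moving set at time `t` stays inside nearby. -/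
theorem eventually_mem_sweepSet {n r : ℕ} {T : ℝ} {ψ : Fin r → ℝ → E n → ℝ}
    (hψ : ∀ i, ContinuousOn (fun p : ℝ × E n => ψ i p.1 p.2) (Icc 0 T ×ˢ univ))
    {z : ℝ → E n} (hz : ContinuousOn z (Icc 0 T)) {t : ℝ} (ht : t ∈ Icc 0 T)
    (hlt : ∀ i, ψ i t (z t) < 0) :
    ∀ᶠ s in 𝓝[Icc 0 T] t, z s ∈ sweepSet ψ s := by
  have : ∀ᶠ s in 𝓝[Icc 0 T] t, ∀ i, ψ i s (z s) < 0 := by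
    refine eventually_all.2 fun i => ?_
    have hc : ContinuousOn (fun s => ψ i s (z s)) (Icc 0 T) :=
      (hψ i).comp (continuousOn_id.prodMk hz) fun s hs => ⟨hs, mem_univ _⟩
    exact (hc t ht).eventually_lt_const (hlt i)
  filter_upwards [this] with s hs i using (hs i).le

namespace UniformGenerators

variable {n r : ℕ} {T : ℝ} {ψ : Fin r → ℝ → E n → ℝ} {ρ L κ η ε : ℝ}

theorem mem_closure_interior (G : UniformGenerators T ψ ρ L κ η ε)
    (hψ : ∀ i, ContinuousOn (fun p : ℝ × E n => ψ i p.1 p.2) (Icc 0 T ×ˢ univ))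
    {t : ℝ} (ht : t ∈ Icc 0 T) {x : E n} (hx : x ∈ sweepSet ψ t) :
    x ∈ closure (interior (sweepSet ψ t)) := by
  obtain ⟨d, hd⟩ := G.exists_inward_path ht hx
  have h1 : Tendsto (fun s : ℝ => x + s • d) (𝓝[>] 0) (𝓝 x) := by
    have : Tendsto (fun s : ℝ => x + s • d) (𝓝 0) (𝓝 (x + (0 : ℝ) • d)) :=
      Continuous.tendsto (by fun_prop) 0
    rw [zero_smul, add_zero] at this
    exact this.mono_left nhdsWithin_le_nhds
  refine mem_closure_of_tendsto h1 ?_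
  filter_upwards [hd, self_mem_nhdsWithin] with s hs (hs0 : 0 < s)
  refine mem_interior_sweepSet hψ ht fun i => (hs i).trans_lt ?_
  have := G.η_pos
  nlinarith

/-- Directions along which all active generators strictly decrease are Clarke tangent. -/
theorem mem_clarkeTangentCone (G : UniformGenerators T ψ ρ L κ η ε) {t : ℝ} (ht : t ∈ Icc 0 T)
    {x : E n} (hx : x ∈ sweepSet ψ t) {v : E n}
    (hv : ∀ i ∈ activeSet ψ t x, inner ℝ (gradient (ψ i t) x) v < 0) :
    v ∈ clarkeTangentCone (sweepSet ψ t) x := by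
  intro z τ hz hzx hτ hτ0
  have hψz : ∀ i, Tendsto (fun k => ψ i t (z k)) atTop (𝓝 (ψ i t x)) := fun i =>
    ((G.hasGradientAt i t ht x hx).hasFDerivAt.continuousAt.tendsto).comp hzx
  have hgz : ∀ i, Tendsto (fun k => gradient (ψ i t) (z k)) atTop (𝓝 (gradient (ψ i t) x)) := by
    intro i
    rw [tendsto_iff_norm_sub_tendsto_zero] at hzx ⊢
    refine squeeze_zero (fun k => norm_nonneg _) (fun k => ?_) (by simpa using hzx.const_mul L)
    simpa using G.gradient_lipschitz i t ht (z k) (hz k) t ht x hx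
  have hball : ∀ᶠ k in atTop, z k + τ k • v ∈ Metric.closedBall (z k) ρ := by
    have : Tendsto (fun k => τ k * ‖v‖) atTop (𝓝 0) := by simpa using hτ0.mul_const ‖v‖
    filter_upwards [this.eventually_lt_const G.ρ_pos] with k hk
    rw [Metric.mem_closedBall, dist_eq_norm, add_sub_cancel_left, norm_smul,
      Real.norm_of_nonneg (hτ k).le]
    exact hk.le
  have hmem : ∀ᶠ k in atTop, z k + τ k • v ∈ sweepSet ψ t := by
    refine eventually_all.2 fun i => ?_
    have hbound : ∀ᶠ k in atTop, ψ i t (z k + τ k • v) ≤ ψ i t (z k)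
        + τ k * (inner ℝ (gradient (ψ i t) (z k)) v + κ * τ k * ‖v‖ ^ 2) := by
      filter_upwards [hball] with k hk
      have := (abs_le.1 (G.taylor_closedBall i t ht (z k) (hz k) _ hk)).2
      rw [add_sub_cancel_left, inner_smul_right, norm_smul, mul_pow,
        Real.norm_of_nonneg (hτ k).le] at this
      nlinarith
    have hlim : Tendsto (fun k => inner ℝ (gradient (ψ i t) (z k)) v + κ * τ k * ‖v‖ ^ 2) atTop
        (𝓝 (inner ℝ (gradient (ψ i t) x) v)) := by
      simpa using ((hgz i).inner (tendsto_const_nhds (x := v))).add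
        ((hτ0.const_mul κ).mul_const (‖v‖ ^ 2))
    by_cases hi : i ∈ activeSet ψ t x
    · filter_upwards [hbound, hlim.eventually_lt_const (hv i hi)] with k h1 h2
      have := mul_neg_of_pos_of_neg (hτ k) h2
      have := hz k i
      linarith
    · have hneg : ψ i t x < 0 := lt_of_le_of_ne (hx i) hi
      have h3 : Tendsto (fun k => ψ i t (z k)
          + τ k * (inner ℝ (gradient (ψ i t) (z k)) v + κ * τ k * ‖v‖ ^ 2)) atTop
          (𝓝 (ψ i t x)) := by
        simpa using (hψz i).add (hτ0.mul hlim)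
      filter_upwards [hbound, h3.eventually_lt_const hneg] with k h1 h2
      linarith
  classical
  refine ⟨fun k => if z k + τ k • v ∈ sweepSet ψ t then v else 0, ?_, fun k => ?_⟩
  · refine tendsto_const_nhds.congr' ?_
    filter_upwards [hmem] with k hk
    rw [if_pos hk]
  · dsimp only
    split_ifs with h
    · exact h
    · simpa using hz k

theorem inner_le_zero_of_mem_clarkeTangentCone (G : UniformGenerators T ψ ρ L κ η ε) {t : ℝ}
    (ht : t ∈ Icc 0 T) {x : E n} (hx : x ∈ sweepSet ψ t) {v : E n}
    (hv : v ∈ clarkeTangentCone (sweepSet ψ t) x) {i : Fin r} (hi : i ∈ activeSet ψ t x) :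
    inner ℝ (gradient (ψ i t) x) v ≤ 0 := by
  have hτ : ∀ k : ℕ, (0 : ℝ) < 1 / ((k : ℝ) + 1) := fun k => by positivity
  have hτ0 := tendsto_one_div_add_atTop_nhds_zero_nat (𝕜 := ℝ)
  obtain ⟨w, hw, hmem⟩ := hv (fun _ => x) (fun k => 1 / ((k : ℝ) + 1)) (fun _ => hx)
    tendsto_const_nhds hτ hτ0
  have h1 : Tendsto (fun k => inner ℝ (gradient (ψ i t) x) (w k)) atTop
      (𝓝 (inner ℝ (gradient (ψ i t) x) v)) := (tendsto_const_nhds).inner hw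
  have h2 : Tendsto (fun k : ℕ => κ * (1 / ((k : ℝ) + 1)) * ‖w k‖ ^ 2) atTop (𝓝 0) := by
    simpa using (hτ0.const_mul κ).mul (hw.norm.pow 2)
  refine le_of_tendsto_of_tendsto' h1 h2 fun k => ?_
  have := (abs_le.1 (G.taylor i t ht x hx _ (hmem k))).1
  rw [add_sub_cancel_left, inner_smul_right, norm_smul, mul_pow, Real.norm_of_nonneg (hτ k).le,
    show ψ i t x = 0 from hi] at this
  have h3 := hmem k i
  have h4 := hτ k
  set τ := 1 / ((k : ℝ) + 1)
  have h5 : τ * inner ℝ (gradient (ψ i t) x) (w k) ≤ τ * (κ * τ * ‖w k‖ ^ 2) := by nlinarith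
  exact le_of_mul_le_mul_left h5 h4

/-- A vector polar to all directions in which no active generator increases is a Clarke normal. -/
theorem mem_clarkeNormalCone (G : UniformGenerators T ψ ρ L κ η ε) {t : ℝ} (ht : t ∈ Icc 0 T)
    {x : E n} (hx : x ∈ sweepSet ψ t) {ξ : E n}
    (hξ : ∀ v : E n, (∀ i ∈ activeSet ψ t x, inner ℝ (gradient (ψ i t) x) v ≤ 0) →
      inner ℝ ξ v ≤ 0) :
    ξ ∈ clarkeNormalCone (sweepSet ψ t) x :=
  ⟨hx, fun _ hv => hξ _ fun _ hi => G.inner_le_zero_of_mem_clarkeTangentCone ht hx hv hi⟩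

/-- Uniform prox-regularity of the moving set, as hypomonotonicity of its normal cone: correcting
`z - x` by a quadratically small multiple of the inward direction makes it tangent at `x`. -/
theorem inner_clarkeNormalCone_le (G : UniformGenerators T ψ ρ L κ η ε) {t : ℝ}
    (ht : t ∈ Icc 0 T) {x ξ : E n} (hξ : ξ ∈ clarkeNormalCone (sweepSet ψ t) x) {z : E n}
    (hz : z ∈ sweepSet ψ t) :
    inner ℝ ξ (z - x) ≤ 2 * κ / η * ‖ξ‖ * ‖z - x‖ ^ 2 := by
  have hx := hξ.1
  rcases eq_or_ne z x with rfl | hne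
  · simp
  have hη := G.η_pos
  have hκ := G.κ_pos
  obtain ⟨d, hd1, hd⟩ := G.inward t ht x hx
  have hpos : 0 < ‖z - x‖ ^ 2 := by
    have := norm_pos_iff.2 (sub_ne_zero.2 hne); positivity
  have h1 := hξ.2 ((z - x) + (2 * κ / η * ‖z - x‖ ^ 2) • d)
    (G.mem_clarkeTangentCone ht hx fun i hi => by
      have hi0 : ψ i t x = 0 := hi
      have h2 := (abs_le.1 (G.taylor i t ht x hx z hz)).1
      have h3 := hd i (by rw [hi0]; linarith [G.ε_pos])
      rw [inner_add_right, inner_smul_right]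
      have h4 : 2 * κ / η * ‖z - x‖ ^ 2 * inner ℝ (gradient (ψ i t) x) d ≤
          2 * κ / η * ‖z - x‖ ^ 2 * -η := mul_le_mul_of_nonneg_left h3 (by positivity)
      have h5 : 2 * κ / η * ‖z - x‖ ^ 2 * -η = -(2 * κ * ‖z - x‖ ^ 2) := by field_simp
      have h6 := hz i
      have h7 : 0 < κ * ‖z - x‖ ^ 2 := by positivity
      linarith)
  rw [inner_add_right, inner_smul_right] at h1
  have h2 : -inner ℝ ξ d ≤ ‖ξ‖ := by
    have := neg_le_of_abs_le (abs_real_inner_le_norm ξ d)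
    nlinarith [norm_nonneg ξ]
  have h3 : 2 * κ / η * ‖z - x‖ ^ 2 * -inner ℝ ξ d ≤ 2 * κ / η * ‖z - x‖ ^ 2 * ‖ξ‖ :=
    mul_le_mul_of_nonneg_left h2 (by positivity)
  linarith

end UniformGenerators

/-! ### Carathéodory differential equations -/

/-- Integration of Picard's bound: `∫ Λ e^{2∫Λ} ≤ e^{2∫Λ} / 2`. -/
theorem integral_mul_exp_le {Λ : ℝ → ℝ} {b : ℝ}
    (hΛ : IntervalIntegrable Λ volume 0 b) :
    ∫ t in (0 : ℝ)..b, Λ t * Real.exp (2 * ∫ s in (0 : ℝ)..t, Λ s) ≤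
      Real.exp (2 * ∫ s in (0 : ℝ)..b, Λ s) / 2 := by
  set A : ℝ → ℝ := fun t => ∫ s in (0 : ℝ)..t, Λ s with hA
  have hAac : AbsolutelyContinuousOnInterval A 0 b :=
    hΛ.absolutelyContinuousOnInterval_intervalIntegral (by simp)
  have hE := absolutelyContinuousOnInterval_contDiff_comp (φ := fun s => Real.exp (2 * s) / 2)
    (by fun_prop) hAac
  have h1 : ∫ t in (0 : ℝ)..b, Λ t * Real.exp (2 * A t) =
      ∫ t in (0 : ℝ)..b, deriv (fun t => Real.exp (2 * A t) / 2) t := by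
    refine intervalIntegral.integral_congr_ae ?_
    filter_upwards [hΛ.ae_hasDerivAt_integral] with t ht htI
    have hd := ht (uIoc_subset_uIcc htI) 0 (by simp)
    have := ((hd.const_mul 2).exp.div_const 2).deriv
    rw [this]
    ring
  rw [h1, hE.integral_deriv_eq_sub]
  have : A 0 = 0 := by simp [hA]
  rw [this, mul_zero, Real.exp_zero]
  linarith

/-- Existence for Carathéodory equations `z' = H(t,z)` with a bounded right-hand side that is
globally Lipschitz in `z` with an integrable Lipschitz constant, by Picard iteration in the norm
weighted by `e^{-2∫Λ}`. -/
theorem exists_caratheodory_solution {V : Type*} [NormedAddCommGroup V] [NormedSpace ℝ V]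
    [CompleteSpace V] {T : ℝ} (hT : 0 ≤ T) {H : ℝ → V → V} {M : ℝ} {Λ : ℝ → ℝ}
    (hmeas : ∀ z : ℝ → V, ContinuousOn z (Icc 0 T) →
      AEStronglyMeasurable (fun t => H t (z t)) (volume.restrict (Icc 0 T)))
    (hbd : ∀ᵐ t ∂(volume.restrict (Icc 0 T)), ∀ z, ‖H t z‖ ≤ M)
    (hΛ : IntegrableOn Λ (Icc 0 T)) (hΛ0 : ∀ t ∈ Icc 0 T, 0 ≤ Λ t)
    (hlip : ∀ᵐ t ∂(volume.restrict (Icc 0 T)), ∀ z z', ‖H t z - H t z'‖ ≤ Λ t * ‖z - z'‖)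
    (z₀ : V) :
    ∃ z : ℝ → V, ContinuousOn z (Icc 0 T) ∧ IntegrableOn (fun t => H t (z t)) (Icc 0 T) ∧
      ∀ t ∈ Icc 0 T, z t = z₀ + ∫ s in (0 : ℝ)..t, H s (z s) := by
  have h0T : (0 : ℝ) ∈ Icc 0 T := ⟨le_rfl, hT⟩
  have hfin : IsFiniteMeasure (volume.restrict (Icc 0 T)) := ⟨by simp⟩
  have hint : ∀ z : ℝ → V, ContinuousOn z (Icc 0 T) →
      IntegrableOn (fun t => H t (z t)) (Icc 0 T) := fun z hz =>
    Integrable.of_bound (hmeas z hz) M (hbd.mono fun t ht => ht _)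
  have hii : ∀ z : ℝ → V, ContinuousOn z (Icc 0 T) → ∀ a ∈ Icc 0 T, ∀ b ∈ Icc 0 T,
      IntervalIntegrable (fun t => H t (z t)) volume a b := fun z hz a ha b hb =>
    ((hint z hz).mono_set (uIcc_subset_Icc ha hb)).intervalIntegrable
  have hΛi : ∀ b ∈ Icc 0 T, IntervalIntegrable Λ volume 0 b := fun b hb =>
    (hΛ.mono_set (uIcc_subset_Icc h0T hb)).intervalIntegrable
  set A : ℝ → ℝ := fun t => ∫ s in (0 : ℝ)..t, Λ s with hA
  have hAcont : ContinuousOn A (Icc 0 T) := by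
    have := intervalIntegral.continuousOn_primitive_interval (f := Λ) (a := 0) (b := T)
      (by rwa [uIcc_of_le hT])
    rwa [uIcc_of_le hT] at this
  set Φ : (ℝ → V) → ℝ → V := fun z t => z₀ + ∫ s in (0 : ℝ)..t, H s (z s) with hΦ
  have hΦcont : ∀ z, ContinuousOn z (Icc 0 T) → ContinuousOn (Φ z) (Icc 0 T) := by
    intro z hz
    have := intervalIntegral.continuousOn_primitive_interval (f := fun s => H s (z s))
      (a := 0) (b := T) (by rw [uIcc_of_le hT]; exact hint z hz)
    rw [uIcc_of_le hT] at this
    exact continuousOn_const.add this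
  -- one Picard step halves the weighted distance
  have hcontr : ∀ z z', ContinuousOn z (Icc 0 T) → ContinuousOn z' (Icc 0 T) → ∀ C : ℝ,
      (∀ t ∈ Icc 0 T, ‖z t - z' t‖ ≤ C * Real.exp (2 * A t)) →
      ∀ t ∈ Icc 0 T, ‖Φ z t - Φ z' t‖ ≤ C / 2 * Real.exp (2 * A t) := by
    intro z z' hz hz' C hC t ht
    have hC0 : 0 ≤ C := by
      have := (norm_nonneg _).trans (hC 0 h0T)
      exact nonneg_of_mul_nonneg_left this (Real.exp_pos _)
    have e1 : Φ z t - Φ z' t = ∫ s in (0 : ℝ)..t, (H s (z s) - H s (z' s)) := by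
      rw [intervalIntegral.integral_sub (hii z hz 0 h0T t ht) (hii z' hz' 0 h0T t ht)]
      simp [hΦ]
    have hci : IntervalIntegrable (fun s => C * (Λ s * Real.exp (2 * A s))) volume 0 t := by
      refine ((hΛi t ht).mul_continuousOn (g := fun s => Real.exp (2 * A s)) ?_).const_mul C
      rw [uIcc_of_le ht.1]
      have := hAcont.mono (Icc_subset_Icc_right ht.2)
      fun_prop
    have hsub : Ioc 0 t ⊆ Icc 0 T := fun s hs => ⟨hs.1.le, hs.2.trans ht.2⟩
    rw [e1]
    calc ‖∫ s in (0 : ℝ)..t, (H s (z s) - H s (z' s))‖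
        ≤ ∫ s in (0 : ℝ)..t, C * (Λ s * Real.exp (2 * A s)) := by
          refine intervalIntegral.norm_integral_le_of_norm_le ht.1 ?_ hci
          have := (ae_restrict_iff' measurableSet_Icc).1 hlip
          filter_upwards [this] with s hs hst
          have h1 := hs (hsub hst) (z s) (z' s)
          have := mul_le_mul_of_nonneg_left (hC s (hsub hst)) (hΛ0 s (hsub hst))
          linarith
      _ = C * ∫ s in (0 : ℝ)..t, Λ s * Real.exp (2 * A s) :=
          intervalIntegral.integral_const_mul _ _
      _ ≤ C * (Real.exp (2 * A t) / 2) :=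
          mul_le_mul_of_nonneg_left (integral_mul_exp_le (hΛi t ht)) hC0
      _ = C / 2 * Real.exp (2 * A t) := by ring
  set Z : ℕ → ℝ → V := fun k => Φ^[k] (fun _ => z₀) with hZ
  have hZs : ∀ k, Z (k + 1) = Φ (Z k) := fun k => Function.iterate_succ_apply' _ _ _
  have hZc : ∀ k, ContinuousOn (Z k) (Icc 0 T) := by
    intro k
    induction k with
    | zero => exact continuousOn_const
    | succ k ih => rw [hZs]; exact hΦcont _ ih
  obtain ⟨R, hR⟩ := isCompact_Icc.exists_bound_of_continuousOn ((hZc 1).sub (hZc 0))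
  have hA0 : ∀ t ∈ Icc 0 T, 0 ≤ A t := fun t ht =>
    intervalIntegral.integral_nonneg ht.1 fun s hs => hΛ0 s ⟨hs.1, hs.2.trans ht.2⟩
  have hR0 : 0 ≤ R := (norm_nonneg _).trans (hR 0 h0T)
  have hstep : ∀ k, ∀ t ∈ Icc 0 T,
      ‖Z (k + 1) t - Z k t‖ ≤ R / 2 ^ k * Real.exp (2 * A t) := by
    intro k
    induction k with
    | zero =>
      intro t ht
      have h1 := hR t ht
      have h2 : 1 ≤ Real.exp (2 * A t) := Real.one_le_exp (by linarith [hA0 t ht])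
      rw [pow_zero, div_one]
      exact h1.trans (le_mul_of_one_le_right hR0 h2)
    | succ k ih =>
      intro t ht
      have := hcontr _ _ (hZc (k + 1)) (hZc k) _ ih t ht
      rw [← hZs, ← hZs, div_div, ← pow_succ] at this
      exact this
  obtain ⟨B, hB⟩ := isCompact_Icc.exists_bound_of_continuousOn
    (f := fun t => R * Real.exp (2 * A t)) (by fun_prop)
  have hgeo : ∀ t ∈ Icc 0 T, ∀ k, dist (Z k t) (Z (k + 1) t) ≤ B * (1 / 2) ^ k := by
    intro t ht k
    rw [dist_comm, dist_eq_norm]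
    refine (hstep k t ht).trans ?_
    have h1 := (le_abs_self _).trans (hB t ht)
    have h2 : (0 : ℝ) ≤ (1 / 2) ^ k := by positivity
    calc R / 2 ^ k * Real.exp (2 * A t) = R * Real.exp (2 * A t) * (1 / 2) ^ k := by
          rw [one_div, inv_pow]; ring
      _ ≤ B * (1 / 2) ^ k := mul_le_mul_of_nonneg_right h1 h2
  have hlim : ∀ t ∈ Icc 0 T, ∃ w, Tendsto (fun k => Z k t) atTop (𝓝 w) := fun t ht =>
    cauchySeq_tendsto_of_complete (cauchySeq_of_le_geometric (1 / 2) B (by norm_num) (hgeo t ht))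
  choose! z hz using hlim
  have hunif : TendstoUniformlyOn Z z atTop (Icc 0 T) := by
    rw [Metric.tendstoUniformlyOn_iff]
    intro δ hδ
    have h1 : Tendsto (fun k : ℕ => B * (1 / 2 : ℝ) ^ k / (1 - 1 / 2)) atTop (𝓝 0) := by
      have := ((tendsto_pow_atTop_nhds_zero_of_lt_one (r := (1 / 2 : ℝ)) (by norm_num)
        (by norm_num)).const_mul B).div_const (1 - 1 / 2)
      simpa using this
    filter_upwards [h1.eventually_lt_const hδ] with k hk t ht
    rw [dist_comm]
    exact (dist_le_of_le_geometric_of_tendsto (1 / 2) B (by norm_num) (hgeo t ht) (hz t ht)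
      k).trans_lt hk
  have hzc : ContinuousOn z (Icc 0 T) := hunif.continuousOn (Frequently.of_forall hZc)
  refine ⟨z, hzc, hint z hzc, fun t ht => ?_⟩
  have hsub : Ioc 0 t ⊆ Icc 0 T := fun s hs => ⟨hs.1.le, hs.2.trans ht.2⟩
  have hIoc : uIoc 0 t = Ioc 0 t := uIoc_of_le ht.1
  have hT1 : Tendsto (fun k => Z (k + 1) t) atTop
      (𝓝 (z₀ + ∫ s in (0 : ℝ)..t, H s (z s))) := by
    simp only [hZs, hΦ]
    refine tendsto_const_nhds.add ?_
    refine intervalIntegral.tendsto_integral_filter_of_dominated_convergence (fun _ => M)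
      (Eventually.of_forall fun k => ?_) (Eventually.of_forall fun k => ?_) (by simp) ?_
    · rw [hIoc]
      exact (hmeas _ (hZc k)).mono_measure (Measure.restrict_mono hsub le_rfl)
    · rw [hIoc]
      filter_upwards [(ae_restrict_iff' measurableSet_Icc).1 hbd] with s hs hst
      exact hs (hsub hst) _
    · rw [hIoc]
      filter_upwards [(ae_restrict_iff' measurableSet_Icc).1 hlip] with s hs hst
      rw [tendsto_iff_norm_sub_tendsto_zero]
      have h1 := (tendsto_iff_norm_sub_tendsto_zero.1 (hz s (hsub hst))).const_mul (Λ s)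
      rw [mul_zero] at h1
      exact squeeze_zero (fun _ => norm_nonneg _) (fun k => hs (hsub hst) _ _) h1
  exact tendsto_nhds_unique ((tendsto_add_atTop_iff_nat 1).2 (hz t ht)) hT1

/-! ### Measurable Lipschitz extension -/

open Classical in
/-- McShane's extension of `φ(t,·)` from the subset `D t` to the whole space, truncated at `M`,
with the infimum taken over those terms of the sequence `q` that lie in `D t`. Restricting to a
sequence makes the extension measurable in `t`. -/
noncomputable def mcShaneExtension {V : Type*} [NormedAddCommGroup V] (q : ℕ → V)
    (D : ℝ → Set V) (φ : ℝ → V → ℝ) (Λ : ℝ → ℝ) (M : ℝ) (t : ℝ) (z : V) : ℝ :=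
  ⨅ i, if q i ∈ D t then min M (φ t (q i) + Λ t * ‖z - q i‖) else M

section McShane

variable {V : Type*} [NormedAddCommGroup V] {q : ℕ → V} {D : ℝ → Set V} {φ : ℝ → V → ℝ}
  {Λ : ℝ → ℝ} {M : ℝ} {t : ℝ}

theorem neg_le_mcShane_term (hM : 0 ≤ M) (hΛ : 0 ≤ Λ t) (hφ : ∀ z ∈ D t, |φ t z| ≤ M) (z : V)
    (i : ℕ) [Decidable (q i ∈ D t)] :
    -M ≤ if q i ∈ D t then min M (φ t (q i) + Λ t * ‖z - q i‖) else M := by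
  split_ifs with h
  · refine le_min (by linarith) ?_
    have := (abs_le.1 (hφ _ h)).1
    have : 0 ≤ Λ t * ‖z - q i‖ := by positivity
    linarith
  · linarith

theorem bddBelow_mcShane (hM : 0 ≤ M) (hΛ : 0 ≤ Λ t) (hφ : ∀ z ∈ D t, |φ t z| ≤ M) (z : V)
    [∀ i, Decidable (q i ∈ D t)] :
    BddBelow (range fun i => if q i ∈ D t then min M (φ t (q i) + Λ t * ‖z - q i‖) else M) :=
  ⟨-M, by rintro _ ⟨i, rfl⟩; exact neg_le_mcShane_term hM hΛ hφ z i⟩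

theorem abs_mcShaneExtension_le (hM : 0 ≤ M) (hΛ : 0 ≤ Λ t) (hφ : ∀ z ∈ D t, |φ t z| ≤ M)
    (z : V) : |mcShaneExtension q D φ Λ M t z| ≤ M := by
  classical
  refine abs_le.2 ⟨le_ciInf fun i => neg_le_mcShane_term hM hΛ hφ z i, ?_⟩
  refine (ciInf_le (bddBelow_mcShane hM hΛ hφ z) 0).trans ?_
  split_ifs
  exacts [min_le_left _ _, le_rfl]

theorem mcShaneExtension_le_add (hM : 0 ≤ M) (hΛ : 0 ≤ Λ t) (hφ : ∀ z ∈ D t, |φ t z| ≤ M)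
    (z z' : V) :
    mcShaneExtension q D φ Λ M t z ≤ mcShaneExtension q D φ Λ M t z' + Λ t * ‖z - z'‖ := by
  classical
  rw [← sub_le_iff_le_add]
  refine le_ciInf fun i => ?_
  rw [sub_le_iff_le_add]
  refine (ciInf_le (bddBelow_mcShane hM hΛ hφ z) i).trans ?_
  have h0 : 0 ≤ Λ t * ‖z - z'‖ := by positivity
  split_ifs with h
  · rw [← min_add_add_right]
    refine min_le_min (by linarith) ?_
    have := mul_le_mul_of_nonneg_left (norm_sub_le_norm_sub_add_norm_sub z z' (q i)) hΛ
    linarith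
  · linarith

theorem abs_mcShaneExtension_sub_le (hM : 0 ≤ M) (hΛ : 0 ≤ Λ t) (hφ : ∀ z ∈ D t, |φ t z| ≤ M)
    (z z' : V) :
    |mcShaneExtension q D φ Λ M t z - mcShaneExtension q D φ Λ M t z'| ≤ Λ t * ‖z - z'‖ := by
  have h1 := mcShaneExtension_le_add (q := q) hM hΛ hφ z z'
  have h2 := mcShaneExtension_le_add (q := q) hM hΛ hφ z' z
  rw [norm_sub_rev] at h2
  exact abs_le.2 ⟨by linarith, by linarith⟩

theorem mcShaneExtension_eq (hM : 0 ≤ M) (hΛ : 0 ≤ Λ t) (hφ : ∀ z ∈ D t, |φ t z| ≤ M)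
    (hlip : ∀ z ∈ D t, ∀ z' ∈ D t, |φ t z - φ t z'| ≤ Λ t * ‖z - z'‖) {z : V} (hz : z ∈ D t)
    (hq : ∀ δ > 0, ∃ i, q i ∈ D t ∧ ‖z - q i‖ < δ) :
    mcShaneExtension q D φ Λ M t z = φ t z := by
  classical
  refine le_antisymm (le_of_forall_pos_le_add fun δ hδ => ?_) (le_ciInf fun i => ?_)
  · obtain ⟨i, hi, hid⟩ := hq (δ / (2 * (Λ t + 1))) (by positivity)
    refine (ciInf_le (bddBelow_mcShane hM hΛ hφ z) i).trans ?_
    rw [if_pos hi]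
    refine (min_le_right _ _).trans ?_
    have h1 := (abs_le.1 (hlip z hz _ hi)).1
    rw [lt_div_iff₀ (by positivity)] at hid
    nlinarith [norm_nonneg (z - q i)]
  · split_ifs with h
    · refine le_min (abs_le.1 (hφ z hz)).2 ?_
      linarith [(abs_le.1 (hlip z hz _ h)).2]
    · exact (abs_le.1 (hφ z hz)).2

theorem aemeasurable_mcShaneExtension [MeasurableSpace V] [BorelSpace V]
    [SecondCountableTopology V] {μ : Measure ℝ} (hΛ : AEMeasurable Λ μ)
    (hD : ∀ i, MeasurableSet {t | q i ∈ D t})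
    (hφ : ∀ i, AEMeasurable (fun t => φ t (q i)) (μ.restrict {t | q i ∈ D t}))
    {z : ℝ → V} (hz : AEMeasurable z μ) :
    AEMeasurable (fun t => mcShaneExtension q D φ Λ M t (z t)) μ := by
  classical
  unfold mcShaneExtension
  refine AEMeasurable.iInf fun i => ?_
  have h1 : AEMeasurable (fun t => min M (φ t (q i) + Λ t * ‖z t - q i‖) - M)
      (μ.restrict {t | q i ∈ D t}) :=
    (aemeasurable_const.min ((hφ i).add (hΛ.mul (hz.sub_const _).norm).restrict)).sub_const M
  convert! ((aemeasurable_indicator_iff (hD i)).2 h1).add_const M using 2 with t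
  by_cases h : q i ∈ D t <;> simp [indicator, h]

end McShane

/-! ### Bounded Lipschitz perturbations on the moving set -/

theorem norm_le_sum_abs {d : ℕ} (v : E d) : ‖v‖ ≤ ∑ i, |v i| := by
  have h : v = ∑ i, v i • EuclideanSpace.single i (1 : ℝ) := by
    ext j; simp [Finset.sum_apply, Pi.single_apply]
  calc ‖v‖ = ‖∑ i, v i • EuclideanSpace.single i (1 : ℝ)‖ := by rw [← h]
    _ ≤ ∑ i, ‖v i • EuclideanSpace.single i (1 : ℝ)‖ := norm_sum_le _ _
    _ = ∑ i, |v i| := by simp [norm_smul]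

/-- A bounded map, Lipschitz in the state variable on `D t` and measurable in time on each
`{t | z ∈ D t}`, extends to all states with the same properties, up to the dimension. -/
theorem exists_measurable_lipschitz_extension {V : Type*} [NormedAddCommGroup V]
    [MeasurableSpace V] [BorelSpace V] [SecondCountableTopology V] {d : ℕ} {μ : Measure ℝ}
    {q : ℕ → V} {D : ℝ → Set V} {F : ℝ → V → E d} {Λ : ℝ → ℝ} {M : ℝ} (hM : 0 ≤ M)
    (hbd : ∀ᵐ t ∂μ, ∀ z ∈ D t, ‖F t z‖ ≤ M)
    (hlip : ∀ᵐ t ∂μ, ∀ z ∈ D t, ∀ z' ∈ D t, ‖F t z - F t z'‖ ≤ Λ t * ‖z - z'‖)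
    (hΛ : AEMeasurable Λ μ) (hΛ0 : ∀ᵐ t ∂μ, 0 ≤ Λ t)
    (hq : ∀ t, ∀ z ∈ D t, ∀ δ > 0, ∃ i, q i ∈ D t ∧ ‖z - q i‖ < δ)
    (hD : ∀ z, MeasurableSet {t | z ∈ D t})
    (hF : ∀ z, AEMeasurable (fun t => F t z) (μ.restrict {t | z ∈ D t})) :
    ∃ F' : ℝ → V → E d, (∀ᵐ t ∂μ, ∀ z ∈ D t, F' t z = F t z) ∧
      (∀ᵐ t ∂μ, ∀ z, ‖F' t z‖ ≤ d * M) ∧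
      (∀ᵐ t ∂μ, ∀ z z', ‖F' t z - F' t z'‖ ≤ d * Λ t * ‖z - z'‖) ∧
      ∀ z : ℝ → V, AEMeasurable z μ → AEMeasurable (fun t => F' t (z t)) μ := by
  have hcoord : ∀ (v : E d) (i : Fin d), |v i| ≤ ‖v‖ := fun v i => PiLp.norm_apply_le v i
  have hbd' : ∀ {t}, (∀ z ∈ D t, ‖F t z‖ ≤ M) → ∀ i : Fin d, ∀ z ∈ D t, |F t z i| ≤ M :=
    fun h i z hz => (hcoord _ i).trans (h z hz)
  have hlip' : ∀ {t}, (∀ z ∈ D t, ∀ z' ∈ D t, ‖F t z - F t z'‖ ≤ Λ t * ‖z - z'‖) →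
      ∀ i : Fin d, ∀ z ∈ D t, ∀ z' ∈ D t, |F t z i - F t z' i| ≤ Λ t * ‖z - z'‖ :=
    fun h i z hz z' hz' => (hcoord (F _ z - F _ z') i).trans (h z hz z' hz')
  refine ⟨fun t z => WithLp.toLp 2 fun i =>
    mcShaneExtension q D (fun t z => F t z i) Λ M t z, ?_, ?_, ?_, ?_⟩
  · filter_upwards [hbd, hlip, hΛ0] with t h1 h2 h3 z hz
    ext i
    exact mcShaneExtension_eq (φ := fun t z => F t z i) hM h3 (hbd' h1 i) (hlip' h2 i) hz
      (hq t z hz)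
  · filter_upwards [hbd, hΛ0] with t h1 h3 z
    refine (norm_le_sum_abs _).trans ?_
    calc _ ≤ ∑ i : Fin d, M := Finset.sum_le_sum fun i _ =>
          abs_mcShaneExtension_le (φ := fun t z => F t z i) hM h3 (hbd' h1 i) z
      _ = d * M := by simp
  · filter_upwards [hbd, hΛ0] with t h1 h3 z z'
    refine (norm_le_sum_abs _).trans ?_
    calc _ ≤ ∑ i : Fin d, Λ t * ‖z - z'‖ := Finset.sum_le_sum fun i _ =>
          abs_mcShaneExtension_sub_le (φ := fun t z => F t z i) hM h3 (hbd' h1 i) z z'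
      _ = d * Λ t * ‖z - z'‖ := by simp [mul_assoc]
  · intro z hz
    have hm : Measurable (fun w : Fin d → ℝ => (WithLp.toLp 2 w : E d)) :=
      (PiLp.continuous_toLp 2 _).measurable
    refine hm.comp_aemeasurable (aemeasurable_pi_lambda _ fun i => ?_)
    have hpr : Measurable (fun w : E d => w i) := by fun_prop
    exact aemeasurable_mcShaneExtension (φ := fun t z => F t z i) hΛ (fun j => hD _)
      (fun j => hpr.comp_aemeasurable (hF (q j))) hz

/-- A pair `(F, G)` of time-dependent vector fields that, on the moving set, is bounded by `M`
and Lipschitz in the state with integrable constant `Λ(t)`, and is measurable in time as long as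
the state belongs to the moving set. -/
structure RegularField {n l r : ℕ} (T : ℝ) (ψ : Fin r → ℝ → E n → ℝ)
    (F : ℝ → E n → E l → E n) (G : ℝ → E n → E l → E l) (M : ℝ) (Λ : ℝ → ℝ) : Prop where
  M_nonneg : 0 ≤ M
  Λ_nonneg : ∀ t ∈ Icc 0 T, 0 ≤ Λ t
  Λ_integrable : IntegrableOn Λ (Icc 0 T)
  bound : ∀ᵐ t ∂(volume.restrict (Icc 0 T)), ∀ x ∈ sweepSet ψ t, ∀ y,
    ‖F t x y‖ ≤ M ∧ ‖G t x y‖ ≤ M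
  lipschitz : ∀ᵐ t ∂(volume.restrict (Icc 0 T)), ∀ x ∈ sweepSet ψ t, ∀ x' ∈ sweepSet ψ t,
    ∀ y y', ‖F t x y - F t x' y'‖ ≤ Λ t * (‖x - x'‖ + ‖y - y'‖) ∧
      ‖G t x y - G t x' y'‖ ≤ Λ t * (‖x - x'‖ + ‖y - y'‖)
  measurable : ∀ x y,
    AEMeasurable (fun t => F t x y) (volume.restrict {t | t ∈ Icc 0 T ∧ x ∈ sweepSet ψ t}) ∧
    AEMeasurable (fun t => G t x y) (volume.restrict {t | t ∈ Icc 0 T ∧ x ∈ sweepSet ψ t})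

theorem isClosed_setOf_mem_sweepSet {n r : ℕ} {T : ℝ} {ψ : Fin r → ℝ → E n → ℝ}
    (hψ : ∀ i, ContinuousOn (fun p : ℝ × E n => ψ i p.1 p.2) (Icc 0 T ×ˢ univ)) (x : E n) :
    IsClosed {t | t ∈ Icc 0 T ∧ x ∈ sweepSet ψ t} := by
  have hc : ∀ i, ContinuousOn (fun t => ψ i t x) (Icc 0 T) := fun i =>
    (hψ i).comp (continuousOn_id.prodMk continuousOn_const) fun s hs => ⟨hs, mem_univ _⟩
  have : {t | t ∈ Icc 0 T ∧ x ∈ sweepSet ψ t} =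
      Icc 0 T ∩ ⋂ i, (Icc 0 T ∩ (fun t => ψ i t x) ⁻¹' Iic 0) := by
    ext t
    simp only [sweepSet, mem_ofPred_eq, mem_inter_iff, mem_iInter, mem_preimage, mem_Iic]
    exact ⟨fun h => ⟨h.1, fun i => ⟨h.1, h.2 i⟩⟩, fun h => ⟨h.1, fun i => (h.2 i).2⟩⟩
  rw [this]
  exact isClosed_Icc.inter (isClosed_iInter fun i =>
    (hc i).preimage_isClosed_of_isClosed isClosed_Icc isClosed_Iic)

namespace RegularField

variable {n l r : ℕ} {T : ℝ} {ψ : Fin r → ℝ → E n → ℝ} {ρ L κ η ε : ℝ}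
  {F : ℝ → E n → E l → E n} {G : ℝ → E n → E l → E l} {M : ℝ} {Λ : ℝ → ℝ}

theorem exists_extension (R : RegularField T ψ F G M Λ) (U : UniformGenerators T ψ ρ L κ η ε)
    (hψ : ∀ i, ContinuousOn (fun p : ℝ × E n => ψ i p.1 p.2) (Icc 0 T ×ˢ univ)) :
    ∃ (F' : ℝ → E n × E l → E n) (G' : ℝ → E n × E l → E l) (M' c : ℝ), 0 ≤ c ∧
      (∀ᵐ t ∂(volume.restrict (Icc 0 T)), ∀ x ∈ sweepSet ψ t, ∀ y,
        F' t (x, y) = F t x y ∧ G' t (x, y) = G t x y) ∧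
      (∀ᵐ t ∂(volume.restrict (Icc 0 T)), ∀ z, ‖F' t z‖ ≤ M' ∧ ‖G' t z‖ ≤ M') ∧
      (∀ᵐ t ∂(volume.restrict (Icc 0 T)), ∀ z z', ‖F' t z - F' t z'‖ ≤ c * Λ t * ‖z - z'‖ ∧
        ‖G' t z - G' t z'‖ ≤ c * Λ t * ‖z - z'‖) ∧
      ∀ z : ℝ → E n × E l, AEMeasurable z (volume.restrict (Icc 0 T)) →
        AEMeasurable (fun t => F' t (z t)) (volume.restrict (Icc 0 T)) ∧
        AEMeasurable (fun t => G' t (z t)) (volume.restrict (Icc 0 T)) := by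
  set μ := volume.restrict (Icc 0 T) with hμ
  set D : ℝ → Set (E n × E l) := fun t => {z | t ∈ Icc 0 T ∧ z.1 ∈ sweepSet ψ t} with hD
  have hΛm : AEMeasurable (fun t => 2 * Λ t) μ := R.Λ_integrable.aemeasurable.const_mul 2
  have hΛ0 : ∀ᵐ t ∂μ, 0 ≤ 2 * Λ t := (ae_restrict_iff' measurableSet_Icc).2
    (Eventually.of_forall fun t ht => mul_nonneg two_pos.le (R.Λ_nonneg t ht))
  have hDm : ∀ z, MeasurableSet {t | z ∈ D t} := fun z =>
    (isClosed_setOf_mem_sweepSet hψ z.1).measurableSet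
  have hq : ∀ t, ∀ z ∈ D t, ∀ δ > 0,
      ∃ i, TopologicalSpace.denseSeq (E n × E l) i ∈ D t ∧
        ‖z - TopologicalSpace.denseSeq (E n × E l) i‖ < δ := by
    rintro t z ⟨ht, hz⟩ δ hδ
    have h1 : z.1 ∈ closure (interior (sweepSet ψ t)) := U.mem_closure_interior hψ ht hz
    obtain ⟨p, hp, hpz⟩ := Metric.mem_closure_iff.1 h1 δ hδ
    have hopen : IsOpen ((interior (sweepSet ψ t) ×ˢ univ) ∩ Metric.ball z δ) :=
      (isOpen_interior.prod isOpen_univ).inter Metric.isOpen_ball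
    have hne : ((interior (sweepSet ψ t) ×ˢ univ) ∩ Metric.ball z δ).Nonempty := by
      refine ⟨(p, z.2), ⟨hp, mem_univ _⟩, ?_⟩
      rw [Metric.mem_ball, dist_comm, Prod.dist_eq]
      exact max_lt hpz (by rwa [dist_self])
    obtain ⟨i, hi⟩ := (TopologicalSpace.denseRange_denseSeq (E n × E l)).exists_mem_open hopen hne
    refine ⟨i, ⟨ht, interior_subset hi.1.1⟩, ?_⟩
    rw [← dist_eq_norm, dist_comm]
    exact hi.2
  have hrestr : ∀ z, μ.restrict {t | z ∈ D t} =
      volume.restrict {t | t ∈ Icc 0 T ∧ z.1 ∈ sweepSet ψ t} := fun z => by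
    rw [hμ, Measure.restrict_restrict (hDm z)]
    congr 1
    ext t
    exact ⟨fun h => h.1, fun h => ⟨h, h.1⟩⟩
  have hsum : ∀ t ∈ Icc 0 T, ∀ z z' : E n × E l,
      Λ t * (‖z.1 - z'.1‖ + ‖z.2 - z'.2‖) ≤ 2 * Λ t * ‖z - z'‖ := by
    intro t ht z z'
    have h1 := norm_fst_le (z - z')
    have h2 := norm_snd_le (z - z')
    rw [Prod.fst_sub] at h1
    rw [Prod.snd_sub] at h2
    have := mul_le_mul_of_nonneg_left (add_le_add h1 h2) (R.Λ_nonneg t ht)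
    linarith
  have hmem : ∀ᵐ t ∂μ, t ∈ Icc 0 T := ae_restrict_mem measurableSet_Icc
  obtain ⟨F', hF1, hF2, hF3, hF4⟩ := exists_measurable_lipschitz_extension (μ := μ)
    (q := TopologicalSpace.denseSeq (E n × E l)) (D := D) (F := fun t z => F t z.1 z.2)
    (Λ := fun t => 2 * Λ t) R.M_nonneg
    (R.bound.mono fun t h z hz => (h z.1 hz.2 z.2).1)
    (by
      filter_upwards [R.lipschitz, hmem] with t h ht z hz z' hz'
      exact ((h z.1 hz.2 z'.1 hz'.2 z.2 z'.2).1).trans (hsum t ht z z'))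
    hΛm hΛ0 hq hDm (fun z => by rw [hrestr]; exact (R.measurable z.1 z.2).1)
  obtain ⟨G', hG1, hG2, hG3, hG4⟩ := exists_measurable_lipschitz_extension (μ := μ)
    (q := TopologicalSpace.denseSeq (E n × E l)) (D := D) (F := fun t z => G t z.1 z.2)
    (Λ := fun t => 2 * Λ t) R.M_nonneg
    (R.bound.mono fun t h z hz => (h z.1 hz.2 z.2).2)
    (by
      filter_upwards [R.lipschitz, hmem] with t h ht z hz z' hz'
      exact ((h z.1 hz.2 z'.1 hz'.2 z.2 z'.2).2).trans (hsum t ht z z'))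
    hΛm hΛ0 hq hDm (fun z => by rw [hrestr]; exact (R.measurable z.1 z.2).2)
  have hM := R.M_nonneg
  refine ⟨F', G', (n + l) * M, 2 * (n + l), by positivity, ?_, ?_, ?_,
    fun z hz => ⟨hF4 z hz, hG4 z hz⟩⟩
  · filter_upwards [hF1, hG1, hmem] with t h1 h2 ht x hx y
    exact ⟨h1 (x, y) ⟨ht, hx⟩, h2 (x, y) ⟨ht, hx⟩⟩
  · filter_upwards [hF2, hG2] with t h1 h2 z
    have a1 : 0 ≤ (n : ℝ) * M := by positivity
    have a2 : 0 ≤ (l : ℝ) * M := by positivity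
    exact ⟨(h1 z).trans (by linarith), (h2 z).trans (by linarith)⟩
  · filter_upwards [hF3, hG3, hmem] with t h1 h2 ht z z'
    have hΛ := R.Λ_nonneg t ht
    have a1 : 0 ≤ (n : ℝ) * (Λ t * ‖z - z'‖) := by positivity
    have a2 : 0 ≤ (l : ℝ) * (Λ t * ‖z - z'‖) := by positivity
    exact ⟨(h1 z z').trans (by linarith), (h2 z z').trans (by linarith)⟩

/-- Measurability of the field along a continuous trajectory in the moving set. -/
theorem aemeasurable_comp (R : RegularField T ψ F G M Λ) (U : UniformGenerators T ψ ρ L κ η ε)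
    (hψ : ∀ i, ContinuousOn (fun p : ℝ × E n => ψ i p.1 p.2) (Icc 0 T ×ˢ univ))
    {x : ℝ → E n} {y : ℝ → E l} (hx : ContinuousOn x (Icc 0 T)) (hy : ContinuousOn y (Icc 0 T))
    (hC : ∀ t ∈ Icc 0 T, x t ∈ sweepSet ψ t) :
    AEMeasurable (fun t => F t (x t) (y t)) (volume.restrict (Icc 0 T)) ∧
    AEMeasurable (fun t => G t (x t) (y t)) (volume.restrict (Icc 0 T)) := by
  obtain ⟨F', G', -, -, -, h1, -, -, h4⟩ := R.exists_extension U hψ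
  have := h4 (fun t => (x t, y t)) ((hx.prodMk hy).aemeasurable measurableSet_Icc)
  refine ⟨this.1.congr ?_, this.2.congr ?_⟩
  · filter_upwards [h1, ae_restrict_mem measurableSet_Icc] with t ht htI
    exact (ht _ (hC t htI) _).1
  · filter_upwards [h1, ae_restrict_mem measurableSet_Icc] with t ht htI
    exact (ht _ (hC t htI) _).2

/-- Trajectories defined on the whole of `[0,T]` that follow the field as long as they stay in
the moving set. -/
theorem exists_trajectory (R : RegularField T ψ F G M Λ) (U : UniformGenerators T ψ ρ L κ η ε)
    (hT : 0 ≤ T)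
    (hψ : ∀ i, ContinuousOn (fun p : ℝ × E n => ψ i p.1 p.2) (Icc 0 T ×ˢ univ))
    (c : E n) (y₀ : E l) :
    ∃ (x v : ℝ → E n) (y w : ℝ → E l), x 0 = c ∧ y 0 = y₀ ∧ HasL1Deriv T x v ∧
      HasL1Deriv T y w ∧ ∀ᵐ t ∂(volume.restrict (Icc 0 T)), x t ∈ sweepSet ψ t →
        v t = F t (x t) (y t) ∧ w t = G t (x t) (y t) := by
  obtain ⟨F', G', M', a, ha, h1, h2, h3, h4⟩ := R.exists_extension U hψ
  obtain ⟨z, hzc, hzi, hz⟩ := exists_caratheodory_solution hT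
    (H := fun t z => (F' t z, G' t z)) (M := M') (Λ := fun t => a * Λ t)
    (fun z hz => by
      have := h4 z (hz.aemeasurable measurableSet_Icc)
      exact (this.1.prodMk this.2).aestronglyMeasurable)
    (by
      filter_upwards [h2] with t ht z
      rw [Prod.norm_def]
      exact max_le (ht z).1 (ht z).2)
    (R.Λ_integrable.const_mul a) (fun t ht => mul_nonneg ha (R.Λ_nonneg t ht))
    (by
      filter_upwards [h3] with t ht z z'
      rw [Prod.mk_sub_mk, Prod.norm_def]
      exact max_le (ht z z').1 (ht z z').2)
    (c, y₀)
  have hz0 : ∀ t ∈ Icc 0 T, IntervalIntegrable (fun s => (F' s (z s), G' s (z s))) volume 0 t :=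
    fun t ht => (hzi.mono_set (uIcc_subset_Icc ⟨le_rfl, hT⟩ ht)).intervalIntegrable
  have hzz : z 0 = (c, y₀) := by simpa using hz 0 ⟨le_rfl, hT⟩
  refine ⟨fun t => (z t).1, fun t => F' t (z t), fun t => (z t).2, fun t => G' t (z t),
    congrArg Prod.fst hzz, congrArg Prod.snd hzz, ⟨hzi.fst, fun t ht => ?_⟩,
    ⟨hzi.snd, fun t ht => ?_⟩, ?_⟩
  · have := (ContinuousLinearMap.fst ℝ (E n) (E l)).intervalIntegral_comp_comm (hz0 t ht)
    beta_reduce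
    rw [hzz, hz t ht, Prod.fst_add]
    exact congrArg _ this.symm
  · have := (ContinuousLinearMap.snd ℝ (E n) (E l)).intervalIntegral_comp_comm (hz0 t ht)
    beta_reduce
    rw [hzz, hz t ht, Prod.snd_add]
    exact congrArg _ this.symm
  · filter_upwards [h1] with t ht hC
    exact ht _ hC _


/-- The field satisfies a one-sided Lipschitz estimate for the Euclidean distance of pairs. -/
theorem two_mul_inner_le (R : RegularField T ψ F G M Λ) :
    ∀ᵐ t ∂(volume.restrict (Icc 0 T)), ∀ x ∈ sweepSet ψ t, ∀ x' ∈ sweepSet ψ t, ∀ y y',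
      2 * (inner ℝ (x - x') (F t x y - F t x' y') + inner ℝ (y - y') (G t x y - G t x' y')) ≤
        4 * Λ t * (‖x - x'‖ ^ 2 + ‖y - y'‖ ^ 2) := by
  filter_upwards [R.lipschitz, ae_restrict_mem measurableSet_Icc] with t h ht x hx x' hx' y y'
  obtain ⟨h1, h2⟩ := h x hx x' hx' y y'
  have h3 := (real_inner_le_norm (x - x') (F t x y - F t x' y')).trans
    (mul_le_mul_of_nonneg_left h1 (norm_nonneg _))
  have h4 := (real_inner_le_norm (y - y') (G t x y - G t x' y')).trans
    (mul_le_mul_of_nonneg_left h2 (norm_nonneg _))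
  have h5 := mul_nonneg (R.Λ_nonneg t ht) (sq_nonneg (‖x - x'‖ - ‖y - y'‖))
  nlinarith

/-- Two trajectories of the field with the same initial point agree as long as both stay in the
moving set. -/
theorem eqOn_of_mem (R : RegularField T ψ F G M Λ) {b : ℝ} (hb : 0 ≤ b) (hbT : b ≤ T)
    {x v x' v' : ℝ → E n} {y w y' w' : ℝ → E l}
    (hx : HasL1Deriv b x v) (hx' : HasL1Deriv b x' v')
    (hy : HasL1Deriv b y w) (hy' : HasL1Deriv b y' w')
    (h : ∀ᵐ t, t ∈ Ioo 0 b → v t = F t (x t) (y t) ∧ w t = G t (x t) (y t))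
    (h' : ∀ᵐ t, t ∈ Ioo 0 b → v' t = F t (x' t) (y' t) ∧ w' t = G t (x' t) (y' t))
    (hC : ∀ t ∈ Icc 0 b, x t ∈ sweepSet ψ t) (hC' : ∀ t ∈ Icc 0 b, x' t ∈ sweepSet ψ t)
    (h0 : x 0 = x' 0) (h0' : y 0 = y' 0) :
    EqOn x x' (Icc 0 b) ∧ EqOn y y' (Icc 0 b) := by
  have hΛi : IntervalIntegrable (fun t => 4 * Λ t) volume 0 b :=
    ((R.Λ_integrable.mono_set
      (uIcc_subset_Icc ⟨le_rfl, hb.trans hbT⟩ ⟨hb, hbT⟩)).intervalIntegrable).const_mul 4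
  refine eqOn_of_oneSided hb hx hx' hy hy' (α := fun t => 4 * Λ t) hΛi
    (fun t ht => mul_nonneg (by norm_num) (R.Λ_nonneg t ⟨ht.1, ht.2.trans hbT⟩)) ?_ h0 h0'
  filter_upwards [h, h', (ae_restrict_iff' measurableSet_Icc).1 R.two_mul_inner_le]
    with t h1 h2 h3 ht
  have htb := Ioo_subset_Icc_self ht
  rw [(h1 ht).1, (h1 ht).2, (h2 ht).1, (h2 ht).2]
  exact h3 ⟨htb.1, htb.2.trans hbT⟩ _ (hC t htb) _ (hC' t htb) _ _

end RegularField

variable {n l r : ℕ} {T : ℝ} {ψ : Fin r → ℝ → E n → ℝ} {ρ L κ η ε : ℝ}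
  {F : ℝ → E n → E l → E n} {G : ℝ → E n → E l → E l} {M : ℝ} {Λ : ℝ → ℝ}

/-- The perturbation along a control is a regular field. -/
theorem PerturbationRegular.exists_regularField {m : ℕ}
    {f : ℝ → E n → E l → E m → E n} {g : ℝ → E n → E l → E m → E l} {U : ℝ → Set (E m)}
    (hh : PerturbationRegular T ψ f g U) {u : ℝ → E m} (hu : IsControl T U u)
    (hmeas : ∀ (x : E n) (y : E l),
      AEMeasurable (fun t => f t x y (u t))
        (volume.restrict {t | t ∈ Icc 0 T ∧ x ∈ sweepSet ψ t}) ∧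
      AEMeasurable (fun t => g t x y (u t))
        (volume.restrict {t | t ∈ Icc 0 T ∧ x ∈ sweepSet ψ t})) :
    ∃ (M : ℝ) (Λ : ℝ → ℝ), RegularField T ψ (fun t x y => f t x y (u t))
      (fun t x y => g t x y (u t)) M Λ := by
  obtain ⟨-, -, M, Λ, hM, hΛ0, hΛ, h⟩ := hh
  have hleft : ∀ {a b : ℕ} (p : E a) (q : E b), ‖p‖ ≤ pairNorm p q := fun p q =>
    Real.le_sqrt_of_sq_le (by nlinarith [sq_nonneg ‖q‖])
  have hright : ∀ {a b : ℕ} (p : E a) (q : E b), ‖q‖ ≤ pairNorm p q := fun p q =>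
    Real.le_sqrt_of_sq_le (by nlinarith [sq_nonneg ‖p‖])
  have hsum : ∀ {a b : ℕ} (p : E a) (q : E b), pairNorm p q ≤ ‖p‖ + ‖q‖ := fun p q =>
    Real.sqrt_le_iff.2 ⟨by positivity, by nlinarith [norm_nonneg p, norm_nonneg q]⟩
  have hfin : IsFiniteMeasure (volume.restrict (Icc 0 T)) := ⟨by simp⟩
  refine ⟨M, Λ, hM.le, hΛ0, hΛ.integrable one_le_two, ?_, ?_, hmeas⟩
  · filter_upwards [h, hu.2] with t ht hut x hx y
    have := (ht _ hut x hx y).1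
    exact ⟨(hleft _ _).trans this, (hright _ _).trans this⟩
  · filter_upwards [h, hu.2, ae_restrict_mem measurableSet_Icc] with t ht hut htI x hx x' hx' y y'
    have h1 := ((ht _ hut x hx y).2 x' hx' y').trans
      (mul_le_mul_of_nonneg_left (hsum _ _) (hΛ0 t htI))
    exact ⟨(hleft _ _).trans h1, (hright _ _).trans h1⟩

/-! ### Uniqueness for the sweeping process -/

/-- Hypomonotonicity of the normal cone and the Lipschitz bounds give uniqueness by Grönwall. -/
theorem RegularField.sweeping_unique (R : RegularField T ψ F G M Λ)
    (U : UniformGenerators T ψ ρ L κ η ε) (hT : 0 ≤ T)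
    {x v x' v' : ℝ → E n} {y w y' w' : ℝ → E l}
    (hx : HasL1Deriv T x v) (hx' : HasL1Deriv T x' v')
    (hy : HasL1Deriv T y w) (hy' : HasL1Deriv T y' w')
    (h : ∀ᵐ t ∂(volume.restrict (Icc 0 T)),
      (∃ ξ ∈ clarkeNormalCone (sweepSet ψ t) (x t), v t = F t (x t) (y t) - ξ) ∧
      w t = G t (x t) (y t))
    (h' : ∀ᵐ t ∂(volume.restrict (Icc 0 T)),
      (∃ ξ ∈ clarkeNormalCone (sweepSet ψ t) (x' t), v' t = F t (x' t) (y' t) - ξ) ∧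
      w' t = G t (x' t) (y' t))
    (h0 : x 0 = x' 0) (h0' : y 0 = y' 0) :
    EqOn x x' (Icc 0 T) ∧ EqOn y y' (Icc 0 T) := by
  have hη := U.η_pos
  have hκ := U.κ_pos
  have hM := R.M_nonneg
  set K := 2 * κ / η with hK
  have hK0 : 0 ≤ K := by positivity
  have h0T : (0 : ℝ) ∈ Icc 0 T := ⟨le_rfl, hT⟩
  have hTT : T ∈ Icc 0 T := ⟨hT, le_rfl⟩
  have hα : IntervalIntegrable (fun t => 4 * Λ t + 2 * (K * (M + ‖v t‖) + K * (M + ‖v' t‖)))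
      volume 0 T := by
    have hΛ : IntervalIntegrable Λ volume 0 T :=
      (R.Λ_integrable.mono_set (uIcc_subset_Icc h0T hTT)).intervalIntegrable
    have hc : IntervalIntegrable (fun _ : ℝ => M) volume 0 T := by simp
    exact (hΛ.const_mul 4).add
      ((((hc.add (hx.intervalIntegrable h0T hTT).norm).const_mul K).add
        ((hc.add (hx'.intervalIntegrable h0T hTT).norm).const_mul K)).const_mul 2)
  refine eqOn_of_oneSided hT hx hx' hy hy' hα (fun t ht => ?_) ?_ h0 h0'
  · have := R.Λ_nonneg t ht
    positivity
  filter_upwards [(ae_restrict_iff' measurableSet_Icc).1 h,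
    (ae_restrict_iff' measurableSet_Icc).1 h',
    (ae_restrict_iff' measurableSet_Icc).1 R.two_mul_inner_le,
    (ae_restrict_iff' measurableSet_Icc).1 R.bound] with t h1 h2 h3 h4 htI
  have ht := Ioo_subset_Icc_self htI
  obtain ⟨⟨ξ, hξ, hv⟩, hw⟩ := h1 ht
  obtain ⟨⟨ξ', hξ', hv'⟩, hw'⟩ := h2 ht
  have e1 := h3 ht _ hξ.1 _ hξ'.1 (y t) (y' t)
  have e2 := U.inner_clarkeNormalCone_le ht hξ hξ'.1
  have e3 := U.inner_clarkeNormalCone_le ht hξ' hξ.1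
  have b1 : ‖ξ‖ ≤ M + ‖v t‖ := by
    have : ξ = F t (x t) (y t) - v t := by rw [hv]; abel
    rw [this]
    exact (norm_sub_le _ _).trans (by linarith [(h4 ht _ hξ.1 (y t)).1])
  have b2 : ‖ξ'‖ ≤ M + ‖v' t‖ := by
    have : ξ' = F t (x' t) (y' t) - v' t := by rw [hv']; abel
    rw [this]
    exact (norm_sub_le _ _).trans (by linarith [(h4 ht _ hξ'.1 (y' t)).1])
  have hsplit : inner ℝ (x t - x' t) (v t - v' t) =
      inner ℝ (x t - x' t) (F t (x t) (y t) - F t (x' t) (y' t)) + inner ℝ ξ (x' t - x t)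
        + inner ℝ ξ' (x t - x' t) := by
    rw [hv, hv', real_inner_comm (x' t - x t) ξ, real_inner_comm (x t - x' t) ξ',
      ← neg_sub (x t) (x' t), inner_neg_left]
    simp only [inner_sub_right]
    ring
  rw [hsplit, hw, hw']
  rw [norm_sub_rev] at e2
  have c1 : K * ‖ξ‖ * ‖x t - x' t‖ ^ 2 ≤ K * (M + ‖v t‖) * (‖x t - x' t‖ ^ 2
      + ‖y t - y' t‖ ^ 2) := by
    apply mul_le_mul (mul_le_mul_of_nonneg_left b1 hK0) _ (by positivity) (by positivity)
    linarith [sq_nonneg ‖y t - y' t‖]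
  have c2 : K * ‖ξ'‖ * ‖x t - x' t‖ ^ 2 ≤ K * (M + ‖v' t‖) * (‖x t - x' t‖ ^ 2
      + ‖y t - y' t‖ ^ 2) := by
    apply mul_le_mul (mul_le_mul_of_nonneg_left b2 hK0) _ (by positivity) (by positivity)
    linarith [sq_nonneg ‖y t - y' t‖]
  linarith

/-! ### The exponential penalty -/

/-- The exponential penalty term `∑ᵢ γ exp(γ ψᵢ(t,x)) ∇ₓψᵢ(t,x)`. -/
noncomputable def expPenalty (ψ : Fin r → ℝ → E n → ℝ) (γ t : ℝ) (x : E n) : E n :=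
  ∑ i, (γ * Real.exp (γ * ψ i t x)) • gradient (ψ i t) x

/-- The sum `∑ᵢ exp(γ ψᵢ(t,x))`; its logarithm divided by `γ` is a smooth approximation of
`maxᵢ ψᵢ`, and its gradient in `x` is the exponential penalty term. -/
noncomputable def expSum (ψ : Fin r → ℝ → E n → ℝ) (γ t : ℝ) (x : E n) : ℝ :=
  ∑ i, Real.exp (γ * ψ i t x)

theorem exp_sub_exp_le (a b : ℝ) : Real.exp a - Real.exp b ≤ Real.exp a * (a - b) := by
  have h1 := Real.add_one_le_exp (b - a)
  have h2 : Real.exp b = Real.exp a * Real.exp (b - a) := by rw [← Real.exp_add]; congr 1; ring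
  nlinarith [Real.exp_pos a]

theorem abs_exp_sub_exp_le {a b : ℝ} (ha : a ≤ 0) (hb : b ≤ 0) :
    |Real.exp a - Real.exp b| ≤ |a - b| := by
  have key : ∀ {a b : ℝ}, a ≤ 0 → Real.exp a - Real.exp b ≤ |a - b| := fun {a b} ha =>
    (exp_sub_exp_le a b).trans <|
      (mul_le_mul_of_nonneg_left (le_abs_self _) (Real.exp_pos a).le).trans
      (mul_le_of_le_one_left (abs_nonneg _) (Real.exp_le_one_iff.2 ha))
  rw [abs_sub_le_iff]
  exact ⟨key ha, abs_sub_comm a b ▸ key hb⟩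

theorem expSum_le {γ : ℝ} (hγ : 0 ≤ γ) {t : ℝ} {x : E n} (hx : x ∈ sweepSet ψ t) :
    expSum ψ γ t x ≤ r := by
  calc expSum ψ γ t x ≤ ∑ _i : Fin r, (1 : ℝ) := Finset.sum_le_sum fun i _ =>
        Real.exp_le_one_iff.2 (mul_nonpos_of_nonneg_of_nonpos hγ (hx i))
    _ = r := by simp

namespace UniformGenerators

theorem norm_expPenalty_le (U : UniformGenerators T ψ ρ L κ η ε) {γ : ℝ} (hγ : 0 ≤ γ) {t : ℝ}
    (ht : t ∈ Icc 0 T) {x : E n} (hx : x ∈ sweepSet ψ t) :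
    ‖expPenalty ψ γ t x‖ ≤ γ * expSum ψ γ t x * L := by
  rw [expPenalty, expSum, Finset.mul_sum, Finset.sum_mul]
  refine (norm_sum_le _ _).trans (Finset.sum_le_sum fun i _ => ?_)
  have := Real.exp_pos (γ * ψ i t x)
  rw [norm_smul, Real.norm_of_nonneg (by positivity)]
  exact mul_le_mul_of_nonneg_left (U.norm_gradient_le i t ht x hx) (by positivity)

theorem norm_expPenalty_sub_le (U : UniformGenerators T ψ ρ L κ η ε) {γ : ℝ} (hγ : 0 ≤ γ) {t : ℝ}
    (ht : t ∈ Icc 0 T) {x x' : E n} (hx : x ∈ sweepSet ψ t) (hx' : x' ∈ sweepSet ψ t) :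
    ‖expPenalty ψ γ t x - expPenalty ψ γ t x'‖ ≤ r * (γ * (γ * L * L + L)) * ‖x - x'‖ := by
  have hL := U.L_pos
  rw [expPenalty, expPenalty, ← Finset.sum_sub_distrib]
  refine (norm_sum_le _ _).trans ?_
  calc _ ≤ ∑ _i : Fin r, (γ * (γ * L * L + L)) * ‖x - x'‖ := Finset.sum_le_sum fun i _ => ?_
    _ = r * (γ * (γ * L * L + L)) * ‖x - x'‖ := by simp [mul_assoc]
  set a := γ * ψ i t x with ha
  set a' := γ * ψ i t x' with ha'
  have ha0 : a ≤ 0 := mul_nonpos_of_nonneg_of_nonpos hγ (hx i)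
  have ha0' : a' ≤ 0 := mul_nonpos_of_nonneg_of_nonpos hγ (hx' i)
  have h1 : |Real.exp a - Real.exp a'| ≤ γ * L * ‖x - x'‖ := by
    refine (abs_exp_sub_exp_le ha0 ha0').trans ?_
    have := U.lipschitz i t ht x hx t ht x' hx'
    rw [sub_self, abs_zero, zero_add] at this
    rw [ha, ha', ← mul_sub, abs_mul, abs_of_nonneg hγ, mul_assoc]
    exact mul_le_mul_of_nonneg_left this hγ
  have h2 := U.gradient_lipschitz i t ht x hx t ht x' hx'
  rw [sub_self, abs_zero, zero_add] at h2
  have h3 := U.norm_gradient_le i t ht x hx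
  have e : (γ * Real.exp a) • gradient (ψ i t) x - (γ * Real.exp a') • gradient (ψ i t) x' =
      γ • ((Real.exp a - Real.exp a') • gradient (ψ i t) x
        + Real.exp a' • (gradient (ψ i t) x - gradient (ψ i t) x')) := by
    module
  rw [e, norm_smul, Real.norm_of_nonneg hγ, mul_assoc]
  refine mul_le_mul_of_nonneg_left ?_ hγ
  refine (norm_add_le _ _).trans ?_
  rw [norm_smul, norm_smul, Real.norm_eq_abs, Real.norm_of_nonneg (Real.exp_pos _).le]
  have h4 : |Real.exp a - Real.exp a'| * ‖gradient (ψ i t) x‖ ≤ γ * L * ‖x - x'‖ * L :=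
    mul_le_mul h1 h3 (norm_nonneg _) (by positivity)
  have h5 : Real.exp a' * ‖gradient (ψ i t) x - gradient (ψ i t) x'‖ ≤ 1 * (L * ‖x - x'‖) :=
    mul_le_mul (Real.exp_le_one_iff.2 ha0') h2 (norm_nonneg _) zero_le_one
  linarith

/-- For large `γ`, at a point where the penalty is large the near-active generators dominate, and
the inward direction bounds the gradient of the exponential sum from below. -/
theorem le_norm_expPenalty (U : UniformGenerators T ψ ρ L κ η ε) {γ K : ℝ} (hγ : 0 < γ)
    (hγε : (η + L) * (r * (γ * Real.exp (-(γ * ε)))) ≤ η / 2 * K) {t : ℝ}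
    (ht : t ∈ Icc 0 T) {x : E n} (hx : x ∈ sweepSet ψ t) (hK : K ≤ γ * expSum ψ γ t x) :
    η / 2 * (γ * expSum ψ γ t x) ≤ ‖expPenalty ψ γ t x‖ := by
  have hη := U.η_pos
  have hL := U.L_pos
  obtain ⟨d, hd1, hd⟩ := U.inward t ht x hx
  have h1 : -inner ℝ (expPenalty ψ γ t x) d ≤ ‖expPenalty ψ γ t x‖ := by
    have h2 := neg_le_of_abs_le (abs_real_inner_le_norm (expPenalty ψ γ t x) d)
    nlinarith [norm_nonneg (expPenalty ψ γ t x)]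
  refine le_trans ?_ h1
  have h2 : -inner ℝ (expPenalty ψ γ t x) d =
      ∑ i, γ * Real.exp (γ * ψ i t x) * -inner ℝ (gradient (ψ i t) x) d := by
    rw [expPenalty, sum_inner, ← Finset.sum_neg_distrib]
    refine Finset.sum_congr rfl fun i _ => ?_
    rw [real_inner_smul_left]; ring
  have h3 : ∑ i, (γ * Real.exp (γ * ψ i t x) * η - (η + L) * (γ * Real.exp (-(γ * ε)))) ≤
      ∑ i, γ * Real.exp (γ * ψ i t x) * -inner ℝ (gradient (ψ i t) x) d := by
    refine Finset.sum_le_sum fun i _ => ?_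
    have hpos : 0 < γ * Real.exp (γ * ψ i t x) := mul_pos hγ (Real.exp_pos _)
    by_cases hi : -ε ≤ ψ i t x
    · have := mul_le_mul_of_nonneg_left (neg_le_neg (hd i hi)) hpos.le
      have h4 : 0 < (η + L) * (γ * Real.exp (-(γ * ε))) := by positivity
      linarith
    · have h4 : Real.exp (γ * ψ i t x) ≤ Real.exp (-(γ * ε)) :=
        Real.exp_le_exp.2 (by nlinarith [not_le.1 hi])
      have h5 : -L ≤ -inner ℝ (gradient (ψ i t) x) d := by
        have := (abs_le.1 (abs_real_inner_le_norm (gradient (ψ i t) x) d)).2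
        have := U.norm_gradient_le i t ht x hx
        nlinarith [norm_nonneg (gradient (ψ i t) x), norm_nonneg d]
      have h6 := mul_le_mul_of_nonneg_left h5 hpos.le
      have h7 : (η + L) * (γ * Real.exp (γ * ψ i t x)) ≤
          (η + L) * (γ * Real.exp (-(γ * ε))) := by gcongr
      linarith
  rw [h2]
  refine le_trans ?_ h3
  rw [Finset.sum_sub_distrib, Finset.sum_const, ← Finset.sum_mul, ← Finset.mul_sum]
  simp only [Finset.card_univ, Fintype.card_fin, nsmul_eq_mul]
  have e : ∑ i, Real.exp (γ * ψ i t x) = expSum ψ γ t x := rfl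
  rw [e]
  have h8 := mul_le_mul_of_nonneg_left hK (half_pos hη).le
  linarith

end UniformGenerators

/-- Subtracting the exponential penalty keeps the field regular, with constants depending on
`γ`. -/
theorem RegularField.sub_expPenalty (R : RegularField T ψ F G M Λ)
    (U : UniformGenerators T ψ ρ L κ η ε)
    (hψ : ∀ i, ContinuousOn (fun p : ℝ × E n => ψ i p.1 p.2) (Icc 0 T ×ˢ univ))
    {γ : ℝ} (hγ : 0 ≤ γ) :
    RegularField T ψ (fun t x y => F t x y - expPenalty ψ γ t x) G (M + γ * r * L)
      (fun t => Λ t + r * (γ * (γ * L * L + L))) := by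
  have hL := U.L_pos
  have hfin : IsFiniteMeasure (volume.restrict (Icc 0 T)) := ⟨by simp⟩
  refine ⟨by have := R.M_nonneg; positivity, fun t ht => ?_,
    R.Λ_integrable.add (integrable_const _), ?_, ?_, fun x y => ⟨?_, (R.measurable x y).2⟩⟩
  · have := R.Λ_nonneg t ht; positivity
  · filter_upwards [R.bound, ae_restrict_mem measurableSet_Icc] with t h ht x hx y
    have h1 := U.norm_expPenalty_le hγ ht hx
    have h2 : γ * expSum ψ γ t x * L ≤ γ * r * L := by
      have := expSum_le hγ hx
      gcongr
    have h3 : 0 ≤ γ * r * L := by positivity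
    exact ⟨(norm_sub_le _ _).trans (by linarith [(h x hx y).1]), by linarith [(h x hx y).2]⟩
  · filter_upwards [R.lipschitz, ae_restrict_mem measurableSet_Icc] with t h ht x hx x' hx' y y'
    have h1 := U.norm_expPenalty_sub_le hγ ht hx hx'
    have h2 := h x hx x' hx' y y'
    have h3 : 0 ≤ r * (γ * (γ * L * L + L)) * ‖y - y'‖ := by positivity
    have h4 : 0 ≤ r * (γ * (γ * L * L + L)) * ‖x - x'‖ := by positivity
    refine ⟨?_, by linarith [h2.2]⟩
    have e : F t x y - expPenalty ψ γ t x - (F t x' y' - expPenalty ψ γ t x') =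
        (F t x y - F t x' y') - (expPenalty ψ γ t x - expPenalty ψ γ t x') := by abel
    rw [e]
    exact (norm_sub_le _ _).trans (by linarith [h2.1])
  · refine (R.measurable x y).1.sub ?_
    refine ContinuousOn.aemeasurable ?_ (isClosed_setOf_mem_sweepSet hψ x).measurableSet
    refine continuousOn_finsetSum _ fun i _ => ?_
    have hψc : ContinuousOn (fun t => ψ i t x) {t | t ∈ Icc 0 T ∧ x ∈ sweepSet ψ t} :=
      (hψ i).comp (continuousOn_id.prodMk continuousOn_const) fun s hs => ⟨hs.1, mem_univ _⟩
    have hgc : ContinuousOn (fun t => gradient (ψ i t) x)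
        {t | t ∈ Icc 0 T ∧ x ∈ sweepSet ψ t} :=
      (LipschitzOnWith.of_dist_le_mul (K := ⟨L, hL.le⟩) fun t ht t' ht' => by
        have := U.gradient_lipschitz i t ht.1 x ht.2 t' ht'.1 x ht'.2
        rw [sub_self, norm_zero, add_zero] at this
        rw [dist_eq_norm, Real.dist_eq]
        exact this).continuousOn
    exact ((continuousOn_const.mul (Real.continuous_exp.comp_continuousOn
      (continuousOn_const.mul hψc))).smul hgc)

/-! ### Invariance and uniqueness for the penalized system -/

theorem exp_le_expSum {γ t : ℝ} {x : E n} (i : Fin r) :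
    Real.exp (γ * ψ i t x) ≤ expSum ψ γ t x :=
  Finset.single_le_sum (f := fun j => Real.exp (γ * ψ j t x))
    (fun _ _ => (Real.exp_pos _).le) (Finset.mem_univ i)

theorem lt_zero_of_expSum_le {γ K : ℝ} (hγ : 0 < γ) (hKγ : K < γ) {t : ℝ} {x : E n}
    (h : γ * expSum ψ γ t x ≤ K) (i : Fin r) : ψ i t x < 0 := by
  have h1 := exp_le_expSum (ψ := ψ) (γ := γ) (t := t) (x := x) i
  have h2 : Real.exp (γ * ψ i t x) < 1 := by
    have := mul_le_mul_of_nonneg_left h1 hγ.le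
    nlinarith
  have := Real.exp_lt_one_iff.1 h2
  by_contra! h3
  have := mul_nonneg hγ.le h3
  linarith

/-- Derivative of the exponential sum along a trajectory: the time dependence of the generators,
which are only Lipschitz in time, contributes at most `γ L` times the sum. -/
theorem UniformGenerators.deriv_expSum_le (U : UniformGenerators T ψ ρ L κ η ε) {γ : ℝ}
    (hγ : 0 < γ) {b : ℝ} (hbT : b ≤ T) {x : ℝ → E n} {t : ℝ} (ht : t ∈ Ioo 0 b)
    (hC : ∀ s ∈ Icc 0 b, x s ∈ sweepSet ψ s) {v : E n} (hx : HasDerivAt x v t) {d : ℝ}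
    (hd : HasDerivAt (fun s => expSum ψ γ s (x s)) d t) :
    d ≤ L * (γ * expSum ψ γ t (x t)) + inner ℝ (expPenalty ψ γ t (x t)) v := by
  have hmem : ∀ s ∈ Icc 0 b, s ∈ Icc 0 T := fun s hs => ⟨hs.1, hs.2.trans hbT⟩
  have htb := Ioo_subset_Icc_self ht
  -- freeze the time argument of the generators
  have hfrozen : HasDerivAt (fun s => expSum ψ γ t (x s))
      (inner ℝ (expPenalty ψ γ t (x t)) v) t := by
    have : ∀ i ∈ Finset.univ, HasDerivAt (fun s => Real.exp (γ * ψ i t (x s)))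
        (Real.exp (γ * ψ i t (x t)) * (γ * inner ℝ (gradient (ψ i t) (x t)) v)) t := by
      intro i _
      have h1 :=
        (U.hasGradientAt i t (hmem t htb) (x t) (hC t htb)).hasFDerivAt.comp_hasDerivAt t hx
      exact (h1.const_mul γ).exp
    refine (HasDerivAt.fun_sum this).congr_deriv ?_
    rw [expPenalty, sum_inner]
    refine Finset.sum_congr rfl fun i _ => ?_
    rw [real_inner_smul_left]; ring
  have h1 := (hasDerivWithinAt_iff_tendsto_slope' (by simp)).1
    ((hd.sub hfrozen).hasDerivWithinAt (s := Ioi t))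
  have h2 : Tendsto (fun s => L * (γ * expSum ψ γ s (x s))) (𝓝[>] t)
      (𝓝 (L * (γ * expSum ψ γ t (x t)))) :=
    ((hd.continuousAt.tendsto.mono_left nhdsWithin_le_nhds).const_mul γ).const_mul L
  have hnear : ∀ᶠ s in 𝓝[>] t, ‖x s - x t‖ ≤ ρ := by
    have := (hx.continuousAt.tendsto.sub_const (x t)).norm
    rw [sub_self, norm_zero] at this
    filter_upwards [(this.mono_left nhdsWithin_le_nhds).eventually_lt_const U.ρ_pos] with s hs
      using hs.le
  have h3 := le_of_tendsto_of_tendsto h1 h2 (by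
    filter_upwards [hnear, Ioo_mem_nhdsGT ht.2] with s hs hst
    have hsb : s ∈ Icc 0 b := ⟨htb.1.trans hst.1.le, hst.2.le⟩
    have hpos : 0 < s - t := sub_pos.2 hst.1
    rw [slope_def_field, div_le_iff₀ hpos]
    simp only [Pi.sub_apply, sub_self, sub_zero]
    rw [expSum, expSum, ← Finset.sum_sub_distrib, Finset.mul_sum, Finset.mul_sum, Finset.sum_mul]
    refine Finset.sum_le_sum fun i _ => (exp_sub_exp_le _ _).trans ?_
    have h4 := (abs_le.1 (U.time_lipschitz i t (hmem t htb) (x t) (hC t htb) s (hmem s hsb) (x s)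
      (hC s hsb) hs)).2
    rw [abs_of_pos hpos] at h4
    have h5 := mul_le_mul_of_nonneg_left h4
      (mul_pos (Real.exp_pos (γ * ψ i s (x s))) hγ).le
    linarith)
  linarith

/-- The penalty cannot push beyond a level `K` independent of `γ`: when `γ S > K`, where `S` is
the exponential sum, the inward force outweighs both the perturbation and the motion of the set,
and `S` decreases. -/
theorem RegularField.expSum_le_of_trajectory (R : RegularField T ψ F G M Λ)
    (U : UniformGenerators T ψ ρ L κ η ε) {γ K : ℝ} (hγ : 0 < γ)
    (hK : 2 * L / η + M ≤ η / 2 * K)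
    (hγε : (η + L) * (r * (γ * Real.exp (-(γ * ε)))) ≤ η / 2 * K)
    {b : ℝ} (hb : 0 ≤ b) (hbT : b ≤ T) {x v : ℝ → E n} {y : ℝ → E l} (hx : HasL1Deriv b x v)
    (hC : ∀ s ∈ Icc 0 b, x s ∈ sweepSet ψ s)
    (hv : ∀ᵐ t, t ∈ Icc 0 b → v t = F t (x t) (y t) - expPenalty ψ γ t (x t))
    (h0 : γ * expSum ψ γ 0 (x 0) ≤ K) : γ * expSum ψ γ b (x b) ≤ K := by
  have hη := U.η_pos
  have hL := U.L_pos
  have hM := R.M_nonneg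
  have hmem : ∀ s ∈ Icc 0 b, s ∈ Icc 0 T := fun s hs => ⟨hs.1, hs.2.trans hbT⟩
  have hF : ∀ᵐ t, t ∈ Icc 0 b → ‖F t (x t) (y t)‖ ≤ M := by
    filter_upwards [(ae_restrict_iff' measurableSet_Icc).1 R.bound] with t ht htb
    exact (ht (hmem t htb) _ (hC t htb) _).1
  have hvb : ∀ᵐ t, t ∈ Icc 0 b → ‖v t‖ ≤ M + γ * r * L := by
    filter_upwards [hF, hv] with t h1 h2 ht
    rw [h2 ht]
    have h3 := U.norm_expPenalty_le hγ.le (hmem t ht) (hC t ht)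
    have h4 : γ * expSum ψ γ t (x t) * L ≤ γ * r * L := by
      have := expSum_le hγ.le (hC t ht)
      gcongr
    exact (norm_sub_le _ _).trans (by linarith [h1 ht])
  set B := M + γ * r * L
  have hac : AbsolutelyContinuousOnInterval (fun s => expSum ψ γ s (x s)) 0 b := by
    have hid : AbsolutelyContinuousOnInterval (fun s : ℝ => s) 0 b :=
      LipschitzWith.id.lipschitzOnWith.absolutelyContinuousOnInterval
    refine absolutelyContinuousOnInterval_of_dist_le (r * (γ * (L * (1 + B)))) hid
      fun s hs t ht => ?_
    rw [uIcc_of_le hb] at hs ht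
    rw [Real.dist_eq, Real.dist_eq, expSum, expSum, ← Finset.sum_sub_distrib]
    refine (Finset.abs_sum_le_sum_abs _ _).trans ?_
    calc _ ≤ ∑ _i : Fin r, γ * (L * (1 + B)) * |s - t| := Finset.sum_le_sum fun i _ => ?_
      _ = r * (γ * (L * (1 + B))) * |s - t| := by simp [mul_assoc]
    refine (abs_exp_sub_exp_le (mul_nonpos_of_nonneg_of_nonpos hγ.le (hC s hs i))
      (mul_nonpos_of_nonneg_of_nonpos hγ.le (hC t ht i))).trans ?_
    rw [← mul_sub, abs_mul, abs_of_pos hγ, mul_assoc]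
    refine mul_le_mul_of_nonneg_left ?_ hγ.le
    have h1 := U.lipschitz i s (hmem s hs) _ (hC s hs) t (hmem t ht) _ (hC t ht)
    have h2 := mul_le_mul_of_nonneg_left (hx.norm_sub_le hvb ht hs) hL.le
    linarith
  have key := le_of_ae_deriv_nonpos_above (K := K / γ) hb hac
    (by rw [le_div_iff₀ hγ]; linarith) (by
      filter_upwards [hF, hv, hx.ae_hasDerivAt hb] with t h1 h2 h3 ht hgt d hd
      have htb := Ioo_subset_Icc_self ht
      have hgt' : K ≤ γ * expSum ψ γ t (x t) := by
        rw [div_lt_iff₀ hγ] at hgt; linarith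
      have e1 := U.deriv_expSum_le hγ hbT ht hC (h3 ht) hd
      have e2 := U.le_norm_expPenalty hγ hγε (hmem t htb) (hC t htb) hgt'
      have e3 := h1 htb
      rw [h2 htb, inner_sub_right, real_inner_self_eq_norm_sq] at e1
      have e4 := (real_inner_le_norm (expPenalty ψ γ t (x t)) (F t (x t) (y t))).trans
        (mul_le_mul_of_nonneg_left e3 (norm_nonneg _))
      set P := ‖expPenalty ψ γ t (x t)‖
      set σ := γ * expSum ψ γ t (x t)
      have hP : 0 ≤ P := norm_nonneg _
      have e5 : L * σ ≤ 2 * L / η * P := by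
        have : L * σ = 2 * L / η * (η / 2 * σ) := by field_simp
        rw [this]
        exact mul_le_mul_of_nonneg_left e2 (by positivity)
      have e6 : 2 * L / η + M ≤ P :=
        hK.trans ((mul_le_mul_of_nonneg_left hgt' (by positivity)).trans e2)
      have e7 := mul_le_mul_of_nonneg_right e6 hP
      nlinarith)
  rw [le_div_iff₀ hγ] at key
  linarith

/-- A property that holds on `[0,t]` and near `t` holds on `[0,b]` for all `b > t` close to `t`. -/
theorem eventually_forall_mem_Icc {P : ℝ → Prop} {t : ℝ} (ht : t ∈ Ico 0 T)
    (hnear : ∀ᶠ s in 𝓝[Icc 0 T] t, P s) (hbefore : ∀ s ∈ Icc 0 t, P s) :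
    ∀ᶠ b in 𝓝[>] t, b ∈ Icc 0 T ∧ ∀ s ∈ Icc 0 b, P s := by
  have h1 : ∀ᶠ s in 𝓝[>] t, P s := by
    rw [← nhdsWithin_Ioc_eq_nhdsGT ht.2]
    have hsub : Ioc t T ⊆ Icc 0 T := fun s hs => ⟨ht.1.trans hs.1.le, hs.2⟩
    exact hnear.filter_mono (nhdsWithin_mono t hsub)
  obtain ⟨a, ha, hsub⟩ := mem_nhdsGT_iff_exists_Ioo_subset.1 h1
  filter_upwards [Ioo_mem_nhdsGT ha, Ioo_mem_nhdsGT ht.2] with b hb hbT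
  refine ⟨⟨ht.1.trans hbT.1.le, hbT.2.le⟩, fun s hs => ?_⟩
  rcases le_or_gt s t with h | h
  · exact hbefore s ⟨hs.1, h⟩
  · exact hsub ⟨h, hs.2.trans_lt hb.2⟩

/-- The penalized system has a solution in the interior of the moving set, with multipliers
bounded by `K`. -/
theorem RegularField.exists_penalty_solution (R : RegularField T ψ F G M Λ)
    (U : UniformGenerators T ψ ρ L κ η ε) (hT : 0 ≤ T)
    (hψ : ∀ i, ContinuousOn (fun p : ℝ × E n => ψ i p.1 p.2) (Icc 0 T ×ˢ univ))
    {γ K : ℝ} (hγ : 0 < γ) (hKγ : K < γ) (hK : 2 * L / η + M ≤ η / 2 * K)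
    (hγε : (η + L) * (r * (γ * Real.exp (-(γ * ε)))) ≤ η / 2 * K)
    {c : E n} (hc : γ * expSum ψ γ 0 c ≤ K) (y₀ : E l) :
    ∃ (x v : ℝ → E n) (y w : ℝ → E l), x 0 = c ∧ y 0 = y₀ ∧ HasL1Deriv T x v ∧
      HasL1Deriv T y w ∧
      (∀ᵐ t ∂(volume.restrict (Icc 0 T)), v t = F t (x t) (y t) - expPenalty ψ γ t (x t) ∧
        w t = G t (x t) (y t)) ∧
      ∀ t ∈ Icc 0 T, γ * expSum ψ γ t (x t) ≤ K := by
  obtain ⟨x, v, y, w, hx0, hy0, hx, hy, h⟩ :=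
    (R.sub_expPenalty U hψ hγ.le).exists_trajectory U hT hψ c y₀
  have hxc := hx.continuousOn hT
  have hSc : ContinuousOn (fun t => γ * expSum ψ γ t (x t)) (Icc 0 T) := by
    refine continuousOn_const.mul (continuousOn_finsetSum _ fun i _ => ?_)
    have : ContinuousOn (fun s => ψ i s (x s)) (Icc 0 T) :=
      (hψ i).comp (continuousOn_id.prodMk hxc) fun s hs => ⟨hs, mem_univ _⟩
    exact Real.continuous_exp.comp_continuousOn (continuousOn_const.mul this)
  have hall : Icc 0 T ⊆ {t | γ * expSum ψ γ t (x t) ≤ K} := by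
    refine IsClosed.Icc_subset_of_forall_mem_nhdsGT_of_Icc_subset ?_
      (show γ * expSum ψ γ 0 (x 0) ≤ K by rwa [hx0]) fun t ht hsub => ?_
    · rw [inter_comm]
      exact hSc.preimage_isClosed_of_isClosed isClosed_Icc isClosed_Iic
    · have htT : t ∈ Icc 0 T := Ico_subset_Icc_self ht
      have hnear := eventually_mem_sweepSet hψ hxc htT
        (lt_zero_of_expSum_le hγ hKγ
          (show γ * expSum ψ γ t (x t) ≤ K from hsub ⟨ht.1, le_rfl⟩))
      have hbefore : ∀ s ∈ Icc 0 t, x s ∈ sweepSet ψ s := fun s hs i =>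
        (lt_zero_of_expSum_le hγ hKγ (hsub hs) i).le
      filter_upwards [eventually_forall_mem_Icc ht hnear hbefore] with b hb
      refine R.expSum_le_of_trajectory U hγ hK hγε hb.1.1 hb.1.2 (hx.mono hb.1.2) hb.2 (y := y) ?_
        (by rw [hx0]; exact hc)
      filter_upwards [(ae_restrict_iff' measurableSet_Icc).1 h] with s hs hsb
      exact (hs ⟨hsb.1, hsb.2.trans hb.1.2⟩ (hb.2 s hsb)).1
  refine ⟨x, v, y, w, hx0, hy0, hx, hy, ?_, hall⟩
  filter_upwards [h, ae_restrict_mem measurableSet_Icc] with t ht htI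
  exact ht fun i => (lt_zero_of_expSum_le hγ hKγ (hall htI) i).le

/-- A solution that stays strictly inside the moving set is the only one with its initial value:
another solution agrees with it as long as it has not left the set, hence cannot leave it. -/
theorem RegularField.eqOn_of_strict (R : RegularField T ψ F G M Λ) (hT : 0 ≤ T)
    (hψ : ∀ i, ContinuousOn (fun p : ℝ × E n => ψ i p.1 p.2) (Icc 0 T ×ˢ univ))
    {x v x' v' : ℝ → E n} {y w y' w' : ℝ → E l}
    (hx : HasL1Deriv T x v) (hx' : HasL1Deriv T x' v')
    (hy : HasL1Deriv T y w) (hy' : HasL1Deriv T y' w')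
    (h : ∀ᵐ t ∂(volume.restrict (Icc 0 T)), v t = F t (x t) (y t) ∧ w t = G t (x t) (y t))
    (h' : ∀ᵐ t ∂(volume.restrict (Icc 0 T)), v' t = F t (x' t) (y' t) ∧ w' t = G t (x' t) (y' t))
    (hC : ∀ t ∈ Icc 0 T, ∀ i, ψ i t (x t) < 0) (h0 : x' 0 = x 0) (h0' : y' 0 = y 0) :
    EqOn x' x (Icc 0 T) ∧ EqOn y' y (Icc 0 T) := by
  have hxc := hx.continuousOn hT
  have hxc' := hx'.continuousOn hT
  have hyc := hy.continuousOn hT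
  have hyc' := hy'.continuousOn hT
  have hall : Icc 0 T ⊆ {t | x' t = x t ∧ y' t = y t} := by
    refine IsClosed.Icc_subset_of_forall_mem_nhdsGT_of_Icc_subset ?_ ⟨h0, h0'⟩ fun t ht hsub => ?_
    · have hcl : IsClosed (Icc 0 T ∩ (fun t => ((x' t, y' t), (x t, y t))) ⁻¹'
          {p : (E n × E l) × (E n × E l) | p.1 = p.2}) :=
        ((hxc'.prodMk hyc').prodMk (hxc.prodMk hyc)).preimage_isClosed_of_isClosed isClosed_Icc
          (isClosed_eq continuous_fst continuous_snd)
      convert! hcl using 1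
      ext t
      simp [and_comm, Prod.ext_iff]
    · have htT : t ∈ Icc 0 T := Ico_subset_Icc_self ht
      have heq : x' t = x t := (hsub ⟨ht.1, le_rfl⟩).1
      have hnear := eventually_mem_sweepSet hψ hxc' htT (by rw [heq]; exact hC t htT)
      have hbefore : ∀ s ∈ Icc 0 t, x' s ∈ sweepSet ψ s := fun s hs i => by
        rw [(hsub hs).1]; exact (hC s ⟨hs.1, hs.2.trans htT.2⟩ i).le
      filter_upwards [eventually_forall_mem_Icc ht hnear hbefore] with b ⟨hb, hbC⟩
      have hIoo : ∀ {s}, s ∈ Ioo 0 b → s ∈ Icc 0 T := fun hs => ⟨hs.1.le, hs.2.le.trans hb.2⟩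
      have key := R.eqOn_of_mem hb.1 hb.2 (hx'.mono hb.2) (hx.mono hb.2) (hy'.mono hb.2)
        (hy.mono hb.2)
        (by filter_upwards [(ae_restrict_iff' measurableSet_Icc).1 h'] with s hs hsb
            exact hs (hIoo hsb))
        (by filter_upwards [(ae_restrict_iff' measurableSet_Icc).1 h] with s hs hsb
            exact hs (hIoo hsb))
        hbC (fun s hs i => (hC s ⟨hs.1, hs.2.trans hb.2⟩ i).le) h0 h0'
      exact ⟨key.1 ⟨hb.1, le_rfl⟩, key.2 ⟨hb.1, le_rfl⟩⟩
  exact ⟨fun t ht => (hall ht).1, fun t ht => (hall ht).2⟩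

/-! ### Convergence of the penalized trajectories -/

theorem tendsto_mul_exp_neg_mul {a : ℝ} (ha : 0 < a) :
    Tendsto (fun γ : ℝ => γ * Real.exp (-(γ * a))) atTop (𝓝 0) := by
  have := (tendsto_rpow_mul_exp_neg_mul_atTop_nhds_zero 1 a ha)
  refine this.congr fun γ => ?_
  rw [Real.rpow_one]; congr 2; ring

theorem mul_exp_neg_le_sqrt {q a : ℝ} (h : Real.exp (-q) ≤ a) :
    q * Real.exp (-q) ≤ √a := by
  have h1 : q ≤ Real.exp (q / 2) := by
    have e : Real.exp (q / 2) = Real.exp (q / 4) * Real.exp (q / 4) := by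
      rw [← Real.exp_add]; congr 1; ring
    have h2 := Real.add_one_le_exp (q / 4)
    rcases le_or_gt 0 q with hq | hq
    · rw [e]; nlinarith [sq_nonneg (q / 4 - 1)]
    · exact hq.le.trans (Real.exp_pos _).le
  have e : Real.exp (-q) = Real.exp (-(q / 2)) * Real.exp (-(q / 2)) := by
    rw [← Real.exp_add]; congr 1; ring
  have e' : Real.exp (q / 2) * Real.exp (-(q / 2)) = 1 := by rw [← Real.exp_add]; simp
  have hpos := Real.exp_pos (-(q / 2))
  have h3 : q * Real.exp (-(q / 2)) ≤ 1 := e' ▸ mul_le_mul_of_nonneg_right h1 hpos.le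
  have h4 : Real.exp (-(q / 2)) ≤ √a := Real.le_sqrt_of_sq_le (by rw [pow_two, ← e]; exact h)
  calc q * Real.exp (-q) = (q * Real.exp (-(q / 2))) * Real.exp (-(q / 2)) := by rw [e]; ring
    _ ≤ 1 * Real.exp (-(q / 2)) := mul_le_mul_of_nonneg_right h3 hpos.le
    _ ≤ √a := by rw [one_mul]; exact h4

/-- While its multipliers are bounded by `K`, the penalty is an approximate proximal normal: the
contribution of the constraints that are not exactly active is of order `γ^{-1/2}`. -/
theorem UniformGenerators.inner_expPenalty_le (U : UniformGenerators T ψ ρ L κ η ε) {γ K : ℝ}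
    (hγ : 0 < γ) {t : ℝ} (ht : t ∈ Icc 0 T) {x z : E n} (hx : x ∈ sweepSet ψ t)
    (hz : z ∈ sweepSet ψ t) (hK : γ * expSum ψ γ t x ≤ K) :
    inner ℝ (expPenalty ψ γ t x) (z - x) ≤ r * √(K / γ) + K * κ * ‖z - x‖ ^ 2 := by
  have hκ := U.κ_pos
  have h1 : ∀ i, inner ℝ ((γ * Real.exp (γ * ψ i t x)) • gradient (ψ i t) x) (z - x) ≤
      √(K / γ) + γ * Real.exp (γ * ψ i t x) * (κ * ‖z - x‖ ^ 2) := by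
    intro i
    have hpos : 0 < γ * Real.exp (γ * ψ i t x) := mul_pos hγ (Real.exp_pos _)
    have h2 := (abs_le.1 (U.taylor i t ht x hx z hz)).1
    have h3 : inner ℝ (gradient (ψ i t) x) (z - x) ≤ -ψ i t x + κ * ‖z - x‖ ^ 2 := by
      linarith [hz i]
    have h4 := mul_le_mul_of_nonneg_left h3 hpos.le
    have h5 : -(γ * ψ i t x) * Real.exp (-(-(γ * ψ i t x))) ≤ √(K / γ) := by
      refine mul_exp_neg_le_sqrt ?_
      rw [neg_neg, le_div_iff₀ hγ]
      have := mul_le_mul_of_nonneg_left (exp_le_expSum (ψ := ψ) (γ := γ) (t := t) (x := x) i) hγ.le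
      linarith
    rw [neg_neg] at h5
    rw [real_inner_smul_left]
    linarith
  rw [expPenalty, sum_inner]
  refine (Finset.sum_le_sum fun i _ => h1 i).trans ?_
  rw [Finset.sum_add_distrib, ← Finset.sum_mul, ← Finset.mul_sum]
  simp only [Finset.sum_const, Finset.card_univ, Fintype.card_fin, nsmul_eq_mul]
  have e : ∑ i, Real.exp (γ * ψ i t x) = expSum ψ γ t x := rfl
  rw [e]
  have := mul_le_mul_of_nonneg_right hK (show 0 ≤ κ * ‖z - x‖ ^ 2 by positivity)
  linarith

/-- Near a point of the moving set and for large `γ`, the penalty makes at most an arbitrarily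
small positive inner product with directions in which no active generator increases. -/
theorem UniformGenerators.eventually_inner_expPenalty_le
    (U : UniformGenerators T ψ ρ L κ η ε) {K : ℝ} (hK0 : 0 ≤ K) {t : ℝ}
    (ht : t ∈ Icc 0 T) {x : E n} (hx : x ∈ sweepSet ψ t) {v : E n}
    (hv : ∀ i ∈ activeSet ψ t x, inner ℝ (gradient (ψ i t) x) v ≤ 0) {ω : ℝ} (hω : 0 < ω) :
    ∃ δ > 0, ∀ᶠ γ : ℝ in atTop, ∀ s ∈ Icc 0 T, ∀ z ∈ sweepSet ψ s, |s - t| + ‖z - x‖ ≤ δ →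
      γ * expSum ψ γ s z ≤ K → inner ℝ (expPenalty ψ γ s z) v ≤ ω := by
  have hL := U.L_pos
  -- a common gap for the inactive generators
  have hgap : ∀ᶠ a : ℝ in 𝓝[>] 0, ∀ i, i ∉ activeSet ψ t x → ψ i t x < -(2 * a) := by
    refine eventually_all.2 fun i => ?_
    by_cases hi : i ∈ activeSet ψ t x
    · exact Eventually.of_forall fun _ h => absurd hi h
    · have hneg : ψ i t x < 0 := lt_of_le_of_ne (hx i) hi
      filter_upwards [Ioo_mem_nhdsGT (show (0 : ℝ) < -ψ i t x / 2 by linarith)] with a ha _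
      linarith [ha.2]
  obtain ⟨a, ha, ha0⟩ := (hgap.and self_mem_nhdsWithin).exists
  have ha0 : 0 < a := ha0
  set δ := min (a / L) (ω / (2 * (K * L * ‖v‖ + 1))) with hδ
  have hKLv : 0 ≤ K * L * ‖v‖ := by positivity
  have hδ0 : 0 < δ := lt_min (by positivity) (by positivity)
  have hδ1 : L * δ ≤ a := by
    have := mul_le_mul_of_nonneg_left (min_le_left (a / L) (ω / (2 * (K * L * ‖v‖ + 1)))) hL.le
    rwa [mul_div_cancel₀ _ hL.ne'] at this
  have hδ2 : K * L * ‖v‖ * δ ≤ ω / 2 := by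
    have h1 : δ ≤ ω / (2 * (K * L * ‖v‖ + 1)) := min_le_right _ _
    rw [le_div_iff₀ (by positivity)] at h1
    nlinarith
  have hlim : Tendsto (fun γ : ℝ => r * (L * ‖v‖) * (γ * Real.exp (-(γ * a)))) atTop (𝓝 0) := by
    simpa using (tendsto_mul_exp_neg_mul ha0).const_mul (r * (L * ‖v‖))
  refine ⟨δ, hδ0, ?_⟩
  filter_upwards [hlim.eventually_lt_const (half_pos hω), eventually_gt_atTop 0]
    with γ hγ hγ0 s hs z hz hd hK
  have h1 : ∀ i, inner ℝ ((γ * Real.exp (γ * ψ i s z)) • gradient (ψ i s) z) v ≤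
      γ * Real.exp (γ * ψ i s z) * (L * δ * ‖v‖) + L * ‖v‖ * (γ * Real.exp (-(γ * a))) := by
    intro i
    have hpos : 0 < γ * Real.exp (γ * ψ i s z) := mul_pos hγ0 (Real.exp_pos _)
    have hpos' : 0 < γ * Real.exp (-(γ * a)) := mul_pos hγ0 (Real.exp_pos _)
    rw [real_inner_smul_left]
    by_cases hi : i ∈ activeSet ψ t x
    · have h2 : inner ℝ (gradient (ψ i s) z) v ≤ L * δ * ‖v‖ := by
        have h3 := (real_inner_le_norm (gradient (ψ i s) z - gradient (ψ i t) x) v)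
        have h4 := (U.gradient_lipschitz i s hs z hz t ht x hx).trans
          (mul_le_mul_of_nonneg_left hd hL.le)
        rw [inner_sub_left] at h3
        have := mul_le_mul_of_nonneg_right h4 (norm_nonneg v)
        linarith [hv i hi]
      have := mul_le_mul_of_nonneg_left h2 hpos.le
      have : 0 ≤ L * ‖v‖ * (γ * Real.exp (-(γ * a))) := by positivity
      linarith
    · have h2 : ψ i s z ≤ -a := by
        have h3 := (abs_le.1 ((U.lipschitz i s hs z hz t ht x hx).trans
          (mul_le_mul_of_nonneg_left hd hL.le))).2
        linarith [ha i hi]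
      have h3 : Real.exp (γ * ψ i s z) ≤ Real.exp (-(γ * a)) :=
        Real.exp_le_exp.2 (by nlinarith)
      have h4 : inner ℝ (gradient (ψ i s) z) v ≤ L * ‖v‖ := (real_inner_le_norm _ _).trans
        (mul_le_mul_of_nonneg_right (U.norm_gradient_le i s hs z hz) (norm_nonneg v))
      have h5 := mul_le_mul_of_nonneg_left h4 hpos.le
      have h6 : γ * Real.exp (γ * ψ i s z) * (L * ‖v‖) ≤
          γ * Real.exp (-(γ * a)) * (L * ‖v‖) := by gcongr
      have : 0 ≤ γ * Real.exp (γ * ψ i s z) * (L * δ * ‖v‖) := by positivity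
      linarith
  rw [expPenalty, sum_inner]
  refine (Finset.sum_le_sum fun i _ => h1 i).trans ?_
  rw [Finset.sum_add_distrib, ← Finset.sum_mul, ← Finset.mul_sum]
  simp only [Finset.sum_const, Finset.card_univ, Fintype.card_fin, nsmul_eq_mul]
  have e : ∑ i, Real.exp (γ * ψ i s z) = expSum ψ γ s z := rfl
  rw [e]
  have := mul_le_mul_of_nonneg_right hK (show 0 ≤ L * δ * ‖v‖ by positivity)
  linarith

/-- A Lipschitz function is the primitive of its derivative. -/
theorem hasL1Deriv_of_lipschitzOnWith {d : ℕ} (hT : 0 ≤ T) {x : ℝ → E d} {K : NNReal}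
    (hx : LipschitzOnWith K x (Icc 0 T)) : HasL1Deriv T x (deriv x) := by
  have hfin : IsFiniteMeasure (volume.restrict (Icc 0 T)) := ⟨by simp⟩
  have hIoo : ∀ᵐ t ∂(volume.restrict (Icc 0 T)), t ∈ Ioo 0 T := by
    rw [← restrict_Ioo_eq_restrict_Icc]
    exact ae_restrict_mem measurableSet_Ioo
  have hdiff : ∀ᵐ t, t ∈ Ioo 0 T → DifferentiableAt ℝ x t := by
    filter_upwards [hx.ae_differentiableWithinAt_of_mem] with t ht htI
    exact (ht (Ioo_subset_Icc_self htI)).differentiableAt (Icc_mem_nhds htI.1 htI.2)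
  have hint : IntegrableOn (deriv x) (Icc 0 T) := by
    refine Integrable.of_bound (aestronglyMeasurable_deriv x _) K ?_
    filter_upwards [hIoo] with t ht
    exact norm_deriv_le_of_lipschitzOn (Icc_mem_nhds ht.1 ht.2) hx
  refine ⟨hint, fun t ht => ?_⟩
  have hI : HasL1Deriv T (fun t => ∫ s in (0 : ℝ)..t, deriv x s) (deriv x) :=
    ⟨hint, fun t _ => by simp⟩
  have hxac : AbsolutelyContinuousOnInterval x 0 T :=
    LipschitzOnWith.absolutelyContinuousOnInterval (by rwa [uIcc_of_le hT])
  have h0T : ∀ᵐ t : ℝ, t ≠ 0 ∧ t ≠ T := by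
    have h1 : ∀ᵐ t : ℝ, t ≠ 0 := by simp [ae_iff, measure_singleton]
    have h2 : ∀ᵐ t : ℝ, t ≠ T := by simp [ae_iff, measure_singleton]
    exact h1.and h2
  obtain ⟨C, hC⟩ := (hxac.fun_sub
    (hI.absolutelyContinuousOnInterval hT)).const_of_ae_hasDerivAt_zero (by
      filter_upwards [hdiff, hI.ae_hasDerivAt hT, h0T] with s h1 h2 h3 hs
      rw [uIcc_of_le hT] at hs
      have hs' : s ∈ Ioo 0 T := ⟨lt_of_le_of_ne hs.1 h3.1.symm, lt_of_le_of_ne hs.2 h3.2⟩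
      exact ((h1 hs').hasDerivAt.sub (h2 hs')).congr_deriv (sub_self _))
  rw [uIcc_of_le hT] at hC
  have e1 := hC t ht
  have e2 := hC 0 ⟨le_rfl, hT⟩
  simp only [intervalIntegral.integral_same, sub_zero] at e2
  rw [e2, ← e1]
  abel

/-- A solution `(x, y)` of the penalized system with parameter `γ`, with velocities `(v, w)`,
along which `∑ᵢ γ exp(γ ψᵢ)` is at most `K < γ`; in particular `x` is strictly inside the moving
set. -/
structure BoundedPenaltySolution (T : ℝ) (ψ : Fin r → ℝ → E n → ℝ) (F : ℝ → E n → E l → E n)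
    (G : ℝ → E n → E l → E l) (K γ : ℝ) (x v : ℝ → E n) (y w : ℝ → E l) : Prop where
  γ_pos : 0 < γ
  lt_γ : K < γ
  hasL1Deriv_fst : HasL1Deriv T x v
  hasL1Deriv_snd : HasL1Deriv T y w
  ode : ∀ᵐ t ∂(volume.restrict (Icc 0 T)), v t = F t (x t) (y t) - expPenalty ψ γ t (x t) ∧
    w t = G t (x t) (y t)
  le_K : ∀ t ∈ Icc 0 T, γ * expSum ψ γ t (x t) ≤ K

namespace BoundedPenaltySolution

variable {K γ γ' : ℝ} {x v x' v' : ℝ → E n} {y w y' w' : ℝ → E l}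

theorem lt_zero (S : BoundedPenaltySolution T ψ F G K γ x v y w) {t : ℝ} (ht : t ∈ Icc 0 T)
    (i : Fin r) : ψ i t (x t) < 0 :=
  lt_zero_of_expSum_le S.γ_pos S.lt_γ (S.le_K t ht) i

theorem mem (S : BoundedPenaltySolution T ψ F G K γ x v y w) {t : ℝ} (ht : t ∈ Icc 0 T) :
    x t ∈ sweepSet ψ t := fun i => (S.lt_zero ht i).le

/-- The distance of two penalized trajectories is controlled by that of their initial points and
by the inverse square roots of the penalty parameters. -/
theorem norm_sq_sub_le (S : BoundedPenaltySolution T ψ F G K γ x v y w)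
    (S' : BoundedPenaltySolution T ψ F G K γ' x' v' y' w') (R : RegularField T ψ F G M Λ)
    (U : UniformGenerators T ψ ρ L κ η ε) (hT : 0 ≤ T) (hK : 0 ≤ K) (h0 : y 0 = y' 0) :
    ∀ t ∈ Icc 0 T, ‖x t - x' t‖ ^ 2 + ‖y t - y' t‖ ^ 2 ≤
      (‖x 0 - x' 0‖ ^ 2 + T * (2 * r * (√(K / γ) + √(K / γ')))) *
        Real.exp (∫ t in (0 : ℝ)..T, (4 * Λ t + 4 * (K * κ))) := by
  have hκ := U.κ_pos
  have hΛ : IntervalIntegrable Λ volume 0 T :=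
    (R.Λ_integrable.mono_set (uIcc_subset_Icc ⟨le_rfl, hT⟩ ⟨hT, le_rfl⟩)).intervalIntegrable
  have hα : IntervalIntegrable (fun t => 4 * Λ t + 4 * (K * κ)) volume 0 T :=
    (hΛ.const_mul 4).add (by simp)
  have key := norm_sq_sub_le_of_oneSided hT S.hasL1Deriv_fst S'.hasL1Deriv_fst S.hasL1Deriv_snd
    S'.hasL1Deriv_snd (c := fun _ => 2 * r * (√(K / γ) + √(K / γ'))) hα
    (fun t ht => by have := R.Λ_nonneg t ht; positivity) (by simp)
    (fun t _ => by positivity) (by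
      filter_upwards [(ae_restrict_iff' measurableSet_Icc).1 S.ode,
        (ae_restrict_iff' measurableSet_Icc).1 S'.ode,
        (ae_restrict_iff' measurableSet_Icc).1 R.two_mul_inner_le] with t h1 h2 h3 htI
      have ht := Ioo_subset_Icc_self htI
      have e1 := h3 ht _ (S.mem ht) _ (S'.mem ht) (y t) (y' t)
      have e2 := U.inner_expPenalty_le S.γ_pos ht (S.mem ht) (S'.mem ht) (S.le_K t ht)
      have e3 := U.inner_expPenalty_le S'.γ_pos ht (S'.mem ht) (S.mem ht) (S'.le_K t ht)
      rw [norm_sub_rev] at e2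
      have hsplit : inner ℝ (x t - x' t) (v t - v' t) =
          inner ℝ (x t - x' t) (F t (x t) (y t) - F t (x' t) (y' t))
            + inner ℝ (expPenalty ψ γ t (x t)) (x' t - x t)
            + inner ℝ (expPenalty ψ γ' t (x' t)) (x t - x' t) := by
        rw [(h1 ht).1, (h2 ht).1, real_inner_comm (x' t - x t), real_inner_comm (x t - x' t)
          (expPenalty ψ γ' t (x' t)), ← neg_sub (x t) (x' t), inner_neg_left]
        simp only [inner_sub_right]
        ring
      rw [hsplit, (h1 ht).2, (h2 ht).2]
      have e4 : 0 ≤ 4 * (K * κ) * ‖y t - y' t‖ ^ 2 := by positivity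
      linarith)
  simpa only [h0, sub_self, norm_zero, ne_eq, OfNat.ofNat_ne_zero, not_false_eq_true, zero_pow,
    add_zero, intervalIntegral.integral_const, sub_zero, smul_eq_mul] using key

end BoundedPenaltySolution

theorem exists_tendstoUniformlyOn_of_norm_sq_le {n l : ℕ} {s : Set ℝ} {X : ℕ → ℝ → E n}
    {Y : ℕ → ℝ → E l} {e : ℕ × ℕ → ℝ} (he : Tendsto e atTop (𝓝 0))
    (h : ∀ j k, ∀ t ∈ s, ‖X j t - X k t‖ ^ 2 + ‖Y j t - Y k t‖ ^ 2 ≤ e (j, k)) :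
    ∃ (x : ℝ → E n) (y : ℝ → E l), TendstoUniformlyOn X x atTop s ∧
      TendstoUniformlyOn Y y atTop s := by
  have main : ∀ {d : ℕ} {Z : ℕ → ℝ → E d},
      (∀ j k, ∀ t ∈ s, ‖Z j t - Z k t‖ ^ 2 ≤ e (j, k)) → ∃ z, TendstoUniformlyOn Z z atTop s := by
    intro d Z hZ
    have hc : UniformCauchySeqOn Z atTop s := by
      rw [Metric.uniformCauchySeqOn_iff]
      intro δ hδ
      obtain ⟨N, hN⟩ := eventually_atTop_prod_self'.1
        (he.eventually_lt_const (show (0 : ℝ) < δ ^ 2 by positivity))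
      refine ⟨N, fun j hj k hk t ht => ?_⟩
      rw [dist_eq_norm]
      exact lt_of_pow_lt_pow_left₀ 2 hδ.le ((hZ j k t ht).trans_lt (hN j hj k hk))
    have hlim : ∀ t ∈ s, ∃ z, Tendsto (fun k => Z k t) atTop (𝓝 z) := fun t ht =>
      cauchySeq_tendsto_of_complete (hc.cauchySeq ht)
    choose! z hz using hlim
    exact ⟨z, hc.tendstoUniformlyOn_of_tendsto hz⟩
  obtain ⟨x, hx⟩ := main (Z := X) fun j k t ht => by
    linarith [h j k t ht, sq_nonneg ‖Y j t - Y k t‖]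
  obtain ⟨y, hy⟩ := main (Z := Y) fun j k t ht => by
    linarith [h j k t ht, sq_nonneg ‖X j t - X k t‖]
  exact ⟨x, y, hx, hy⟩

/-- Uniform limits of penalized trajectories with bounded multipliers solve the sweeping process.
At a Lebesgue point `t`, the normal inclusion is tested against a direction `v` in which no active
generator increases: `⟪∫ F - x, v⟫` is the limit of functions with derivative
`⟪penalty, v⟫ ≤ ω` near `t`. -/
theorem isSolution_of_tendstoUniformlyOn (R : RegularField T ψ F G M Λ)
    (U : UniformGenerators T ψ ρ L κ η ε) (hT : 0 ≤ T)
    (hψ : ∀ i, ContinuousOn (fun p : ℝ × E n => ψ i p.1 p.2) (Icc 0 T ×ˢ univ))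
    {K : ℝ} (hK : 0 ≤ K) {γ : ℕ → ℝ} (hγ : Tendsto γ atTop atTop)
    {X V : ℕ → ℝ → E n} {Y W : ℕ → ℝ → E l}
    (S : ∀ k, BoundedPenaltySolution T ψ F G K (γ k) (X k) (V k) (Y k) (W k))
    {x : ℝ → E n} {y : ℝ → E l} (hX : TendstoUniformlyOn X x atTop (Icc 0 T))
    (hY : TendstoUniformlyOn Y y atTop (Icc 0 T)) :
    ∃ B : NNReal, LipschitzOnWith B x (Icc 0 T) ∧ LipschitzOnWith B y (Icc 0 T) ∧
      ∃ (v : ℝ → E n) (w : ℝ → E l), HasL1Deriv T x v ∧ HasL1Deriv T y w ∧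
        ∀ᵐ t ∂(volume.restrict (Icc 0 T)),
          (∃ ξ ∈ clarkeNormalCone (sweepSet ψ t) (x t), v t = F t (x t) (y t) - ξ) ∧
          w t = G t (x t) (y t) := by
  have hM := R.M_nonneg
  have hL := U.L_pos
  have h0T : (0 : ℝ) ∈ Icc 0 T := ⟨le_rfl, hT⟩
  have hfin : IsFiniteMeasure (volume.restrict (Icc 0 T)) := ⟨by simp⟩
  have hXt : ∀ t ∈ Icc 0 T, Tendsto (fun k => X k t) atTop (𝓝 (x t)) := fun t ht =>
    hX.tendsto_at ht
  have hYt : ∀ t ∈ Icc 0 T, Tendsto (fun k => Y k t) atTop (𝓝 (y t)) := fun t ht =>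
    hY.tendsto_at ht
  have hXc : ∀ k, ContinuousOn (X k) (Icc 0 T) := fun k => (S k).hasL1Deriv_fst.continuousOn hT
  have hYc : ∀ k, ContinuousOn (Y k) (Icc 0 T) := fun k => (S k).hasL1Deriv_snd.continuousOn hT
  have hmem : ∀ t ∈ Icc 0 T, x t ∈ sweepSet ψ t := by
    intro t ht i
    have hc : Continuous (fun z => ψ i t z) :=
      (hψ i).comp_continuous (f := fun z : E n => (t, z)) (by fun_prop) fun z => ⟨ht, mem_univ _⟩
    exact le_of_tendsto' ((hc.tendsto (x t)).comp (hXt t ht)) fun k => (S k).mem ht i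
  -- common Lipschitz constant
  set B : NNReal := ⟨M + K * L, by positivity⟩ with hB
  have hFb : ∀ k, ∀ᵐ t, t ∈ Icc 0 T →
      ‖F t (X k t) (Y k t)‖ ≤ M ∧ ‖G t (X k t) (Y k t)‖ ≤ M := fun k => by
    filter_upwards [(ae_restrict_iff' measurableSet_Icc).1 R.bound] with t h ht
    exact h ht _ ((S k).mem ht) _
  have hVb : ∀ k, ∀ᵐ t, t ∈ Icc 0 T → ‖V k t‖ ≤ B := fun k => by
    filter_upwards [hFb k, (ae_restrict_iff' measurableSet_Icc).1 (S k).ode] with t h1 h2 ht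
    rw [(h2 ht).1]
    have h3 := U.norm_expPenalty_le (S k).γ_pos.le ht ((S k).mem ht)
    have h4 := mul_le_mul_of_nonneg_right ((S k).le_K t ht) hL.le
    exact (norm_sub_le _ _).trans (add_le_add (h1 ht).1 (h3.trans h4))
  have hWb : ∀ k, ∀ᵐ t, t ∈ Icc 0 T → ‖W k t‖ ≤ B := fun k => by
    filter_upwards [hFb k, (ae_restrict_iff' measurableSet_Icc).1 (S k).ode] with t h1 h2 ht
    rw [(h2 ht).2]
    have h3 : 0 ≤ K * L := by positivity
    exact (h1 ht).2.trans (le_add_of_nonneg_right h3)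
  have hxL : LipschitzOnWith B x (Icc 0 T) := LipschitzOnWith.of_dist_le_mul fun s hs t ht =>
    le_of_tendsto' ((hXt s hs).dist (hXt t ht)) fun k => by
      rw [dist_eq_norm, Real.dist_eq]
      exact (S k).hasL1Deriv_fst.norm_sub_le (hVb k) ht hs
  have hyL : LipschitzOnWith B y (Icc 0 T) := LipschitzOnWith.of_dist_le_mul fun s hs t ht =>
    le_of_tendsto' ((hYt s hs).dist (hYt t ht)) fun k => by
      rw [dist_eq_norm, Real.dist_eq]
      exact (S k).hasL1Deriv_snd.norm_sub_le (hWb k) ht hs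
  -- integrability and convergence of the fields along the trajectories
  have hint : ∀ {x : ℝ → E n} {y : ℝ → E l}, ContinuousOn x (Icc 0 T) → ContinuousOn y (Icc 0 T) →
      (∀ t ∈ Icc 0 T, x t ∈ sweepSet ψ t) →
      IntegrableOn (fun t => F t (x t) (y t)) (Icc 0 T) ∧
      IntegrableOn (fun t => G t (x t) (y t)) (Icc 0 T) := by
    intro x y hx hy hC
    have hm := R.aemeasurable_comp U hψ hx hy hC
    refine ⟨Integrable.of_bound hm.1.aestronglyMeasurable M ?_,
      Integrable.of_bound hm.2.aestronglyMeasurable M ?_⟩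
    · filter_upwards [R.bound, ae_restrict_mem measurableSet_Icc] with t h ht
      exact (h _ (hC t ht) _).1
    · filter_upwards [R.bound, ae_restrict_mem measurableSet_Icc] with t h ht
      exact (h _ (hC t ht) _).2
  have hintk := fun k => hint (hXc k) (hYc k) fun t ht => (S k).mem ht
  have hint0 := hint hxL.continuousOn hyL.continuousOn hmem
  have hconv : ∀ᵐ t, t ∈ Icc 0 T →
      Tendsto (fun k => F t (X k t) (Y k t)) atTop (𝓝 (F t (x t) (y t))) ∧
      Tendsto (fun k => G t (X k t) (Y k t)) atTop (𝓝 (G t (x t) (y t))) := by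
    filter_upwards [(ae_restrict_iff' measurableSet_Icc).1 R.lipschitz] with t h ht
    have h1 : Tendsto (fun k => Λ t * (‖X k t - x t‖ + ‖Y k t - y t‖)) atTop (𝓝 0) := by
      have := ((tendsto_iff_norm_sub_tendsto_zero.1 (hXt t ht)).add
        (tendsto_iff_norm_sub_tendsto_zero.1 (hYt t ht))).const_mul (Λ t)
      simpa using this
    exact ⟨tendsto_iff_norm_sub_tendsto_zero.2 (squeeze_zero (fun _ => norm_nonneg _)
        (fun k => (h ht _ ((S k).mem ht) _ (hmem t ht) _ _).1) h1),
      tendsto_iff_norm_sub_tendsto_zero.2 (squeeze_zero (fun _ => norm_nonneg _)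
        (fun k => (h ht _ ((S k).mem ht) _ (hmem t ht) _ _).2) h1)⟩
  have hsub : ∀ {t}, t ∈ Icc 0 T → uIoc 0 t ⊆ Icc 0 T := fun ht =>
    uIoc_subset_uIcc.trans (uIcc_subset_Icc h0T ht)
  have hFint : ∀ t ∈ Icc 0 T, Tendsto (fun k => ∫ s in (0 : ℝ)..t, F s (X k s) (Y k s)) atTop
      (𝓝 (∫ s in (0 : ℝ)..t, F s (x s) (y s))) := by
    intro t ht
    refine intervalIntegral.tendsto_integral_filter_of_dominated_convergence (fun _ => M)
      (Eventually.of_forall fun k => ?_) (Eventually.of_forall fun k => ?_) (by simp) ?_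
    · exact ((hintk k).1.mono_set (hsub ht)).aestronglyMeasurable
    · filter_upwards [hFb k] with s hs hst using (hs (hsub ht hst)).1
    · filter_upwards [hconv] with s hs hst using (hs (hsub ht hst)).1
  have hGint : ∀ t ∈ Icc 0 T, Tendsto (fun k => ∫ s in (0 : ℝ)..t, G s (X k s) (Y k s)) atTop
      (𝓝 (∫ s in (0 : ℝ)..t, G s (x s) (y s))) := by
    intro t ht
    refine intervalIntegral.tendsto_integral_filter_of_dominated_convergence (fun _ => M)
      (Eventually.of_forall fun k => ?_) (Eventually.of_forall fun k => ?_) (by simp) ?_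
    · exact ((hintk k).2.mono_set (hsub ht)).aestronglyMeasurable
    · filter_upwards [hFb k] with s hs hst using (hs (hsub ht hst)).2
    · filter_upwards [hconv] with s hs hst using (hs (hsub ht hst)).2
  have hyD : HasL1Deriv T y (fun t => G t (x t) (y t)) := by
    refine ⟨hint0.2, fun t ht => ?_⟩
    refine tendsto_nhds_unique (hYt t ht) (((hYt 0 h0T).add (hGint t ht)).congr fun k => ?_)
    rw [(S k).hasL1Deriv_snd.2 t ht]
    congr 1
    refine intervalIntegral.integral_congr_ae ?_
    filter_upwards [(ae_restrict_iff' measurableSet_Icc).1 (S k).ode] with s hs hst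
    exact (hs (hsub ht hst)).2.symm
  have hxD := hasL1Deriv_of_lipschitzOnWith hT hxL
  refine ⟨B, hxL, hyL, deriv x, _, hxD, hyD, ?_⟩
  -- the defects `∫ F - x` and their limit
  have hprim : ∀ {p : ℝ → E n}, IntegrableOn p (Icc 0 T) →
      HasL1Deriv T (fun t => ∫ s in (0 : ℝ)..t, p s) p := fun hp => ⟨hp, fun t _ => by simp⟩
  have hDk := fun k => (hprim (hintk k).1).sub (S k).hasL1Deriv_fst
  have hD0 := (hprim hint0.1).sub hxD
  have hlim : ∀ t ∈ Icc 0 T, Tendsto (fun k => (∫ s in (0 : ℝ)..t, F s (X k s) (Y k s)) - X k t)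
      atTop (𝓝 ((∫ s in (0 : ℝ)..t, F s (x s) (y s)) - x t)) := fun t ht =>
    (hFint t ht).sub (hXt t ht)
  have hIoo : ∀ᵐ t ∂(volume.restrict (Icc 0 T)), t ∈ Ioo 0 T := by
    rw [← restrict_Ioo_eq_restrict_Icc]
    exact ae_restrict_mem measurableSet_Ioo
  filter_upwards [ae_restrict_of_ae (hD0.ae_hasDerivAt hT), hIoo] with t hder htI
  have ht := Ioo_subset_Icc_self htI
  refine ⟨⟨F t (x t) (y t) - deriv x t, ?_, by abel⟩, rfl⟩
  refine U.mem_clarkeNormalCone ht (hmem t ht) fun v hv => le_of_forall_pos_le_add fun ω hω => ?_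
  rw [zero_add]
  obtain ⟨δ, hδ, hev⟩ := U.eventually_inner_expPenalty_le hK ht (hmem t ht) hv hω
  have hder' : HasDerivAt (fun s => inner ℝ ((∫ τ in (0 : ℝ)..s, F τ (x τ) (y τ)) - x s) v)
      (inner ℝ (F t (x t) (y t) - deriv x t) v) t := by
    simpa using (hder htI).inner ℝ (hasDerivAt_const t v)
  have hslope := (hasDerivWithinAt_iff_tendsto_slope' (by simp)).1
    (hder'.hasDerivWithinAt (s := Ioi t))
  refine le_of_tendsto hslope ?_
  set h₀ := δ / (2 * (1 + B)) with hh₀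
  have hB0 : (0 : ℝ) ≤ B := B.2
  have hh₀pos : 0 < h₀ := by positivity
  filter_upwards [Ioo_mem_nhdsGT htI.2, Ioo_mem_nhdsGT (show t < t + h₀ by linarith)]
    with b hbT hbh
  have hb : b ∈ Icc 0 T := ⟨ht.1.trans hbT.1.le, hbT.2.le⟩
  have hpos : 0 < b - t := sub_pos.2 hbT.1
  rw [slope_def_field, div_le_iff₀ hpos]
  refine le_of_tendsto (((hlim b hb).inner tendsto_const_nhds).sub
    ((hlim t ht).inner tendsto_const_nhds)) ?_
  have hclose := Metric.tendstoUniformlyOn_iff.1 hX (δ / 2) (half_pos hδ)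
  filter_upwards [hγ.eventually hev, hclose] with k hk hkX
  rw [← inner_sub_left, (hDk k).sub_eq_integral ht hb, real_inner_comm]
  have hi := (hDk k).intervalIntegrable ht hb
  have hcomm := (innerSL ℝ v).intervalIntegral_comp_comm hi
  simp only [innerSL_apply_apply] at hcomm
  rw [← hcomm]
  have hi' : IntervalIntegrable (fun s => inner ℝ v (F s (X k s) (Y k s) - V k s)) volume t b :=
    ⟨(innerSL ℝ v).integrable_comp hi.1, (innerSL ℝ v).integrable_comp hi.2⟩
  have hle : ∫ s in t..b, inner ℝ v (F s (X k s) (Y k s) - V k s) ≤ ∫ _s in t..b, ω := by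
    refine intervalIntegral.integral_mono_ae_restrict hbT.1.le hi' (by simp) ?_
    rw [EventuallyLE, ae_restrict_iff' measurableSet_Icc]
    filter_upwards [(ae_restrict_iff' measurableSet_Icc).1 (S k).ode] with s hs hst
    have hsT : s ∈ Icc 0 T := ⟨ht.1.trans hst.1, hst.2.trans hb.2⟩
    rw [(hs hsT).1, sub_sub_cancel, real_inner_comm]
    refine hk s hsT _ ((S k).mem hsT) ?_ ((S k).le_K s hsT)
    have d1 : |s - t| ≤ h₀ := by
      rw [abs_of_nonneg (sub_nonneg.2 hst.1)]; linarith [hst.2, hbh.2]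
    have d2 : ‖X k s - x s‖ ≤ δ / 2 := by
      rw [← dist_eq_norm, dist_comm]; exact (hkX s hsT).le
    have d3 : ‖x s - x t‖ ≤ B * |s - t| := by
      rw [← dist_eq_norm, ← Real.dist_eq]; exact hxL.dist_le_mul s hsT t ht
    have d4 : ‖X k s - x t‖ ≤ ‖X k s - x s‖ + ‖x s - x t‖ := norm_sub_le_norm_sub_add_norm_sub _ _ _
    have d5 : (1 + B) * |s - t| ≤ δ / 2 := by
      calc (1 + B) * |s - t| ≤ (1 + B) * h₀ := by gcongr
        _ = δ / 2 := by rw [hh₀]; field_simp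
    linarith
  refine hle.trans ?_
  rw [intervalIntegral.integral_const, smul_eq_mul, mul_comm]

/-- Suitable initial points `c k → x₀` in the interior of `C(0)`, at distance of order
`log γ / γ` from `x₀`, keep the multipliers bounded uniformly in the penalty parameter. -/
theorem exists_boundedPenaltySolutions (R : RegularField T ψ F G M Λ)
    (U : UniformGenerators T ψ ρ L κ η ε) (hT : 0 ≤ T)
    (hψ : ∀ i, ContinuousOn (fun p : ℝ × E n => ψ i p.1 p.2) (Icc 0 T ×ˢ univ))
    {x₀ : E n} (hx₀ : x₀ ∈ sweepSet ψ 0) (y₀ : E l) {γ : ℕ → ℝ} (hγ : Tendsto γ atTop atTop) :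
    ∃ (K : ℝ) (c : ℕ → E n) (X V : ℕ → ℝ → E n) (Y W : ℕ → ℝ → E l), 0 ≤ K ∧
      Tendsto c atTop (𝓝 x₀) ∧ ∀ᶠ k in atTop,
        BoundedPenaltySolution T ψ F G K (γ k) (X k) (V k) (Y k) (W k) ∧
        X k 0 = c k ∧ Y k 0 = y₀ := by
  have hη := U.η_pos
  have hL := U.L_pos
  have hM := R.M_nonneg
  obtain ⟨d, hd⟩ := U.exists_inward_path ⟨le_rfl, hT⟩ hx₀
  set K : ℝ := r + 2 / η * (2 * L / η + M) with hKdef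
  have hr : (0 : ℝ) ≤ r := Nat.cast_nonneg r
  have hK1 : 2 * L / η + M ≤ η / 2 * K := by
    have e : η / 2 * K = η / 2 * r + (2 * L / η + M) := by rw [hKdef]; field_simp
    rw [e]
    have : 0 ≤ η / 2 * r := by positivity
    linarith
  have hK2 : (r : ℝ) ≤ K := le_add_of_nonneg_right (by positivity)
  have hK0 : 0 < K := by positivity
  -- the step `s` is chosen so that `γ exp(-γ (η / 2) s) = 1`
  set s : ℝ → ℝ := fun g => 2 / η * (Real.log g / g) with hs
  have hs0 : Tendsto s atTop (𝓝 0) := by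
    have : Tendsto (fun g : ℝ => Real.log g / g) atTop (𝓝 0) :=
      Real.isLittleO_log_id_atTop.tendsto_div_nhds_zero
    simpa using this.const_mul (2 / η)
  have hs1 : ∀ᶠ g : ℝ in atTop, 0 < s g := by
    filter_upwards [eventually_gt_atTop 1] with g hg
    have := Real.log_pos hg
    have : 0 < g := by linarith
    positivity
  have hs2 : Tendsto s atTop (𝓝[>] 0) := tendsto_nhdsWithin_iff.2 ⟨hs0, hs1⟩
  have hlim : Tendsto (fun g : ℝ => (η + L) * (r * (g * Real.exp (-(g * ε))))) atTop (𝓝 0) := by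
    simpa using ((tendsto_mul_exp_neg_mul U.ε_pos).const_mul (r : ℝ)).const_mul (η + L)
  have hgood : ∀ᶠ g : ℝ in atTop, 0 < g ∧ K < g ∧
      (η + L) * (r * (g * Real.exp (-(g * ε)))) ≤ η / 2 * K ∧
      g * expSum ψ g 0 (x₀ + s g • d) ≤ K := by
    filter_upwards [eventually_gt_atTop 0, eventually_gt_atTop K,
      hlim.eventually_le_const (show 0 < η / 2 * K by positivity), hs2.eventually hd]
      with g h1 h2 h3 h4
    refine ⟨h1, h2, h3, le_trans ?_ hK2⟩
    rw [expSum, Finset.mul_sum]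
    calc _ ≤ ∑ _i : Fin r, (1 : ℝ) := Finset.sum_le_sum fun i _ => ?_
      _ = r := by simp
    have h5 : g * ψ i 0 (x₀ + s g • d) ≤ -Real.log g := by
      have h6 := mul_le_mul_of_nonneg_left (h4 i) h1.le
      have e : g * (-(η / 2) * s g) = -Real.log g := by simp only [hs]; field_simp
      rwa [e] at h6
    calc g * Real.exp (g * ψ i 0 (x₀ + s g • d)) ≤ g * Real.exp (-Real.log g) := by gcongr
      _ = 1 := by rw [Real.exp_neg, Real.exp_log h1, mul_inv_cancel₀ h1.ne']
  have hex : ∀ k, ∃ (x v : ℝ → E n) (y w : ℝ → E l), (0 < γ k ∧ K < γ k ∧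
      (η + L) * (r * (γ k * Real.exp (-(γ k * ε)))) ≤ η / 2 * K ∧
      γ k * expSum ψ (γ k) 0 (x₀ + s (γ k) • d) ≤ K) →
      BoundedPenaltySolution T ψ F G K (γ k) x v y w ∧ x 0 = x₀ + s (γ k) • d ∧ y 0 = y₀ := by
    intro k
    by_cases h : 0 < γ k ∧ K < γ k ∧
      (η + L) * (r * (γ k * Real.exp (-(γ k * ε)))) ≤ η / 2 * K ∧
      γ k * expSum ψ (γ k) 0 (x₀ + s (γ k) • d) ≤ K
    · obtain ⟨x, v, y, w, h1, h2, h3, h4, h5, h6⟩ :=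
        R.exists_penalty_solution U hT hψ h.1 h.2.1 hK1 h.2.2.1 h.2.2.2 y₀
      exact ⟨x, v, y, w, fun _ => ⟨⟨h.1, h.2.1, h3, h4, h5, h6⟩, h1, h2⟩⟩
    · exact ⟨0, 0, 0, 0, fun h' => absurd h' h⟩
  choose X V Y W hXY using hex
  refine ⟨K, fun k => x₀ + s (γ k) • d, X, V, Y, W, hK0.le, ?_, ?_⟩
  · have := ((hs0.comp hγ).smul_const d).const_add x₀
    simpa using this
  · filter_upwards [hγ.eventually hgood] with k hk using hXY k hk

/-- Penalized trajectories with bounded multipliers whose initial points converge form a uniformly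
Cauchy sequence, and their limit solves the sweeping process. -/
theorem exists_solution_of_boundedPenaltySolutions (R : RegularField T ψ F G M Λ)
    (U : UniformGenerators T ψ ρ L κ η ε) (hT : 0 ≤ T)
    (hψ : ∀ i, ContinuousOn (fun p : ℝ × E n => ψ i p.1 p.2) (Icc 0 T ×ˢ univ))
    {x₀ : E n} {y₀ : E l} {K : ℝ} (hK : 0 ≤ K) {γ : ℕ → ℝ} (hγ : Tendsto γ atTop atTop)
    {c : ℕ → E n} (hc : Tendsto c atTop (𝓝 x₀)) {X V : ℕ → ℝ → E n} {Y W : ℕ → ℝ → E l}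
    (S : ∀ k, BoundedPenaltySolution T ψ F G K (γ k) (X k) (V k) (Y k) (W k))
    (hX0 : ∀ k, X k 0 = c k) (hY0 : ∀ k, Y k 0 = y₀) :
    ∃ (x : ℝ → E n) (y : ℝ → E l), TendstoUniformlyOn X x atTop (Icc 0 T) ∧
      TendstoUniformlyOn Y y atTop (Icc 0 T) ∧ x 0 = x₀ ∧ y 0 = y₀ ∧
      ∃ B : NNReal, LipschitzOnWith B x (Icc 0 T) ∧ LipschitzOnWith B y (Icc 0 T) ∧
        ∃ (v : ℝ → E n) (w : ℝ → E l), HasL1Deriv T x v ∧ HasL1Deriv T y w ∧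
          ∀ᵐ t ∂(volume.restrict (Icc 0 T)),
            (∃ ξ ∈ clarkeNormalCone (sweepSet ψ t) (x t), v t = F t (x t) (y t) - ξ) ∧
            w t = G t (x t) (y t) := by
  have h0T : (0 : ℝ) ∈ Icc 0 T := ⟨le_rfl, hT⟩
  set A := Real.exp (∫ t in (0 : ℝ)..T, (4 * Λ t + 4 * (K * κ)))
  have hsq : Tendsto (fun k => √(K / γ k)) atTop (𝓝 0) := by
    have := (Real.continuous_sqrt.tendsto 0).comp (hγ.const_div_atTop K)
    simpa [Function.comp_def] using this
  have he : Tendsto (fun p : ℕ × ℕ => (‖c p.1 - c p.2‖ ^ 2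
      + T * (2 * r * (√(K / γ p.1) + √(K / γ p.2)))) * A) atTop (𝓝 0) := by
    rw [← prod_atTop_atTop_eq]
    have t1 : Tendsto Prod.fst ((atTop : Filter ℕ) ×ˢ (atTop : Filter ℕ)) atTop := tendsto_fst
    have t2 : Tendsto Prod.snd ((atTop : Filter ℕ) ×ˢ (atTop : Filter ℕ)) atTop := tendsto_snd
    have h1 := ((hc.comp t1).sub (hc.comp t2)).norm.pow 2
    have h2 := (((hsq.comp t1).add (hsq.comp t2)).const_mul (2 * (r : ℝ))).const_mul T
    simpa using (h1.add h2).mul_const A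
  obtain ⟨x, y, hX, hY⟩ := exists_tendstoUniformlyOn_of_norm_sq_le he fun j k t ht => by
    have := (S j).norm_sq_sub_le (S k) R U hT hK ((hY0 j).trans (hY0 k).symm) t ht
    rwa [hX0, hX0] at this
  refine ⟨x, y, hX, hY, ?_, ?_, isSolution_of_tendstoUniformlyOn R U hT hψ hK hγ S hX hY⟩
  · exact tendsto_nhds_unique ((hX.tendsto_at h0T).congr hX0) hc
  · exact tendsto_nhds_unique ((hY.tendsto_at h0T).congr hY0) tendsto_const_nhds

end CoupledSweeping

theorem theorem2p2 {n l m r : ℕ} (T : ℝ) (hT : 0 < T)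
    (ψ : Fin r → ℝ → CoupledSweeping.E n → ℝ)
    (f : ℝ → CoupledSweeping.E n → CoupledSweeping.E l → CoupledSweeping.E m →
      CoupledSweeping.E n)
    (g : ℝ → CoupledSweeping.E n → CoupledSweeping.E l → CoupledSweeping.E m →
      CoupledSweeping.E l)
    (U : ℝ → Set (CoupledSweeping.E m))
    (hψ : ∀ i, ContinuousOn (fun p : ℝ × CoupledSweeping.E n => ψ i p.1 p.2)
      (Icc 0 T ×ˢ univ))
    (hne : ∀ t ∈ Icc 0 T, (CoupledSweeping.sweepSet ψ t).Nonempty)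
    (hbdd : Bornology.IsBounded (CoupledSweeping.sweepGraph T ψ))
    (hreg : CoupledSweeping.GeneratorsRegular T ψ)
    (hcq : CoupledSweeping.ConstraintQualification T ψ)
    (hh : CoupledSweeping.PerturbationRegular T ψ f g U)
    (x₀ : CoupledSweeping.E n) (hx₀ : x₀ ∈ CoupledSweeping.sweepSet ψ 0)
    (y₀ : CoupledSweeping.E l)
    (u : ℝ → CoupledSweeping.E m) (hu : CoupledSweeping.IsControl T U u)
    -- measurability in `t` of the data along the control, at fixed `(x,y)`, while `x ∈ C(t)`
    (hmeas : ∀ (x : CoupledSweeping.E n) (y : CoupledSweeping.E l),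
      AEMeasurable (fun t => f t x y (u t))
        (volume.restrict {t | t ∈ Icc 0 T ∧ x ∈ CoupledSweeping.sweepSet ψ t}) ∧
      AEMeasurable (fun t => g t x y (u t))
        (volume.restrict {t | t ∈ Icc 0 T ∧ x ∈ CoupledSweeping.sweepSet ψ t})) :
    ∃ (x : ℝ → CoupledSweeping.E n) (y : ℝ → CoupledSweeping.E l),
      -- existence
      CoupledSweeping.IsSweepingSolution T ψ f g u x₀ y₀ x y ∧
      -- uniqueness
      (∀ (x' : ℝ → CoupledSweeping.E n) (y' : ℝ → CoupledSweeping.E l),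
        CoupledSweeping.IsSweepingSolution T ψ f g u x₀ y₀ x' y' →
        EqOn x' x (Icc 0 T) ∧ EqOn y' y (Icc 0 T)) ∧
      -- Lipschitz continuity
      (∃ K : NNReal, LipschitzOnWith K x (Icc 0 T) ∧ LipschitzOnWith K y (Icc 0 T)) ∧
      -- approximation by the exponential-penalty systems
      (∀ γ : ℕ → ℝ, Tendsto γ atTop atTop →
        ∃ (c : ℕ → CoupledSweeping.E n) (X : ℕ → ℝ → CoupledSweeping.E n)
          (Y : ℕ → ℝ → CoupledSweeping.E l),
          Tendsto c atTop (𝓝 x₀) ∧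
          (∀ᶠ k in atTop,
            CoupledSweeping.IsPenaltySolution T ψ f g u (γ k) (c k) y₀ (X k) (Y k) ∧
            (∀ (x' : ℝ → CoupledSweeping.E n) (y' : ℝ → CoupledSweeping.E l),
              CoupledSweeping.IsPenaltySolution T ψ f g u (γ k) (c k) y₀ x' y' →
              EqOn x' (X k) (Icc 0 T) ∧ EqOn y' (Y k) (Icc 0 T)) ∧
            ∀ t ∈ Icc 0 T, X k t ∈ interior (CoupledSweeping.sweepSet ψ t)) ∧
          ∃ φ : ℕ → ℕ, StrictMono φ ∧
            TendstoUniformlyOn (fun k => X (φ k)) x atTop (Icc 0 T) ∧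
            TendstoUniformlyOn (fun k => Y (φ k)) y atTop (Icc 0 T)) := by
  obtain ⟨ρ, L, κ, η, ε, hU⟩ := CoupledSweeping.exists_uniformGenerators hψ hbdd hreg hcq
  obtain ⟨M, Λ, R⟩ := hh.exists_regularField hu hmeas
  have hT0 := hT.le
  have huniq : ∀ {x x' : ℝ → CoupledSweeping.E n} {y y' : ℝ → CoupledSweeping.E l},
      CoupledSweeping.IsSweepingSolution T ψ f g u x₀ y₀ x y →
      CoupledSweeping.IsSweepingSolution T ψ f g u x₀ y₀ x' y' →
      EqOn x' x (Icc 0 T) ∧ EqOn y' y (Icc 0 T) := by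
    rintro x x' y y' ⟨h1, h2, v, w, hv, hw, h⟩ ⟨h1', h2', v', w', hv', hw', h'⟩
    exact R.sweeping_unique hU hT0 hv' hv hw' hw h' h (h1'.trans h1.symm) (h2'.trans h2.symm)
  -- every sequence of penalty parameters yields a solution of the sweeping process
  have happrox : ∀ γ : ℕ → ℝ, Tendsto γ atTop atTop →
      ∃ (c : ℕ → CoupledSweeping.E n) (X : ℕ → ℝ → CoupledSweeping.E n)
        (Y : ℕ → ℝ → CoupledSweeping.E l) (x : ℝ → CoupledSweeping.E n)
        (y : ℝ → CoupledSweeping.E l) (N : ℕ),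
        Tendsto c atTop (𝓝 x₀) ∧
        (∀ᶠ k in atTop,
          CoupledSweeping.IsPenaltySolution T ψ f g u (γ k) (c k) y₀ (X k) (Y k) ∧
          (∀ (x' : ℝ → CoupledSweeping.E n) (y' : ℝ → CoupledSweeping.E l),
            CoupledSweeping.IsPenaltySolution T ψ f g u (γ k) (c k) y₀ x' y' →
            EqOn x' (X k) (Icc 0 T) ∧ EqOn y' (Y k) (Icc 0 T)) ∧
          ∀ t ∈ Icc 0 T, X k t ∈ interior (CoupledSweeping.sweepSet ψ t)) ∧
        TendstoUniformlyOn (fun k => X (k + N)) x atTop (Icc 0 T) ∧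
        TendstoUniformlyOn (fun k => Y (k + N)) y atTop (Icc 0 T) ∧
        CoupledSweeping.IsSweepingSolution T ψ f g u x₀ y₀ x y ∧
        ∃ B : NNReal, LipschitzOnWith B x (Icc 0 T) ∧ LipschitzOnWith B y (Icc 0 T) := by
    intro γ hγ
    obtain ⟨K, c, X, V, Y, W, hK, hc, hev⟩ :=
      CoupledSweeping.exists_boundedPenaltySolutions R hU hT0 hψ hx₀ y₀ hγ
    obtain ⟨N, hN⟩ := eventually_atTop.1 hev
    have hS := fun k => hN (k + N) (Nat.le_add_left N k)
    obtain ⟨x, y, hX, hY, hx0, hy0, B, hBx, hBy, v, w, hv, hw, h⟩ :=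
      CoupledSweeping.exists_solution_of_boundedPenaltySolutions R hU hT0 hψ hK
        (hγ.comp (tendsto_add_atTop_nat N)) (hc.comp (tendsto_add_atTop_nat N))
        (fun k => (hS k).1) (fun k => (hS k).2.1) (fun k => (hS k).2.2)
    refine ⟨c, X, Y, x, y, N, hc, ?_, hX, hY, ⟨hx0, hy0, v, w, hv, hw, h⟩, B, hBx, hBy⟩
    filter_upwards [hev] with k ⟨S, hX0, hY0⟩
    refine ⟨⟨hX0, hY0, V k, W k, S.hasL1Deriv_fst, S.hasL1Deriv_snd, S.ode⟩, ?_, fun t ht =>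
      CoupledSweeping.mem_interior_sweepSet hψ ht (S.lt_zero ht)⟩
    rintro x' y' ⟨h1, h2, v', w', hv', hw', h'⟩
    exact (R.sub_expPenalty hU hψ S.γ_pos.le).eqOn_of_strict hT0 hψ S.hasL1Deriv_fst hv'
      S.hasL1Deriv_snd hw' S.ode h' (fun t ht => S.lt_zero ht) (h1.trans hX0.symm)
      (h2.trans hY0.symm)
  obtain ⟨-, -, -, x, y, -, -, -, -, -, hsol, hlip⟩ :=
    happrox (fun k : ℕ => (k : ℝ)) tendsto_natCast_atTop_atTop
  refine ⟨x, y, hsol, fun x' y' h' => huniq hsol h', hlip, fun γ hγ => ?_⟩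
  obtain ⟨c, X, Y, x', y', N, hc, hev, hX, hY, hsol', -⟩ := happrox γ hγ
  have heq := huniq hsol hsol'
  exact ⟨c, X, Y, hc, hev, fun k => k + N, strictMono_id.add_const N, hX.congr_right heq.1,
    hY.congr_right heq.2⟩
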